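/- Let $T$ be a locally finite tree and let $G = T\times K_2$ be the Cartesian product, i.e. the graph with vertex set $V(T)\times V(K_2)$ in which two vertices are adjacent iff they agree in one coordinate and are adjacent in the other. Let $\Psi$ be any set of ends of $G$ (equivalence classes of rays, two rays being equivalent if no finite set of vertices separates them). Then $(G,\Psi)$ induces a matroid: there is a (possibly infinite) matroid $M$ with ground set $E(G)$ whose circuits are exactly the $\Psi$-circuits of $G$ and whose cocircuits are exactly the $\Psi^{\complement}$-bonds of $G$. Here $|G|$ is the set $V(G)\sqcup\Omega(G)\sqcup\big((0,1)\times E(G)\big)$, where $\Omega(G)$ is the set of ends of $G$, with the following topology (VTOP). Basic open neighbourhoods of vertices and of inner points of edges are the small $\varepsilon$-balls in the 1-complex of $G$ (each edge having length $1$): $0<\varepsilon\le 1$ at a vertex, and $0<\varepsilon\le\min(x,1-x)$ at $(x,e)$. Those of an end $\omega$ are the sets $\hat C(S,\omega)$ for finite $S\subseteq V(G)$: if $C(S,\omega)$ is the component of $G-S$ containing a ray of $\omega$, then $\hat C(S,\omega)$ consists of the vertices of $C(S,\omega)$, all inner points of edges having an endvertex in $C(S,\omega)$, and all ends represented by a ray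 in $C(S,\omega)$. Let $|G|_\Psi$ be the subspace $|G|\setminus(\Omega(G)\setminus\Psi)$. The space $\tilde G_\Psi$ is the topological quotient of $|G|_\Psi$ obtained by identifying two elements of $V(G)\cup\Psi$ whenever they lie on the same side of every partition of $V(G)\cup\Psi$ induced by two disjoint open subsets of $|G|_\Psi$ that together cover $V(G)\cup\Psi$. The closure of a set of edges in one of these spaces means the closure of the set of all inner points of those edges. A $\Psi$-circuit is a set of edges of $G$ whose closure in $\tilde G_\Psi$ is homeomorphic to the unit circle. A cut is the set of all edges of $G$ between some $X\subseteq V(G)$ and $V(G)\setminus X$; it is $\Psi$-bounded if its closure in $|G|_\Psi$ contains no end. A $\Psi^{\complement}$-bond is a minimal nonempty $\Psi$-bounded cut. -/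

import Mathlib

namespace PsiSystem

universe u

/-- A ray of `G`: a one-way infinite path `r 0, r 1, r 2, …` with distinct vertices. -/
structure Ray {V : Type u} (G : SimpleGraph V) where
  toFun : ℕ → V
  injective : Function.Injective toFun
  adj : ∀ n, G.Adj (toFun n) (toFun (n + 1))

/-- Some tail of the ray `r` lies in the set `X`. -/
def Ray.HasTailIn {V : Type u} {G : SimpleGraph V} (r : Ray G) (X : Set V) : Prop :=
  ∃ N, ∀ n, N ≤ n → r.toFun n ∈ X

/-- Two rays are equivalent if no finite set `S` of vertices separates them, that is, they have
tails in the same component of `G - S`. -/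
def RayEquiv {V : Type u} {G : SimpleGraph V} (r r' : Ray G) : Prop :=
  ∀ S : Finset V, ∃ C : G.ComponentCompl (S : Set V),
    r.HasTailIn (C : Set V) ∧ r'.HasTailIn (C : Set V)

theorem Ray.exists_hasTailIn {V : Type u} {G : SimpleGraph V} (r : Ray G) (S : Finset V) :
    ∃ C : G.ComponentCompl (S : Set V), r.HasTailIn (C : Set V) := by
  have hfin : (r.toFun ⁻¹' (S : Set V)).Finite := S.finite_toSet.preimage r.injective.injOn
  obtain ⟨N, hN⟩ := hfin.bddAbove
  have hout : ∀ n, N + 1 ≤ n → r.toFun n ∉ (S : Set V) := fun n hn hmem => by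
    have := hN hmem
    omega
  refine ⟨G.componentComplMk (hout (N + 1) le_rfl), N + 1, fun n hn => ?_⟩
  induction n, hn using Nat.le_induction with
  | base => exact G.componentComplMk_mem _
  | succ k hk ih =>
    exact SimpleGraph.ComponentCompl.mem_of_adj _ _ ih (hout (k + 1) (by omega)) (r.adj k)

theorem Ray.hasTailIn_unique {V : Type u} {G : SimpleGraph V} {r : Ray G} {S : Set V}
    {C D : G.ComponentCompl S} (hC : r.HasTailIn (C : Set V)) (hD : r.HasTailIn (D : Set V)) :
    C = D := by
  obtain ⟨N, hN⟩ := hC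
  obtain ⟨M, hM⟩ := hD
  by_contra hne
  exact Set.disjoint_left.mp (SimpleGraph.ComponentCompl.pairwise_disjoint hne)
    (hN (max N M) (le_max_left _ _)) (hM (max N M) (le_max_right _ _))

instance raySetoid {V : Type u} (G : SimpleGraph V) : Setoid (Ray G) where
  r := RayEquiv
  iseqv :=
    { refl := fun r S => (r.exists_hasTailIn S).imp fun _ h => ⟨h, h⟩
      symm := fun h S => (h S).imp fun _ hC => ⟨hC.2, hC.1⟩
      trans := fun {a b c} h h' S => by
        obtain ⟨C, h1, h2⟩ := h S
        obtain ⟨D, h3, h4⟩ := h' S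
        obtain rfl := Ray.hasTailIn_unique h2 h3
        exact ⟨C, h1, h4⟩ }

/-- The ends of `G`: the equivalence classes of rays. -/
def Ends {V : Type u} (G : SimpleGraph V) : Type u := Quotient (raySetoid G)

/-- The end `ω` is represented by a ray all of whose vertices lie in `X`. -/
def Ends.LivesIn {V : Type u} {G : SimpleGraph V} (ω : Ends G) (X : Set V) : Prop :=
  ∃ r : Ray G, (Quotient.mk (raySetoid G) r : Ends G) = ω ∧ ∀ n, r.toFun n ∈ X

theorem Ends.exists_livesIn {V : Type u} {G : SimpleGraph V} (ω : Ends G) (S : Finset V) :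
    ∃ C : G.ComponentCompl (S : Set V), ω.LivesIn (C : Set V) := by
  obtain ⟨r, rfl⟩ := Quotient.exists_rep ω
  obtain ⟨C, N, hN⟩ := r.exists_hasTailIn S
  refine ⟨C, ⟨fun n => r.toFun (N + n), fun a b h => by simpa using r.injective h,
    fun n => r.adj (N + n)⟩, Quotient.sound fun S' => ?_, fun n => hN _ (by omega)⟩
  obtain ⟨D, M, hM⟩ := r.exists_hasTailIn S'
  exact ⟨D, ⟨M, fun n hn => hM _ (by omega)⟩, ⟨M, hM⟩⟩

/-- If an end has a ray inside `C` (a component of `G - S`) and one inside `D` (a component of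
`G - L`), where `S ⊆ L`, then `D ⊆ C`. -/
theorem Ends.LivesIn.subset {V : Type u} {G : SimpleGraph V} {ω : Ends G} {S L : Finset V}
    {C : G.ComponentCompl (S : Set V)} {D : G.ComponentCompl (L : Set V)}
    (hC : ω.LivesIn (C : Set V)) (hD : ω.LivesIn (D : Set V)) (h : S ⊆ L) :
    (D : Set V) ⊆ (C : Set V) := by
  obtain ⟨r, hr, hrC⟩ := hC
  obtain ⟨s, hs, hsD⟩ := hD
  have hL : (S : Set V) ⊆ (L : Set V) := by exact_mod_cast h
  obtain ⟨B, hB, hB'⟩ := (Quotient.exact (hr.trans hs.symm) : RayEquiv r s) S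
  obtain rfl := Ray.hasTailIn_unique ⟨0, fun n _ => hrC n⟩ hB
  have hsub := D.subset_hom hL
  have h2 := Ray.hasTailIn_unique ⟨0, fun n _ => hsub (hsD n)⟩ hB'
  rwa [h2] at hsub

/-- The points of `|G|`: vertices, ends, and the points `(x, e)` with `e` an edge, `0 < x < 1`. -/
inductive Pt {V : Type u} (G : SimpleGraph V) : Type u
  | vert (v : V) : Pt G
  | ending (ω : Ends G) : Pt G
  | inner (e : G.edgeSet) (x : Set.Ioo (0 : ℝ) 1) : Pt G

/-- The endvertex of `e` at which the parameter `x` of `(x, e)` tends to `0`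
(each edge is given an arbitrary fixed direction). -/
noncomputable def src {V : Type u} {G : SimpleGraph V} (e : G.edgeSet) : V := (Quot.out e.1).1

/-- The endvertex of `e` at which the parameter `x` of `(x, e)` tends to `1`. -/
noncomputable def tgt {V : Type u} {G : SimpleGraph V} (e : G.edgeSet) : V := (Quot.out e.1).2

/-- The open `ε`-ball about the vertex `v` in the 1-complex of `G` (for `ε ≤ 1`). -/
def vertBall {V : Type u} (G : SimpleGraph V) (v : V) (ε : ℝ) : Set (Pt G) :=
  {p | p = Pt.vert v ∨ ∃ (e : G.edgeSet) (x : Set.Ioo (0 : ℝ) 1), p = Pt.inner e x ∧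
    ((src e = v ∧ (x : ℝ) < ε) ∨ (tgt e = v ∧ 1 - (x : ℝ) < ε))}

/-- The open `ε`-ball about `(x, e)` in the 1-complex of `G` (for `ε ≤ min x (1 - x)`). -/
def innerBall {V : Type u} {G : SimpleGraph V} (e : G.edgeSet) (x : Set.Ioo (0 : ℝ) 1) (ε : ℝ) :
    Set (Pt G) :=
  {p | ∃ y : Set.Ioo (0 : ℝ) 1, p = Pt.inner e y ∧ |(y : ℝ) - (x : ℝ)| < ε}

/-- `Ĉ`, for a set `C` of vertices: the vertices in `C`, all inner points of the edges with at
least one endvertex in `C`, and the ends represented by a ray in `C`. -/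
def hat {V : Type u} (G : SimpleGraph V) (C : Set V) : Set (Pt G) :=
  {p | (∃ v ∈ C, p = Pt.vert v) ∨
    (∃ (e : G.edgeSet) (x : Set.Ioo (0 : ℝ) 1), p = Pt.inner e x ∧ (src e ∈ C ∨ tgt e ∈ C)) ∨
    (∃ ω : Ends G, p = Pt.ending ω ∧ ω.LivesIn C)}

theorem vertBall_mono {V : Type u} (G : SimpleGraph V) (v : V) {ε δ : ℝ} (h : ε ≤ δ) :
    vertBall G v ε ⊆ vertBall G v δ := by
  rintro p (hp | ⟨e, x, hp, hx⟩)
  · exact Or.inl hp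
  · exact Or.inr ⟨e, x, hp, hx.imp (fun h' => ⟨h'.1, h'.2.trans_le h⟩)
      (fun h' => ⟨h'.1, h'.2.trans_le h⟩)⟩

theorem innerBall_mono {V : Type u} {G : SimpleGraph V} (e : G.edgeSet)
    (x : Set.Ioo (0 : ℝ) 1) {ε δ : ℝ} (h : ε ≤ δ) : innerBall e x ε ⊆ innerBall e x δ := by
  rintro p ⟨y, hp, hy⟩
  exact ⟨y, hp, hy.trans_le h⟩

theorem hat_mono {V : Type u} (G : SimpleGraph V) {C D : Set V} (h : C ⊆ D) :
    hat G C ⊆ hat G D := by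
  rintro p (⟨v, hv, hp⟩ | ⟨e, x, hp, hx⟩ | ⟨ω, hp, r, hr, hrC⟩)
  · exact Or.inl ⟨v, h hv, hp⟩
  · exact Or.inr (Or.inl ⟨e, x, hp, hx.imp (fun h' => h h') (fun h' => h h')⟩)
  · exact Or.inr (Or.inr ⟨ω, hp, r, hr, fun n => h (hrC n)⟩)

/-- The topology VTOP of `|G|`. A set is open if with each of its points it includes a basic
neighbourhood of that point: an `ε`-ball about a vertex or about an inner point of an edge, and
`Ĉ(S, ω)` for an end `ω`, where `S` is a finite vertex set and `C(S, ω)` is the component of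
`G - S` that contains a ray from `ω`. -/
instance vtop {V : Type u} (G : SimpleGraph V) : TopologicalSpace (Pt G) where
  IsOpen U :=
    (∀ v, Pt.vert v ∈ U → ∃ ε : ℝ, 0 < ε ∧ ε ≤ 1 ∧ vertBall G v ε ⊆ U) ∧
    (∀ e x, Pt.inner e x ∈ U →
      ∃ ε : ℝ, 0 < ε ∧ ε ≤ min (x : ℝ) (1 - (x : ℝ)) ∧ innerBall e x ε ⊆ U) ∧
    (∀ ω, Pt.ending ω ∈ U → ∃ (S : Finset V) (C : G.ComponentCompl (S : Set V)),
      ω.LivesIn (C : Set V) ∧ hat G (C : Set V) ⊆ U)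
  isOpen_univ := by
    refine ⟨fun v _ => ⟨1, one_pos, le_rfl, Set.subset_univ _⟩, fun e x _ =>
      ⟨min (x : ℝ) (1 - (x : ℝ)), lt_min x.2.1 (sub_pos.2 x.2.2), le_rfl, Set.subset_univ _⟩,
      fun ω _ => ?_⟩
    obtain ⟨C, hC⟩ := ω.exists_livesIn ∅
    exact ⟨∅, C, hC, Set.subset_univ _⟩
  isOpen_inter := by
    classical
    rintro U W ⟨hU1, hU2, hU3⟩ ⟨hW1, hW2, hW3⟩
    refine ⟨fun v hv => ?_, fun e x hx => ?_, fun ω hω => ?_⟩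
    · obtain ⟨a, ha, ha1, hau⟩ := hU1 v hv.1
      obtain ⟨b, hb, _, hbw⟩ := hW1 v hv.2
      exact ⟨min a b, lt_min ha hb, (min_le_left _ _).trans ha1, Set.subset_inter
        ((vertBall_mono G v (min_le_left _ _)).trans hau)
        ((vertBall_mono G v (min_le_right _ _)).trans hbw)⟩
    · obtain ⟨a, ha, ha1, hau⟩ := hU2 e x hx.1
      obtain ⟨b, hb, _, hbw⟩ := hW2 e x hx.2
      exact ⟨min a b, lt_min ha hb, (min_le_left _ _).trans ha1, Set.subset_inter
        ((innerBall_mono e x (min_le_left _ _)).trans hau)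
        ((innerBall_mono e x (min_le_right _ _)).trans hbw)⟩
    · obtain ⟨S, C, hC, hCU⟩ := hU3 ω hω.1
      obtain ⟨L, D, hD, hDW⟩ := hW3 ω hω.2
      obtain ⟨B, hB⟩ := ω.exists_livesIn (S ∪ L)
      exact ⟨S ∪ L, B, hB, Set.subset_inter
        ((hat_mono G (hC.subset hB Finset.subset_union_left)).trans hCU)
        ((hat_mono G (hD.subset hB Finset.subset_union_right)).trans hDW)⟩
  isOpen_sUnion := by
    intro 𝒰 h
    refine ⟨fun v hv => ?_, fun e x hx => ?_, fun ω hω => ?_⟩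
    · obtain ⟨U, hU, hv⟩ := hv
      obtain ⟨a, ha, ha1, hau⟩ := (h U hU).1 v hv
      exact ⟨a, ha, ha1, hau.trans (Set.subset_sUnion_of_mem hU)⟩
    · obtain ⟨U, hU, hx⟩ := hx
      obtain ⟨a, ha, ha1, hau⟩ := (h U hU).2.1 e x hx
      exact ⟨a, ha, ha1, hau.trans (Set.subset_sUnion_of_mem hU)⟩
    · obtain ⟨U, hU, hω⟩ := hω
      obtain ⟨S, C, hC, hCU⟩ := (h U hU).2.2 ω hω
      exact ⟨S, C, hC, hCU.trans (Set.subset_sUnion_of_mem hU)⟩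

/-- The subspace `|G|_Ψ` of `|G|` obtained by removing the ends outside `Ψ`. -/
abbrev PsiSpace {V : Type u} {G : SimpleGraph V} (Ψ : Set (Ends G)) : Type u :=
  {p : Pt G // ∀ ω, p = Pt.ending ω → ω ∈ Ψ}

/-- The vertices of the almost graph-like space `|G|_Ψ` are the vertices of `G` and the ends
in `Ψ`, that is, all points which are not inner points of edges. -/
def IsVertex {V : Type u} {G : SimpleGraph V} {Ψ : Set (Ends G)} (p : PsiSpace Ψ) : Prop :=
  ∀ e x, p.1 ≠ Pt.inner e x

/-- No two disjoint open sets that partition the vertices of `|G|_Ψ` have `p` and `q` on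
different sides. -/
def NotSeparated {V : Type u} {G : SimpleGraph V} {Ψ : Set (Ends G)} (p q : PsiSpace Ψ) : Prop :=
  ∀ U W : Set (PsiSpace Ψ), IsOpen U → IsOpen W → Disjoint U W →
    (∀ a, IsVertex a → a ∈ U ∨ a ∈ W) → (p ∈ U ↔ q ∈ U)

/-- The identifications in the graph-like quotient: equivalent vertices are identified. -/
def tildeSetoid {V : Type u} {G : SimpleGraph V} (Ψ : Set (Ends G)) : Setoid (PsiSpace Ψ) where
  r p q := p = q ∨ (IsVertex p ∧ IsVertex q ∧ NotSeparated p q)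
  iseqv :=
    { refl := fun _ => Or.inl rfl
      symm := by
        rintro p q (rfl | ⟨hp, hq, h⟩)
        · exact Or.inl rfl
        · exact Or.inr ⟨hq, hp, fun U W hU hW hd hc => (h U W hU hW hd hc).symm⟩
      trans := by
        rintro p q s (rfl | ⟨hp, hq, h⟩) (rfl | ⟨hq', hs, h'⟩)
        · exact Or.inl rfl
        · exact Or.inr ⟨hq', hs, h'⟩
        · exact Or.inr ⟨hp, hq, h⟩
        · exact Or.inr ⟨hp, hs, fun U W hU hW hd hc =>
            (h U W hU hW hd hc).trans (h' U W hU hW hd hc)⟩ }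

/-- The graph-like quotient of `|G|_Ψ`, with the quotient topology. -/
abbrev TildeSpace {V : Type u} {G : SimpleGraph V} (Ψ : Set (Ends G)) : Type u :=
  Quotient (tildeSetoid Ψ)

/-- The set of inner points of the edges in `F`, in `|G|_Ψ`. -/
def edgePoints {V : Type u} {G : SimpleGraph V} (Ψ : Set (Ends G)) (F : Set (Sym2 V)) :
    Set (PsiSpace Ψ) :=
  {p | ∃ (e : G.edgeSet) (x : Set.Ioo (0 : ℝ) 1), (e : Sym2 V) ∈ F ∧ p.1 = Pt.inner e x}

/-- The set of inner points of the edges in `F`, in the graph-like quotient of `|G|_Ψ`. -/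
def tildeEdgePoints {V : Type u} {G : SimpleGraph V} (Ψ : Set (Ends G)) (F : Set (Sym2 V)) :
    Set (TildeSpace Ψ) :=
  Quotient.mk (tildeSetoid Ψ) '' edgePoints Ψ F

/-- A `Ψ`-circuit: an edge set whose closure in the graph-like quotient of `|G|_Ψ` is
homeomorphic to the unit circle. -/
def IsPsiCircuit {V : Type u} (G : SimpleGraph V) (Ψ : Set (Ends G)) (F : Set (Sym2 V)) : Prop :=
  F ⊆ G.edgeSet ∧ Nonempty (closure (tildeEdgePoints Ψ F) ≃ₜ Circle)

/-- A cut of `G`: the set of all edges between some vertex set `X` and its complement. -/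
def IsCut {V : Type u} (G : SimpleGraph V) (F : Set (Sym2 V)) : Prop :=
  ∃ X : Set V, F = {e | e ∈ G.edgeSet ∧ ∃ u v, e = s(u, v) ∧ u ∈ X ∧ v ∉ X}

/-- The closure of `F` in `|G|_Ψ` contains no ends. -/
def IsPsiBounded {V : Type u} {G : SimpleGraph V} (Ψ : Set (Ends G)) (F : Set (Sym2 V)) : Prop :=
  ∀ p ∈ closure (edgePoints Ψ F), ∀ ω : Ends G, p.1 ≠ Pt.ending ω

/-- A bond of the graph-like quotient of `|G|_Ψ` (a `Ψᶜ`-bond of `G`): a minimal nonempty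
`Ψ`-bounded cut. -/
def IsPsiBond {V : Type u} (G : SimpleGraph V) (Ψ : Set (Ends G)) (F : Set (Sym2 V)) : Prop :=
  Minimal (fun F' => F'.Nonempty ∧ IsCut G F' ∧ IsPsiBounded Ψ F') F

/-- `(G, Ψ)` induces a matroid: there is a matroid on the edge set of `G` whose circuits are the
`Ψ`-circuits and whose cocircuits are the `Ψᶜ`-bonds. -/
def InducesMatroid {V : Type u} (G : SimpleGraph V) (Ψ : Set (Ends G)) : Prop :=
  ∃ M : Matroid (Sym2 V), M.E = G.edgeSet ∧
    (∀ F, M.IsCircuit F ↔ IsPsiCircuit G Ψ F) ∧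
    (∀ F, M.IsCocircuit F ↔ IsPsiBond G Ψ F)

end PsiSystem

/-! Write a `rail` for each of the two lifts of an edge of `T` and a `rung` for the edge over a
vertex. For a set `X` of edges of the ladder, keep the graph `doubled T X` on `V(T)` of those edges
both of whose lifts lie in `X`. Call a vertex with its rung in `X`, or an end in `Ψ` reached by a
ray of a component of `doubled T X`, a terminal of that component. Both lifts of a path, ray or
double ray of `T` joining two terminals close up to a circle in `|G|_Ψ`, through the rungs or ends
at its two extremities. Hence `X` ought to be independent exactly when no component of `doubled T X`
has two terminals, and this is the definition `LadderIndep`.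

These sets satisfy the axioms of an infinite matroid. An edge that attaches a component without
terminals to another one, or a rung in it, preserves independence; this gives augmentation
(`LadderIndep.exists_insert`). The existence of maximal independent subsets rests on a Zorn argument
in forests, `exists_maximal_atMostOne`.

It remains to identify circuits and cocircuits. Since the ladder is locally finite, distinct
vertices or ends are separated by finite cuts, so the graph-like quotient identifies nothing
(`exists_homeomorph_tildeSpace`). Three facts suffice. Every dependent set contains a dependent set
whose closure is a circle (`exists_circle_subset`), so matroid circuits are `Ψ`-circuits. A circle
never meets a bounded cut in exactly one edge (`inter_cutEdges_ne_singleton`), so, by fundamental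
circuits, every nonempty bounded cut meets all bases. Every set that meets all bases contains a
nonempty bounded cut (`exists_cut_of_meets_bases`). The last two facts show that cocircuits are the
minimal nonempty bounded cuts, and also that `Ψ`-circuits are dependent. A `Ψ`-circuit then contains
a matroid circuit, and the two are equal because a circle has no circle as a proper subset. -/

namespace PsiSystem

open Set

/-! ### Reachability and rays in acyclic graphs. -/

section Reachability

variable {V : Type*} {T D H : SimpleGraph V}

theorem mem_of_reachable {A : Set V} (hA : ∀ x y, x ∈ A → H.Adj x y → y ∈ A) {x y : V}
    (h : H.Reachable x y) (hx : x ∈ A) : y ∈ A := by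
  obtain ⟨p⟩ := h
  induction p with
  | nil => exact hx
  | cons hadj _ ih => exact ih (hA _ _ hx hadj)

/-- A subgraph of an acyclic graph that misses an edge does not connect the ends of that edge. -/
theorem not_reachable_of_not_adj (hT : T.IsAcyclic) (hH : H ≤ T) {x y : V} (h : T.Adj x y)
    (hn : ¬ H.Adj x y) : ¬ H.Reachable x y := by
  intro hr
  have hb := SimpleGraph.isAcyclic_iff_forall_adj_isBridge.1 hT h
  rw [SimpleGraph.isBridge_iff] at hb
  refine hb (hr.mono fun a b hab => ?_)
  rw [SimpleGraph.deleteEdges_adj]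
  refine ⟨hH hab, fun he => ?_⟩
  rw [Set.mem_singleton_iff, Sym2.eq_iff] at he
  rcases he with ⟨rfl, rfl⟩ | ⟨rfl, rfl⟩
  · exact hn hab
  · exact hn hab.symm

/-- The edges of `D` inside `A`, as a graph on all vertices. -/
def within (D : SimpleGraph V) (A : Set V) : SimpleGraph V where
  Adj x y := D.Adj x y ∧ x ∈ A ∧ y ∈ A
  symm := ⟨fun _ _ h => ⟨h.1.symm, h.2.2, h.2.1⟩⟩
  loopless := ⟨fun _ h => D.loopless.irrefl _ h.1⟩

/-- `s` is a one-way infinite path of `D`. -/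
structure IsRay (D : SimpleGraph V) (s : ℕ → V) : Prop where
  inj : Function.Injective s
  adj : ∀ n, D.Adj (s n) (s (n + 1))

theorem IsRay.mono {s : ℕ → V} (h : IsRay D s) (hD : D ≤ H) : IsRay H s :=
  ⟨h.inj, fun n => hD (h.adj n)⟩

theorem IsRay.shift {s : ℕ → V} (h : IsRay D s) (k : ℕ) : IsRay D (fun i => s (k + i)) :=
  ⟨fun a b hab => by simpa using h.inj hab, fun n => h.adj (k + n)⟩

theorem reachable_of_seq {s : ℕ → V} {m n : ℕ} (hmn : m ≤ n)
    (h : ∀ k, m ≤ k → k < n → D.Adj (s k) (s (k + 1))) : D.Reachable (s m) (s n) := by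
  induction n, hmn using Nat.le_induction with
  | base => rfl
  | succ k hk ih =>
    exact (ih fun j h1 h2 => h j h1 (by omega)).trans (h k hk (by omega)).reachable

theorem IsRay.reachable {s : ℕ → V} (h : IsRay D s) (m n : ℕ) : D.Reachable (s m) (s n) := by
  rcases le_total m n with hmn | hmn
  · exact reachable_of_seq hmn fun k _ _ => h.adj k
  · exact (reachable_of_seq hmn fun k _ _ => h.adj k).symm

theorem IsRay.eventually_ne {s : ℕ → V} (h : IsRay D s) (a : V) :
    ∃ N, ∀ n, N ≤ n → s n ≠ a := by
  by_cases ha : ∃ k, s k = a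
  · obtain ⟨k, rfl⟩ := ha
    exact ⟨k + 1, fun n hn he => by have := h.inj he; omega⟩
  · push Not at ha
    exact ⟨0, fun n _ => ha n⟩

/-- Connected vertex sets of an acyclic graph are convex along rays. -/
theorem IsRay.mem_of_mem_of_mem (hT : T.IsAcyclic) {s : ℕ → V} (hs : IsRay T s) {A : Set V}
    (hA : ∀ x ∈ A, ∀ y ∈ A, (within T A).Reachable x y) {m j k : ℕ} (hmj : m ≤ j) (hjk : j ≤ k)
    (hm : s m ∈ A) (hk : s k ∈ A) : s j ∈ A := by
  by_contra hj
  obtain ⟨i, rfl⟩ : ∃ i, j = i + 1 := by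
    cases j with
    | zero => exact absurd ((Nat.le_zero.1 hmj) ▸ hm) hj
    | succ i => exact ⟨i, rfl⟩
  have hmi : m ≤ i := by
    rcases Nat.lt_or_ge i m with h | h
    · have : m = i + 1 := by omega
      exact absurd (this ▸ hm) hj
    · exact h
  -- If the ray left `A` at `s (i + 1)`, the edge from `s i` to `s (i + 1)` could be bypassed: back
  -- along the ray to `s m`, through `A` to `s k`, and back along the ray to `s (i + 1)`.
  refine not_reachable_of_not_adj hT (SimpleGraph.deleteEdges_le (G := T) {s(s i, s (i + 1))})
    (hs.adj i) (by simp) ?_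
  have h1 : ∀ l, l ≠ i → (T.deleteEdges {s(s i, s (i + 1))}).Adj (s l) (s (l + 1)) := by
    intro l hl
    rw [SimpleGraph.deleteEdges_adj]
    refine ⟨hs.adj l, fun he => ?_⟩
    rw [Set.mem_singleton_iff, Sym2.eq_iff] at he
    rcases he with ⟨h, -⟩ | ⟨h, h'⟩
    · exact hl (hs.inj h)
    · have := hs.inj h
      have := hs.inj h'
      omega
  have h2 := (hA _ hm _ hk).mono (G' := T.deleteEdges {s(s i, s (i + 1))}) (by
    rintro x y ⟨hxy, hx, hy⟩
    rw [SimpleGraph.deleteEdges_adj]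
    refine ⟨hxy, fun he => ?_⟩
    rw [Set.mem_singleton_iff, Sym2.eq_iff] at he
    rcases he with ⟨rfl, rfl⟩ | ⟨rfl, rfl⟩
    · exact hj hy
    · exact hj hx)
  exact ((reachable_of_seq hmi fun l _ hl => h1 l (by omega)).symm.trans h2).trans
    (reachable_of_seq hjk fun l hl _ => h1 l (by omega)).symm

/-- A walk that uses the new edge repeatedly can be shortened until it uses it at most once. -/
theorem reachable_add_edge {D' : SimpleGraph V} {a b : V}
    (h : ∀ x y, D'.Adj x y → D.Adj x y ∨ (x = a ∧ y = b) ∨ (x = b ∧ y = a)) {v w : V}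
    (hvw : D'.Reachable v w) :
    D.Reachable v w ∨ (D.Reachable v a ∧ D.Reachable b w) ∨
      (D.Reachable v b ∧ D.Reachable a w) := by
  obtain ⟨p⟩ := hvw
  induction p with
  | nil => exact Or.inl (SimpleGraph.Reachable.refl _)
  | cons hadj _ ih =>
    rcases h _ _ hadj with h1 | ⟨rfl, rfl⟩ | ⟨rfl, rfl⟩
    · rcases ih with h2 | ⟨h2, h3⟩ | ⟨h2, h3⟩
      · exact Or.inl (h1.reachable.trans h2)
      · exact Or.inr (Or.inl ⟨h1.reachable.trans h2, h3⟩)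
      · exact Or.inr (Or.inr ⟨h1.reachable.trans h2, h3⟩)
    · rcases ih with h2 | ⟨h2, h3⟩ | ⟨h2, h3⟩
      · exact Or.inr (Or.inl ⟨SimpleGraph.Reachable.refl _, h2⟩)
      · exact Or.inr (Or.inl ⟨SimpleGraph.Reachable.refl _, h3⟩)
      · exact Or.inl h3
    · rcases ih with h2 | ⟨h2, h3⟩ | ⟨h2, h3⟩
      · exact Or.inr (Or.inr ⟨SimpleGraph.Reachable.refl _, h2⟩)
      · exact Or.inl h3
      · exact Or.inr (Or.inr ⟨SimpleGraph.Reachable.refl _, h3⟩)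

end Reachability

/-- Convergence of rays of the tree `T` to elements of `Ω`, which stands for a set of ends. -/
structure EndConv {V : Type*} (T : SimpleGraph V) (Ω : Type*) where
  conv : (ℕ → V) → Ω → Prop
  ray : ∀ {s ω}, conv s ω → IsRay T s
  shift : ∀ {s ω}, conv s ω → ∀ k, conv (fun i => s (k + i)) ω
  unshift : ∀ {s ω k}, IsRay T s → conv (fun i => s (k + i)) ω → conv s ω
  meet : ∀ {s s' ω}, conv s ω → conv s' ω → ∃ n m, s n = s' m
  eq_of_meet : ∀ {s s' ω ω'}, conv s ω → conv s' ω' →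
    (∀ N, ∃ n, N ≤ n ∧ ∃ m, s n = s' m) → ω = ω'

/-! ### Terminals of components of forests, and maximal choices with at most one terminal per
component. -/

section Terminals

variable {V Ω : Type*} {T D D' : SimpleGraph V} {R R' : Set V} (𝓔 : EndConv T Ω)

/-- `t` is a terminal of the component of `v` in `D`: a vertex of `R` or an end to which a ray of
this component converges. -/
def Term (D : SimpleGraph V) (R : Set V) (v : V) : V ⊕ Ω → Prop
  | Sum.inl w => w ∈ R ∧ D.Reachable v w
  | Sum.inr ω => ∃ s, IsRay D s ∧ 𝓔.conv s ω ∧ D.Reachable v (s 0)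

/-- Every component of `D` has at most one terminal. -/
def AtMostOne (D : SimpleGraph V) (R : Set V) : Prop :=
  ∀ v t t', Term 𝓔 D R v t → Term 𝓔 D R v t' → t = t'

variable {𝓔}

theorem Term.of_reachable {v w : V} {t : V ⊕ Ω} (h : D.Reachable w v) (ht : Term 𝓔 D R v t) :
    Term 𝓔 D R w t := by
  rcases t with x | ω
  · exact ⟨ht.1, h.trans ht.2⟩
  · obtain ⟨s, h1, h2, h3⟩ := ht
    exact ⟨s, h1, h2, h.trans h3⟩

theorem Term.mono (hD : D ≤ D') (hR : R ⊆ R') {v : V} {t : V ⊕ Ω} (ht : Term 𝓔 D R v t) :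
    Term 𝓔 D' R' v t := by
  rcases t with x | ω
  · exact ⟨hR ht.1, ht.2.mono hD⟩
  · obtain ⟨s, h1, h2, h3⟩ := ht
    exact ⟨s, h1.mono hD, h2, h3.mono hD⟩

theorem AtMostOne.anti (hD : D ≤ D') (hR : R ⊆ R') (h : AtMostOne 𝓔 D' R') :
    AtMostOne 𝓔 D R :=
  fun v t t' ht ht' => h v t t' (ht.mono hD hR) (ht'.mono hD hR)

/-- Different components share no terminal, because rays converging to the same end meet. -/
theorem Term.reachable {v w : V} {t : V ⊕ Ω} (hv : Term 𝓔 D R v t) (hw : Term 𝓔 D R w t) :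
    D.Reachable v w := by
  rcases t with x | ω
  · exact hv.2.trans hw.2.symm
  · obtain ⟨s, h1, h2, h3⟩ := hv
    obtain ⟨s', h1', h2', h3'⟩ := hw
    obtain ⟨n, m, hnm⟩ := 𝓔.meet h2 h2'
    have h4 := h1.reachable 0 n
    rw [hnm] at h4
    exact (h3.trans h4).trans ((h1'.reachable m 0).trans h3'.symm)

theorem Term.tail {s : ℕ → V} {ω : Ω} (hs : 𝓔.conv s ω) {k : ℕ}
    (hk : ∀ n, k ≤ n → D.Adj (s n) (s (n + 1))) {v : V} (hv : D.Reachable v (s k)) :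
    Term 𝓔 D R v (Sum.inr ω) :=
  ⟨fun i => s (k + i), ⟨((𝓔.ray hs).shift k).inj, fun n => hk (k + n) (by omega)⟩, 𝓔.shift hs k, hv⟩

/-- A ray visits `a` at most once and so has a tail that avoids the new edge; this tail witnesses
the same end in `D`. -/
theorem Term.of_add_edge {a b : V}
    (h : ∀ x y, D'.Adj x y → D.Adj x y ∨ (x = a ∧ y = b) ∨ (x = b ∧ y = a)) {v : V}
    {t : V ⊕ Ω} (ht : Term 𝓔 D' R v t) :
    Term 𝓔 D R v t ∨ (D.Reachable v a ∧ Term 𝓔 D R b t) ∨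
      (D.Reachable v b ∧ Term 𝓔 D R a t) := by
  rcases t with w | ω
  · rcases reachable_add_edge h ht.2 with h1 | ⟨h1, h2⟩ | ⟨h1, h2⟩
    · exact Or.inl ⟨ht.1, h1⟩
    · exact Or.inr (Or.inl ⟨h1, ht.1, h2⟩)
    · exact Or.inr (Or.inr ⟨h1, ht.1, h2⟩)
  · obtain ⟨s, h1, h2, h3⟩ := ht
    obtain ⟨N, hN⟩ := h1.eventually_ne a
    have hadj : ∀ n, N ≤ n → D.Adj (s n) (s (n + 1)) := by
      intro n hn
      rcases h _ _ (h1.adj n) with h4 | ⟨h4, -⟩ | ⟨-, h4⟩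
      · exact h4
      · exact absurd h4 (hN n hn)
      · exact absurd h4 (hN (n + 1) (by omega))
    rcases reachable_add_edge h (h3.trans (h1.reachable 0 N)) with h4 | ⟨h4, h5⟩ | ⟨h4, h5⟩
    · exact Or.inl (Term.tail h2 hadj h4)
    · exact Or.inr (Or.inl ⟨h4, Term.tail h2 hadj h5⟩)
    · exact Or.inr (Or.inr ⟨h4, Term.tail h2 hadj h5⟩)

/-- The new edge merges the component of `a`, which has no terminal, into that of `b`, so no second
terminal arises. -/
theorem AtMostOne.add_edge {a b : V}
    (h : ∀ x y, D'.Adj x y → D.Adj x y ∨ (x = a ∧ y = b) ∨ (x = b ∧ y = a))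
    (hD : AtMostOne 𝓔 D R) (ha : ∀ t, ¬ Term 𝓔 D R a t) : AtMostOne 𝓔 D' R := by
  intro v t t' ht ht'
  rcases ht.of_add_edge h with h1 | ⟨h1, h2⟩ | ⟨-, h2⟩
  · rcases ht'.of_add_edge h with h3 | ⟨h3, h4⟩ | ⟨-, h4⟩
    · exact hD v t t' h1 h3
    · exact absurd (h1.of_reachable h3.symm) (ha t)
    · exact absurd h4 (ha t')
  · rcases ht'.of_add_edge h with h3 | ⟨h3, h4⟩ | ⟨-, h4⟩
    · exact absurd (h3.of_reachable h1.symm) (ha t')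
    · exact hD b t t' h2 h4
    · exact absurd h4 (ha t')
  · exact absurd h2 (ha t)

theorem AtMostOne.add_vertex {w : V} (h : R' ⊆ insert w R) (hD : AtMostOne 𝓔 D R)
    (hw : ∀ t, ¬ Term 𝓔 D R w t) : AtMostOne 𝓔 D R' := by
  have key : ∀ v t, Term 𝓔 D R' v t → Term 𝓔 D R v t ∨ (t = Sum.inl w ∧ D.Reachable v w) := by
    intro v t ht
    rcases t with x | ω
    · rcases h ht.1 with rfl | hx
      · exact Or.inr ⟨rfl, ht.2⟩
      · exact Or.inl ⟨hx, ht.2⟩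
    · exact Or.inl ht
  intro v t t' ht ht'
  rcases key v t ht with h1 | ⟨h1, h2⟩ <;> rcases key v t' ht' with h3 | ⟨h3, h4⟩
  · exact hD v t t' h1 h3
  · exact absurd (h1.of_reachable h4.symm) (hw t)
  · exact absurd (h3.of_reachable h2.symm) (hw t')
  · rw [h1, h3]

/-- Following `D'` from a component of `D` without terminals towards a terminal. -/
theorem Term.exists_exit (hT : T.IsAcyclic) (hD : D ≤ T) (hD' : D' ≤ T) {a : V}
    (ha : ∀ t, ¬ Term 𝓔 D R a t) {t : V ⊕ Ω} (ht : Term 𝓔 D' R' a t) :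
    (∃ w ∈ R', D.Reachable a w) ∨ ∃ x y, D'.Adj x y ∧ D.Reachable a x ∧ ¬ D.Reachable a y := by
  by_contra! hcon
  obtain ⟨hc1, hc2⟩ := hcon
  have hstay : ∀ x, D'.Reachable a x → D.Reachable a x := fun x hx =>
    mem_of_reachable (A := {x | D.Reachable a x}) (fun x y h1 h2 => hc2 x y h2 h1) hx
      (SimpleGraph.Reachable.refl a)
  rcases t with w | ω
  · exact hc1 w ht.1 (hstay w ht.2)
  · obtain ⟨s, h1, h2, h3⟩ := ht
    have h4 : ∀ n, D.Reachable a (s n) := fun n => hstay _ (h3.trans (h1.reachable 0 n))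
    -- The ray never leaves the `D`-component of `a`, so by acyclicity its edges belong to `D`, and
    -- `ω` would be a terminal of that component.
    refine ha (Sum.inr ω) (Term.tail (k := 0) h2 (fun n _ => ?_) (h4 0))
    by_contra hn
    exact not_reachable_of_not_adj hT hD (hD' (h1.adj n)) hn ((h4 n).symm.trans (h4 (n + 1)))

/-- A vertex set that can serve as a component with exactly one terminal. -/
def Good (𝓔 : EndConv T Ω) (DI DX : SimpleGraph V) (RI RX : Set V) (A : Set V) : Prop :=
  A.Nonempty ∧ (∀ x y, x ∈ A → DI.Adj x y → y ∈ A) ∧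
    (∀ x ∈ A, ∀ y ∈ A, (within DX A).Reachable x y) ∧
    ∃ R ⊆ RX ∩ A, RI ∩ A ⊆ R ∧ ∃ t, ∀ v ∈ A, ∀ t', Term 𝓔 (within DX A) R v t' ↔ t' = t

theorem good_of_unique {DI DX : SimpleGraph V} {RI RX A R : Set V} {a : V} {t : V ⊕ Ω}
    (ha : a ∈ A) (h1 : ∀ x y, x ∈ A → DI.Adj x y → y ∈ A)
    (h2 : ∀ x ∈ A, (within DX A).Reachable a x) (h3 : R ⊆ RX ∩ A) (h4 : RI ∩ A ⊆ R)
    (h5 : Term 𝓔 (within DX A) R a t) (h6 : ∀ t', Term 𝓔 (within DX A) R a t' → t' = t) :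
    Good 𝓔 DI DX RI RX A := by
  refine ⟨⟨a, ha⟩, h1, fun x hx y hy => (h2 x hx).symm.trans (h2 y hy), R, h3, h4, t,
    fun v hv t' => ⟨fun h => h6 t' (h.of_reachable (h2 v hv)), ?_⟩⟩
  rintro rfl
  exact h5.of_reachable (h2 v hv).symm

section Unsettled

variable {DI DX : SimpleGraph V} {RI RX Y : Set V} (hT : T.IsAcyclic) (hIX : DI ≤ DX)
  (hX : DX ≤ T) (hR : RI ⊆ RX) (hY : ∀ x y, x ∈ Y → DI.Adj x y → y ∈ Y)
  (hgood : ∀ A ⊆ Y, ¬ Good 𝓔 DI DX RI RX A)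

theorem within_component_le (hT : T.IsAcyclic) (hIX : DI ≤ DX) (hX : DX ≤ T) (v : V) :
    within DX {x | DI.Reachable v x} ≤ DI := by
  rintro x y ⟨h1, h2, h3⟩
  by_contra hn
  exact not_reachable_of_not_adj hT (hIX.trans hX) (hX h1) hn (h2.symm.trans h3)

theorem reachable_within_component (hIX : DI ≤ DX) {v x : V} (h : DI.Reachable v x) :
    (within DX {x | DI.Reachable v x}).Reachable v x := by
  have : x ∈ {x | DI.Reachable v x} ∩ {x | (within DX {x | DI.Reachable v x}).Reachable v x} := by
    refine mem_of_reachable ?_ h ⟨SimpleGraph.Reachable.refl v, SimpleGraph.Reachable.refl v⟩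
    rintro a b ⟨h1, h2⟩ hab
    have h3 : DI.Reachable v b := h1.trans hab.reachable
    exact ⟨h3, h2.trans (SimpleGraph.Adj.reachable ⟨hIX hab, h1, h3⟩)⟩
  exact this.2

include hT hIX hX hY hgood

/-- A `DI`-component in `Y` with a terminal is itself good: by acyclicity `DX` adds no edges inside
it, and by `hI` its terminal is unique. -/
theorem not_term_of_no_good (hR : RI ⊆ RX) (hI : AtMostOne 𝓔 DI RI) {v : V} (hv : v ∈ Y)
    (t : V ⊕ Ω) : ¬ Term 𝓔 DI RI v t := by
  intro ht
  refine hgood {x | DI.Reachable v x} (fun x hx => mem_of_reachable hY hx hv)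
    (good_of_unique (R := RI ∩ {x | DI.Reachable v x}) (a := v) (t := t)
      (SimpleGraph.Reachable.refl v)
      (fun x y h1 h2 => SimpleGraph.Reachable.trans h1 h2.reachable)
      (fun x hx => reachable_within_component hIX hx)
      (inter_subset_inter_left _ hR) subset_rfl ?_ ?_)
  · rcases t with w | ω
    · exact ⟨⟨ht.1, ht.2⟩, reachable_within_component hIX ht.2⟩
    · obtain ⟨s, h1, h2, h3⟩ := ht
      refine ⟨s, ⟨h1.inj, fun n => ⟨hIX (h1.adj n), h3.trans (h1.reachable 0 n),
        h3.trans (h1.reachable 0 (n + 1))⟩⟩, h2, reachable_within_component hIX h3⟩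
  · intro t' ht'
    exact hI v t' t (ht'.mono (within_component_le hT hIX hX v) inter_subset_left) ht

/-- The `DI`-component of `w` has no terminal of its own, so choosing the single rung vertex `w`
would make it good. -/
theorem notMem_of_no_good (hR : RI ⊆ RX) (hI : AtMostOne 𝓔 DI RI) {w : V} (hw : w ∈ Y) :
    w ∉ RX := by
  intro hwX
  have hno := not_term_of_no_good hT hIX hX hY hgood hR hI hw
  refine hgood {x | DI.Reachable w x} (fun x hx => mem_of_reachable hY hx hw)
    (good_of_unique (R := {w}) (a := w) (t := Sum.inl w) (SimpleGraph.Reachable.refl w)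
      (fun x y h1 h2 => SimpleGraph.Reachable.trans h1 h2.reachable)
      (fun x hx => reachable_within_component hIX hx)
      (singleton_subset_iff.2 ⟨hwX, SimpleGraph.Reachable.refl w⟩)
      (fun x hx => absurd ⟨hx.1, hx.2⟩ (hno (Sum.inl x)))
      ⟨rfl, SimpleGraph.Reachable.refl w⟩ ?_)
  rintro (x | ω) ht'
  · rw [ht'.1]
  · obtain ⟨s, h1, h2, h3⟩ := ht'
    exact absurd ⟨s, h1.mono (within_component_le hT hIX hX w), h2,
      h3.mono (within_component_le hT hIX hX w)⟩ (hno (Sum.inr ω))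

/-- Otherwise the union `A` of the `DI`-components met by `s` would be good, with no rungs and `ω`
as its only terminal. For a ray `s'` in `A` to another end eventually avoids `s`; from there on its
edges lie in `DI`, since any other edge would close a cycle with `DI` and `s`. So `DI` would have an
end as a terminal in `Y`. -/
theorem not_conv_of_no_good (hR : RI ⊆ RX) (hI : AtMostOne 𝓔 DI RI) {s : ℕ → V}
    (hs : ∀ n, DX.Adj (s n) (s (n + 1))) (hsY : ∀ n, s n ∈ Y) (ω : Ω) : ¬ 𝓔.conv s ω := by
  intro hω
  have hray := 𝓔.ray hω
  have hno : ∀ v ∈ Y, ∀ t, ¬ Term 𝓔 DI RI v t := fun v hv =>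
    not_term_of_no_good hT hIX hX hY hgood hR hI hv
  set A : Set V := {x | ∃ n, DI.Reachable (s n) x} with hA
  have hAY : A ⊆ Y := fun x ⟨n, hn⟩ => mem_of_reachable hY hn (hsY n)
  have hsA : ∀ n, s n ∈ A := fun n => ⟨n, SimpleGraph.Reachable.refl _⟩
  have hrayA : IsRay (within DX A) s := ⟨hray.inj, fun n => ⟨hs n, hsA n, hsA (n + 1)⟩⟩
  refine hgood A hAY (good_of_unique (R := ∅) (a := s 0) (t := Sum.inr ω) (hsA 0)
    (fun x y ⟨n, hn⟩ hxy => ⟨n, hn.trans hxy.reachable⟩) ?_ (empty_subset _)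
    (fun x hx => absurd ⟨hx.1, SimpleGraph.Reachable.refl x⟩ (hno x (hAY hx.2) (Sum.inl x)))
    ⟨s, hrayA, hω, SimpleGraph.Reachable.refl _⟩ ?_)
  · rintro x ⟨n, hn⟩
    refine (hrayA.reachable 0 n).trans ((reachable_within_component hIX hn).mono ?_)
    rintro a b ⟨h1, h2, h3⟩
    exact ⟨h1, ⟨n, h2⟩, ⟨n, h3⟩⟩
  · rintro (x | ω') ht'
    · exact absurd ht'.1 (notMem_empty x)
    · obtain ⟨s', h1, h2, -⟩ := ht'
      by_contra hne
      have hne' : ω' ≠ ω := fun h => hne (by rw [h])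
      have hfin : ∃ N, ∀ n, N ≤ n → ∀ m, s' n ≠ s m := by
        by_contra! hcon
        exact hne' (𝓔.eq_of_meet h2 hω hcon)
      obtain ⟨N, hN⟩ := hfin
      set S : SimpleGraph V := SimpleGraph.fromRel fun x y => ∃ n, x = s n ∧ y = s (n + 1) with hS
      have hSadj : ∀ x y, S.Adj x y → ∃ n, x = s n := by
        intro x y hxy
        rw [hS, SimpleGraph.fromRel_adj] at hxy
        rcases hxy.2 with ⟨n, h, -⟩ | ⟨n, -, h⟩
        · exact ⟨n, h⟩
        · exact ⟨n + 1, h⟩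
      have hST : S ≤ T := by
        intro x y hxy
        rw [hS, SimpleGraph.fromRel_adj] at hxy
        rcases hxy.2 with ⟨n, rfl, rfl⟩ | ⟨n, rfl, rfl⟩
        · exact hray.adj n
        · exact (hray.adj n).symm
      have hSray : IsRay S s := ⟨hray.inj, fun n => by
        rw [hS, SimpleGraph.fromRel_adj]
        exact ⟨(hray.adj n).ne, Or.inl ⟨n, rfl, rfl⟩⟩⟩
      have hadj : ∀ n, N ≤ n → DI.Adj (s' n) (s' (n + 1)) := by
        intro n hn
        by_contra hnad
        obtain ⟨hX1, ⟨m, hm⟩, ⟨m', hm'⟩⟩ := h1.adj n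
        refine not_reachable_of_not_adj hT (sup_le (hIX.trans hX) hST) (hX hX1) ?_
          (((hm.symm.mono le_sup_left).trans ((hSray.reachable m m').mono le_sup_right)).trans
            (hm'.mono le_sup_left))
        rw [SimpleGraph.sup_adj]
        rintro (h | h)
        · exact hnad h
        · obtain ⟨k, hk⟩ := hSadj _ _ h
          exact hN n hn k hk
      have hmem : s' N ∈ Y := hAY (h1.adj N).2.1
      exact hno _ hmem (Sum.inr ω') (Term.tail h2 hadj (SimpleGraph.Reachable.refl _))

end Unsettled

-- The core of the maximality axiom. Let `𝓕` be a maximal family of disjoint good sets. The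
-- uncovered set `Y` contains no good set, hence no terminal of `DI`, no vertex of `RX` and no
-- convergent ray of `DX`. Each component of `DX` in `Y` is attached to one adjacent member of `𝓕`,
-- if there is any, and otherwise forms a class of its own; `D` consists of the `DX`-edges inside
-- classes. Attaching creates no terminals, so the classes of members of `𝓕` have exactly one each.
-- The remaining classes have none, but `DX` offers nothing to extend them.
open Classical in
theorem exists_maximal_atMostOne (hT : T.IsAcyclic) {DI DX : SimpleGraph V} {RI RX : Set V}
    (hIX : DI ≤ DX) (hX : DX ≤ T) (hR : RI ⊆ RX) (hI : AtMostOne 𝓔 DI RI) :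
    ∃ D R, DI ≤ D ∧ D ≤ DX ∧ RI ⊆ R ∧ R ⊆ RX ∧ AtMostOne 𝓔 D R ∧
      ∀ v, (∃ t, Term 𝓔 D R v t) ∨
        ∀ x, D.Reachable v x → x ∉ RX ∧ ∀ y, DX.Adj x y → D.Adj x y := by
  obtain ⟨𝓕, ⟨hF1, hF2⟩, hF3⟩ := zorn_subset
    {𝓕 : Set (Set V) | (∀ A ∈ 𝓕, Good 𝓔 DI DX RI RX A) ∧
      ∀ A ∈ 𝓕, ∀ B ∈ 𝓕, ∀ x, x ∈ A → x ∈ B → A = B} (by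
    intro c hc hchain
    refine ⟨⋃₀ c, ⟨fun A ⟨F, hF, hA⟩ => (hc hF).1 A hA, ?_⟩, fun s hs => subset_sUnion_of_mem hs⟩
    rintro A ⟨F, hF, hA⟩ B ⟨F', hF', hB⟩ x hxA hxB
    rcases hchain.total hF hF' with h | h
    · exact (hc hF').2 A (h hA) B hB x hxA hxB
    · exact (hc hF).2 A hA B (h hB) x hxA hxB)
  set Y : Set V := {x | ∀ A ∈ 𝓕, x ∉ A} with hYdef
  have hY : ∀ x y, x ∈ Y → DI.Adj x y → y ∈ Y := fun x y hx hxy A hA hy =>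
    hx A hA ((hF1 A hA).2.1 y x hy hxy.symm)
  have hgood : ∀ A ⊆ Y, ¬ Good 𝓔 DI DX RI RX A := by
    intro A hAY hA
    have hins : insert A 𝓕 ∈ {𝓕 : Set (Set V) | (∀ A ∈ 𝓕, Good 𝓔 DI DX RI RX A) ∧
      ∀ A ∈ 𝓕, ∀ B ∈ 𝓕, ∀ x, x ∈ A → x ∈ B → A = B} := by
      refine ⟨?_, ?_⟩
      · rintro B (rfl | hB)
        · exact hA
        · exact hF1 B hB
      · rintro B (rfl | hB) C (rfl | hC) x hxB hxC
        · rfl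
        · exact absurd hxC (hAY hxB C hC)
        · exact absurd hxB (hAY hxC B hB)
        · exact hF2 B hB C hC x hxB hxC
    obtain ⟨a, ha⟩ := hA.1
    exact hAY ha A (hF3 hins (subset_insert A 𝓕) (mem_insert A 𝓕)) ha
  have hnoterm : ∀ v ∈ Y, ∀ t, ¬ Term 𝓔 DI RI v t := fun v hv =>
    not_term_of_no_good hT hIX hX hY hgood hR hI hv
  have hnorung : ∀ v ∈ Y, v ∉ RX := fun v hv =>
    notMem_of_no_good hT hIX hX hY hgood hR hI hv
  have hnoray : ∀ s ω, 𝓔.conv s ω → ∀ N, (∀ n, N ≤ n → DX.Adj (s n) (s (n + 1))) →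
      ¬ ∀ n, N ≤ n → s n ∈ Y := fun s ω hs N hadj hsY =>
    not_conv_of_no_good hT hIX hX hY hgood hR hI (s := fun i => s (N + i))
      (fun n => hadj (N + n) (by omega)) (fun n => hsY (N + n) (by omega)) ω (𝓔.shift hs N)
  have hex : ∀ A ∈ 𝓕, ∃ R ⊆ RX ∩ A, RI ∩ A ⊆ R ∧
      ∃ t, ∀ v ∈ A, ∀ t', Term 𝓔 (within DX A) R v t' ↔ t' = t := fun A hA => (hF1 A hA).2.2.2
  choose! RA hRA1 hRA2 tA htA using hex
  set K : V → Set V := fun v => {x | (within DX Y).Reachable v x} with hK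
  have hKeq : ∀ {v x}, (within DX Y).Reachable v x → K v = K x := fun h =>
    Set.ext fun z => ⟨fun hz => h.symm.trans hz, fun hz => h.trans hz⟩
  have hKY : ∀ {v x}, v ∈ Y → x ∈ K v → x ∈ Y := fun hv hx =>
    mem_of_reachable (H := within DX Y) (fun _ _ _ h => h.2.2) hx hv
  -- The label `lab v` names the class of `v`. A component in `Y` contains a point of `Y` and so is
  -- no member of `𝓕`; thus the two kinds of label do not clash.
  set g : Set V → Set V := fun K =>
    if h : ∃ A ∈ 𝓕, ∃ x ∈ K, ∃ y ∈ A, DX.Adj x y then h.choose else K with hg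
  set lab : V → Set V := fun v =>
    if h : ∃ A ∈ 𝓕, v ∈ A then h.choose else g (K v) with hlab
  have hlabA : ∀ {A v}, A ∈ 𝓕 → v ∈ A → lab v = A := by
    intro A v hA hv
    have h : ∃ A ∈ 𝓕, v ∈ A := ⟨A, hA, hv⟩
    rw [hlab]
    simp only [h, ↓reduceDIte]
    exact hF2 _ h.choose_spec.1 _ hA v h.choose_spec.2 hv
  have hlabY : ∀ {v}, v ∈ Y → lab v = g (K v) := by
    intro v hv
    have h : ¬ ∃ A ∈ 𝓕, v ∈ A := fun ⟨A, hA, hvA⟩ => hv A hA hvA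
    rw [hlab]
    simp only [h, ↓reduceDIte]
  have hcases : ∀ v, (∃ A ∈ 𝓕, v ∈ A) ∨ v ∈ Y := by
    intro v
    by_cases h : ∃ A ∈ 𝓕, v ∈ A
    · exact Or.inl h
    · exact Or.inr fun A hA hv => h ⟨A, hA, hv⟩
  -- vertices of `Y` whose label lies in `𝓕` are linked to their label
  have hlink : ∀ {v}, v ∈ Y → lab v ∈ 𝓕 → ∃ x ∈ K v, ∃ y ∈ lab v, DX.Adj x y := by
    intro v hv hvF
    by_cases h : ∃ A ∈ 𝓕, ∃ x ∈ K v, ∃ y ∈ A, DX.Adj x y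
    · have : lab v = h.choose := by rw [hlabY hv, hg]; simp only [h, ↓reduceDIte]
      rw [this]
      exact h.choose_spec.2
    · have : lab v = K v := by rw [hlabY hv, hg]; simp only [h, ↓reduceDIte]
      exact absurd (this ▸ SimpleGraph.Reachable.refl v : v ∈ lab v) (hv _ hvF)
  have hunlink : ∀ {v}, v ∈ Y → lab v ∉ 𝓕 →
      lab v = K v ∧ ∀ A ∈ 𝓕, ∀ x ∈ K v, ∀ y ∈ A, ¬ DX.Adj x y := by
    intro v hv hvF
    by_cases h : ∃ A ∈ 𝓕, ∃ x ∈ K v, ∃ y ∈ A, DX.Adj x y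
    · have : lab v = h.choose := by rw [hlabY hv, hg]; simp only [h, ↓reduceDIte]
      rw [this] at hvF
      exact absurd h.choose_spec.1 hvF
    · refine ⟨by rw [hlabY hv, hg]; simp only [h, ↓reduceDIte], fun A hA x hx y hy hxy => ?_⟩
      exact h ⟨A, hA, x, hx, y, hy, hxy⟩
  set D : SimpleGraph V :=
    { Adj := fun x y => DX.Adj x y ∧ lab x = lab y
      symm := ⟨fun _ _ h => ⟨h.1.symm, h.2.symm⟩⟩
      loopless := ⟨fun _ h => DX.loopless.irrefl _ h.1⟩ } with hD
  have hDX : D ≤ DX := fun _ _ h => h.1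
  have hDlab : ∀ {x y}, D.Reachable x y → lab x = lab y := fun {x y} h =>
    (mem_of_reachable (H := D) (A := {z | lab x = lab z}) (fun a b ha hab => Eq.trans ha hab.2) h rfl)
  have hYD : within DX Y ≤ D := fun x y h =>
    ⟨h.1, by rw [hlabY h.2.1, hlabY h.2.2, hKeq (SimpleGraph.Adj.reachable h)]⟩
  have hAD : ∀ A ∈ 𝓕, within DX A ≤ D := fun A hA x y h =>
    ⟨h.1, by rw [hlabA hA h.2.1, hlabA hA h.2.2]⟩
  set R : Set V := {w | ∃ A ∈ 𝓕, w ∈ RA A} with hRdef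
  have hRA : ∀ {A w}, A ∈ 𝓕 → lab w = A → w ∈ R → w ∈ RA A ∧ w ∈ A := by
    rintro A w hA hw ⟨B, hB, hwB⟩
    have h1 : w ∈ B := (hRA1 B hB hwB).2
    have h2 : A = B := hw.symm.trans (hlabA hB h1)
    subst h2
    exact ⟨hwB, h1⟩
  have huniq : ∀ v (hvF : lab v ∈ 𝓕), ∀ t, Term 𝓔 D R v t → t = tA (lab v) hvF := by
    intro v hvF t ht
    obtain ⟨a, ha⟩ := (hF1 _ hvF).1
    rcases t with w | ω
    · obtain ⟨h1, h2⟩ := hRA hvF (hDlab ht.2).symm ht.1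
      exact (htA _ hvF w h2 _).1 ⟨h1, SimpleGraph.Reachable.refl w⟩
    · obtain ⟨s, h1, h2, h3⟩ := ht
      have hls : ∀ n, lab (s n) = lab v := fun n => (hDlab (h3.trans (h1.reachable 0 n))).symm
      -- A ray in the class either returns to the good set forever, and then stays in it from its
      -- first visit on by convexity, or has a tail in `Y`, where no ray converges.
      by_cases hinf : ∀ N, ∃ n, N ≤ n ∧ s n ∈ lab v
      · obtain ⟨m, -, hm⟩ := hinf 0
        have hin : ∀ n, m ≤ n → s n ∈ lab v := by
          intro n hn
          obtain ⟨k, hk1, hk2⟩ := hinf n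
          refine (𝓔.ray h2).mem_of_mem_of_mem hT (fun x hx y hy => ?_) hn hk1 hm hk2
          exact ((hF1 _ hvF).2.2.1 x hx y hy).mono (fun p q (h : (within DX (lab v)).Adj p q) =>
            (⟨hX h.1, h.2⟩ : (within T (lab v)).Adj p q))
        exact (htA _ hvF _ (hin m le_rfl) _).1 (Term.tail (D := within DX (lab v)) h2
          (fun n hn => ⟨hDX (h1.adj n), hin n hn, hin (n + 1) (by omega)⟩)
          (SimpleGraph.Reachable.refl _))
      · push Not at hinf
        obtain ⟨N, hN⟩ := hinf
        refine absurd (fun n hn => ?_) (hnoray s ω h2 N fun n _ => hDX (h1.adj n))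
        rcases hcases (s n) with ⟨A, hA, hnA⟩ | h
        · have : A = lab v := (hlabA hA hnA).symm.trans (hls n)
          exact absurd (this ▸ hnA) (hN n hn)
        · exact h
  have hnone : ∀ v, lab v ∉ 𝓕 → ∀ t, ¬ Term 𝓔 D R v t := by
    intro v hvF t ht
    rcases t with w | ω
    · obtain ⟨A, hA, hw⟩ := ht.1
      have := (hDlab ht.2).trans (hlabA hA (hRA1 A hA hw).2)
      exact hvF (this ▸ hA)
    · obtain ⟨s, h1, h2, h3⟩ := ht
      refine hnoray s ω h2 0 (fun n _ => hDX (h1.adj n)) fun n _ => ?_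
      rcases hcases (s n) with ⟨A, hA, hnA⟩ | h
      · have := (hDlab (h3.trans (h1.reachable 0 n))).trans (hlabA hA hnA)
        exact absurd (this ▸ hA) hvF
      · exact h
  refine ⟨D, R, ?_, hDX, ?_, ?_, ?_, ?_⟩
  · intro x y hxy
    rcases hcases x with ⟨A, hA, hx⟩ | hx
    · exact ⟨hIX hxy, by rw [hlabA hA hx, hlabA hA ((hF1 A hA).2.1 x y hx hxy)]⟩
    · exact hYD ⟨hIX hxy, hx, hY x y hx hxy⟩
  · intro w hw
    rcases hcases w with ⟨A, hA, hwA⟩ | h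
    · exact ⟨A, hA, hRA2 A hA ⟨hw, hwA⟩⟩
    · exact absurd ⟨hw, SimpleGraph.Reachable.refl w⟩ (hnoterm w h (Sum.inl w))
  · rintro w ⟨A, hA, hw⟩
    exact (hRA1 A hA hw).1
  · intro v t t' ht ht'
    by_cases hvF : lab v ∈ 𝓕
    · rw [huniq v hvF t ht, huniq v hvF t' ht']
    · exact absurd ht (hnone v hvF t)
  · intro v
    by_cases hvF : lab v ∈ 𝓕
    · left
      obtain ⟨a, ha, hva⟩ : ∃ a ∈ lab v, D.Reachable v a := by
        rcases hcases v with ⟨A, hA, hv⟩ | hv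
        · exact ⟨v, (hlabA hA hv).symm ▸ hv, SimpleGraph.Reachable.refl v⟩
        · obtain ⟨x, hx, y, hy, hxy⟩ := hlink hv hvF
          refine ⟨y, hy, (SimpleGraph.Reachable.mono hYD hx).trans (SimpleGraph.Adj.reachable
            ⟨hxy, ?_⟩)⟩
          rw [hlabA hvF hy, hlabY (hKY hv hx), hlabY hv, hKeq hx]
      refine ⟨tA (lab v) hvF, Term.of_reachable hva (Term.mono (hAD _ hvF) (fun w (hw : w ∈ RA (lab v)) => (⟨_, hvF, hw⟩ : w ∈ R))
        ((htA _ hvF a ha _).2 rfl))⟩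
    · right
      intro x hx
      have hlx := hDlab hx
      have hxY : x ∈ Y := by
        rcases hcases x with ⟨A, hA, hxA⟩ | h
        · rw [hlx, hlabA hA hxA] at hvF
          exact absurd hA hvF
        · exact h
      refine ⟨hnorung x hxY, fun y hxy => ?_⟩
      rw [hlx] at hvF
      have hyY : y ∈ Y := fun A hA hyA =>
        (hunlink hxY hvF).2 A hA x (SimpleGraph.Reachable.refl x) y hyA hxy
      exact hYD ⟨hxy, hxY, hyY⟩

end Terminals

/-! ### The matroid on the edges of the ladder. -/

section LadderMatroid

variable {V : Type*}

/-- The edge of `T □ K₂` at level `j` over the edge `xy` of `T`. -/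
def rail (x y : V) (j : Fin 2) : Sym2 (V × Fin 2) := s((x, j), (y, j))

/-- The edge of `T □ K₂` over the vertex `v` of `T`. -/
def rung (v : V) : Sym2 (V × Fin 2) := s((v, 0), (v, 1))

theorem rail_comm (x y : V) (j : Fin 2) : rail x y j = rail y x j := Sym2.eq_swap

theorem rail_eq_rail {x y x' y' : V} {j j' : Fin 2} :
    rail x y j = rail x' y' j' ↔ j = j' ∧ ((x = x' ∧ y = y') ∨ (x = y' ∧ y = x')) := by
  simp only [rail, Sym2.eq_iff, Prod.mk.injEq]
  tauto

theorem rung_eq_rung {v w : V} : rung v = rung w ↔ v = w := by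
  simp [rung]

theorem rung_ne_rail (v x y : V) (j : Fin 2) : rung v ≠ rail x y j := by
  simp only [rung, rail, ne_eq, Sym2.eq_iff, Prod.mk.injEq]
  rintro (⟨⟨-, h⟩, -, h'⟩ | ⟨⟨-, h⟩, -, h'⟩)
  · exact absurd (h.trans h'.symm) (by decide)
  · exact absurd (h.trans h'.symm) (by decide)

/-- The Cartesian product of `T` and `K₂`. -/
abbrev ladder (T : SimpleGraph V) : SimpleGraph (V × Fin 2) := T.boxProd (⊤ : SimpleGraph (Fin 2))

variable {T : SimpleGraph V}

theorem rung_mem (v : V) : rung v ∈ (ladder T).edgeSet := by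
  simp [rung, ladder, SimpleGraph.boxProd_adj]

theorem rail_mem {x y : V} {j : Fin 2} (h : T.Adj x y) : rail x y j ∈ (ladder T).edgeSet := by
  simp [rail, ladder, SimpleGraph.boxProd_adj, h]

theorem mem_edgeSet_ladder {e : Sym2 (V × Fin 2)} :
    e ∈ (ladder T).edgeSet ↔ (∃ v, e = rung v) ∨ ∃ x y j, T.Adj x y ∧ e = rail x y j := by
  constructor
  · induction e using Sym2.ind with
    | _ a b =>
      obtain ⟨x, i⟩ := a
      obtain ⟨y, j⟩ := b
      intro h
      rw [SimpleGraph.mem_edgeSet, SimpleGraph.boxProd_adj] at h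
      rcases h with ⟨h, rfl⟩ | ⟨h, h'⟩
      · exact Or.inr ⟨x, y, i, h, rfl⟩
      · left
        obtain rfl : x = y := h'
        refine ⟨x, ?_⟩
        have hij : i ≠ j := h
        have : (i = 0 ∧ j = 1) ∨ (i = 1 ∧ j = 0) := by omega
        rcases this with ⟨rfl, rfl⟩ | ⟨rfl, rfl⟩
        · rfl
        · exact Sym2.eq_swap
  · rintro (⟨v, rfl⟩ | ⟨x, y, j, h, rfl⟩)
    · exact rung_mem v
    · exact rail_mem h

/-- The edges of `T` both of whose lifts lie in `X`. -/
def doubled (T : SimpleGraph V) (X : Set (Sym2 (V × Fin 2))) : SimpleGraph V where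
  Adj x y := T.Adj x y ∧ ∀ j, rail x y j ∈ X
  symm := ⟨fun x y h => ⟨h.1.symm, fun j => rail_comm x y j ▸ h.2 j⟩⟩
  loopless := ⟨fun _ h => T.loopless.irrefl _ h.1⟩

/-- The vertices of `T` whose rung lies in `X`. -/
def rungs (X : Set (Sym2 (V × Fin 2))) : Set V := {v | rung v ∈ X}

theorem doubled_le (T : SimpleGraph V) (X : Set (Sym2 (V × Fin 2))) : doubled T X ≤ T :=
  fun _ _ h => h.1

theorem doubled_mono {X Y : Set (Sym2 (V × Fin 2))} (h : X ⊆ Y) : doubled T X ≤ doubled T Y :=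
  fun _ _ hxy => ⟨hxy.1, fun j => h (hxy.2 j)⟩

theorem rungs_mono {X Y : Set (Sym2 (V × Fin 2))} (h : X ⊆ Y) : rungs X ⊆ rungs Y :=
  fun _ hv => h hv

variable {Ω : Type*} (𝓔 : EndConv T Ω)

/-- An edge set of the ladder is independent if every component of the graph of doubled edges
has at most one terminal. -/
def LadderIndep (X : Set (Sym2 (V × Fin 2))) : Prop :=
  X ⊆ (ladder T).edgeSet ∧ AtMostOne 𝓔 (doubled T X) (rungs X)

variable {𝓔} {I J X B : Set (Sym2 (V × Fin 2))}

theorem LadderIndep.subset (hJ : LadderIndep 𝓔 J) (h : I ⊆ J) : LadderIndep 𝓔 I :=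
  ⟨h.trans hJ.1, hJ.2.anti (doubled_mono h) (rungs_mono h)⟩

theorem rungs_insert_rail (x y : V) (j : Fin 2) : rungs (insert (rail x y j) I) = rungs I := by
  ext v
  simp [rungs, rung_ne_rail]

theorem LadderIndep.insert_rung (hI : LadderIndep 𝓔 I) {v : V}
    (hv : ∀ t, ¬ Term 𝓔 (doubled T I) (rungs I) v t) : LadderIndep 𝓔 (insert (rung v) I) := by
  refine ⟨insert_subset (rung_mem v) hI.1, ?_⟩
  have hD : doubled T (insert (rung v) I) ≤ doubled T I := fun x y h => ⟨h.1, fun j =>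
    (h.2 j).resolve_left (rung_ne_rail v x y j).symm⟩
  refine AtMostOne.anti hD subset_rfl (AtMostOne.add_vertex ?_ hI.2 hv)
  rintro w (hw | hw)
  · exact Or.inl (rung_eq_rung.1 hw)
  · exact Or.inr hw

theorem LadderIndep.insert_rail (hI : LadderIndep 𝓔 I) {x y : V} {j : Fin 2} (hxy : T.Adj x y)
    (hx : ∀ t, ¬ Term 𝓔 (doubled T I) (rungs I) x t) :
    LadderIndep 𝓔 (insert (rail x y j) I) := by
  refine ⟨insert_subset (rail_mem hxy) hI.1, ?_⟩
  rw [rungs_insert_rail]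
  refine AtMostOne.add_edge (a := x) (b := y) (fun a b h => ?_) hI.2 hx
  by_contra! hcon
  refine hcon.1 ⟨h.1, fun i => (h.2 i).resolve_left fun he => ?_⟩
  rw [rail_eq_rail] at he
  rcases he.2 with ⟨h1, h2⟩ | ⟨h1, h2⟩
  · exact hcon.2.1 h1 h2
  · exact hcon.2.2 h1 h2

/-- As the other lift is absent, no new doubled edge arises. -/
theorem LadderIndep.insert_rail_of_notMem (hI : LadderIndep 𝓔 I) {x y : V} {j k : Fin 2}
    (hxy : T.Adj x y) (hjk : j ≠ k) (hk : rail x y k ∉ I) :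
    LadderIndep 𝓔 (insert (rail x y j) I) := by
  refine ⟨insert_subset (rail_mem hxy) hI.1, ?_⟩
  rw [rungs_insert_rail]
  have hD : doubled T (insert (rail x y j) I) ≤ doubled T I := by
    refine fun a b h => ⟨h.1, fun i => (h.2 i).resolve_left fun he => ?_⟩
    rw [rail_eq_rail] at he
    have hmem := (h.2 k).resolve_left fun h' => hjk (rail_eq_rail.1 h').1.symm
    rcases he.2 with ⟨rfl, rfl⟩ | ⟨rfl, rfl⟩
    · exact hk hmem
    · rw [rail_comm] at hmem
      exact hk hmem
  exact AtMostOne.anti hD subset_rfl hI.2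

/-- The test for maximality inside `I`. In components with a terminal, a further rung would be a
second terminal. A further rail would complete a doubled edge between two components of `doubled T
J`; their terminals would then coincide, whereas distinct components share none. Terminal-free
components are not extended by assumption. -/
theorem LadderIndep.eq_of_subset (hT : T.IsAcyclic) (hI : LadderIndep 𝓔 I) (hIJ : J ⊆ I)
    (h1 : ∀ x y j, T.Adj x y → rail x y j ∈ I → ∃ k, rail x y k ∈ J)
    (h2 : ∀ v, (∃ t, Term 𝓔 (doubled T J) (rungs J) v t) ∨
      ∀ x, (doubled T J).Reachable v x →
        x ∉ rungs I ∧ ∀ y, (doubled T I).Adj x y → (doubled T J).Adj x y) : J = I := by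
  have hm1 := doubled_mono (T := T) hIJ
  have hm2 := rungs_mono hIJ
  refine hIJ.antisymm fun e he => ?_
  by_contra heJ
  rcases mem_edgeSet_ladder.1 (hI.1 he) with ⟨v, rfl⟩ | ⟨x, y, j, hxy, rfl⟩
  · rcases h2 v with ⟨t, ht⟩ | h
    · obtain rfl : t = Sum.inl v :=
        hI.2 v _ _ (ht.mono hm1 hm2) ⟨he, SimpleGraph.Reachable.refl v⟩
      exact heJ ht.1
    · exact (h v (SimpleGraph.Reachable.refl v)).1 he
  · obtain ⟨k, hk⟩ := h1 x y j hxy he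
    have hjk : j ≠ k := by
      rintro rfl
      exact heJ hk
    have hadj : (doubled T I).Adj x y := ⟨hxy, fun i => by
      have : i = j ∨ i = k := by omega
      rcases this with rfl | rfl
      · exact he
      · exact hIJ hk⟩
    have hn : ¬ (doubled T J).Adj x y := fun h => heJ (h.2 j)
    rcases h2 x with ⟨t, ht⟩ | h
    · rcases h2 y with ⟨t', ht'⟩ | h
      · obtain rfl : t = t' := hI.2 x _ _ (ht.mono hm1 hm2)
          ((ht'.mono hm1 hm2).of_reachable hadj.reachable)
        exact not_reachable_of_not_adj hT (doubled_le T J) hxy hn (ht.reachable ht')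
      · exact hn ((h y (SimpleGraph.Reachable.refl y)).2 x hadj.symm).symm
    · exact hn ((h x (SimpleGraph.Reachable.refl x)).2 y hadj)

/-- `exists_maximal_atMostOne` decides which edges are doubled and which rungs are kept; `J` is the
largest subset of `X` realising this choice up to which lift of a remaining edge is dropped. -/
theorem LadderIndep.exists_maximal_subset (hT : T.IsAcyclic) (hI : LadderIndep 𝓔 I)
    (hX : X ⊆ (ladder T).edgeSet) (hIX : I ⊆ X) :
    ∃ J, I ⊆ J ∧ Maximal (fun K => LadderIndep 𝓔 K ∧ K ⊆ X) J := by
  obtain ⟨D, R, hD1, hD2, hR1, hR2, hDR, hmax⟩ := exists_maximal_atMostOne hT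
    (doubled_mono (T := T) hIX) (doubled_le T X) (rungs_mono hIX) hI.2
  -- for each edge of `T` that is doubled in `X` but not in `D`, one lift has to be left out
  set skip : Set (Sym2 (V × Fin 2)) := {e | ∃ x y j, e = rail x y j ∧ (doubled T X).Adj x y ∧
    ¬ D.Adj x y ∧ e ∉ I ∧ (j = 0 → rail x y 1 ∈ I)} with hskip
  set J : Set (Sym2 (V × Fin 2)) :=
    {e | e ∈ X ∧ (∀ v, e = rung v → v ∈ R) ∧ e ∉ skip} with hJ
  have hJX : J ⊆ X := fun e he => he.1
  have hIJ : I ⊆ J := by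
    refine fun e he => ⟨hIX he, ?_, ?_⟩
    · rintro v rfl
      exact hR1 he
    · rintro ⟨x, y, j, -, -, -, h, -⟩
      exact h he
  have hRJ : rungs J = R := by
    ext v
    constructor
    · intro h
      exact h.2.1 v rfl
    · intro h
      refine ⟨hR2 h, fun w hw => rung_eq_rung.1 hw ▸ h, ?_⟩
      rintro ⟨x, y, j, h, -⟩
      exact rung_ne_rail _ _ _ _ h
  have hDJ : doubled T J = D := by
    ext x y
    constructor
    · intro h
      by_contra hn
      have hXxy : (doubled T X).Adj x y := ⟨h.1, fun j => (h.2 j).1⟩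
      -- The lift dropped is the one at level `1` unless that lies in `I`, and then the one at level
      -- `0`. If neither is dropped, both lie in `I`, and `D` already has the edge.
      have hn' : ∀ j, (j = 0 → rail x y 1 ∈ I) → rail x y j ∈ I := by
        intro j hj
        by_contra hjI
        exact (h.2 j).2.2 ⟨x, y, j, rfl, hXxy, hn, hjI, hj⟩
      have h1 := hn' 1 (by simp)
      have h0 := hn' 0 fun _ => h1
      exact hn (hD1 ⟨h.1, fun j => by
        have : j = 0 ∨ j = 1 := by omega
        rcases this with rfl | rfl
        · exact h0
        · exact h1⟩)
    · intro h
      have hX' := hD2 h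
      refine ⟨hX'.1, fun j => ⟨hX'.2 j, fun v hv => absurd hv.symm (rung_ne_rail _ _ _ _), ?_⟩⟩
      rintro ⟨a, b, i, he, -, hab, -⟩
      rcases (rail_eq_rail.1 he).2 with ⟨rfl, rfl⟩ | ⟨rfl, rfl⟩
      · exact hab h
      · exact hab h.symm
  refine ⟨J, hIJ, ⟨⟨hJX.trans hX, by rwa [hDJ, hRJ]⟩, hJX⟩, ?_⟩
  rintro K ⟨hK, hKX⟩ hJK
  refine (LadderIndep.eq_of_subset hT hK hJK ?_ ?_).symm.subset
  · intro x y j hxy hj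
    by_cases hd : (doubled T X).Adj x y
    · by_contra! hcon
      have hnD : ¬ D.Adj x y := by
        rw [← hDJ]
        exact fun h => hcon 0 (h.2 0)
      refine hcon 0 ⟨hd.2 0, fun v hv => absurd hv.symm (rung_ne_rail _ _ _ _), ?_⟩
      rintro ⟨a, b, i, he, -, -, -, hi⟩
      obtain ⟨rfl, hab⟩ := rail_eq_rail.1 he
      refine hcon 1 (hIJ ?_)
      rcases hab with ⟨rfl, rfl⟩ | ⟨rfl, rfl⟩
      · exact hi rfl
      · rw [rail_comm]
        exact hi rfl
    · refine ⟨j, hKX hj, fun v hv => absurd hv.symm (rung_ne_rail _ _ _ _), ?_⟩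
      rintro ⟨a, b, i, he, hab, -⟩
      rcases (rail_eq_rail.1 he).2 with ⟨rfl, rfl⟩ | ⟨rfl, rfl⟩
      · exact hd hab
      · exact hd hab.symm
  · intro v
    rw [hDJ, hRJ]
    refine (hmax v).imp_right fun h x hx => ⟨fun h' => (h x hx).1 (hKX h'), fun y hy =>
      (h x hx).2 y (doubled_mono hKX hy)⟩

/-- Maximal independent sets contain a lift of every edge of `T`, and each of their components
has a terminal. -/
theorem exists_term_of_maximal (hB : Maximal (LadderIndep 𝓔) B) :
    (∀ x y, T.Adj x y → ∃ k, rail x y k ∈ B) ∧ ∀ v, ∃ t, Term 𝓔 (doubled T B) (rungs B) v t := by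
  constructor
  · intro x y hxy
    by_contra! hcon
    exact hcon 0 (hB.2 (hB.1.insert_rail_of_notMem hxy (j := 0) (k := 1) (by decide) (hcon 1))
      (subset_insert _ _) (mem_insert _ _))
  · intro v
    by_contra! hcon
    have := hB.2 (hB.1.insert_rung hcon) (subset_insert _ _) (mem_insert _ _)
    exact hcon (Sum.inl v) ⟨this, SimpleGraph.Reachable.refl v⟩

theorem LadderIndep.maximal (hT : T.IsAcyclic) (hI : LadderIndep 𝓔 I)
    (h1 : ∀ x y, T.Adj x y → ∃ k, rail x y k ∈ I)
    (h2 : ∀ v, ∃ t, Term 𝓔 (doubled T I) (rungs I) v t) : Maximal (LadderIndep 𝓔) I :=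
  ⟨hI, fun _ hK hIK => (LadderIndep.eq_of_subset hT hK hIK (fun x y _ hxy _ => h1 x y hxy)
    fun v => Or.inl (h2 v)).symm.subset⟩

/-- If `I` misses both lifts of an edge, a lift in `B` can be added without changing the doubled
graph. Otherwise some component of `doubled T I` has no terminal. Following `doubled T B` from there
to a terminal produces a rung in that component or an edge leaving it, and a terminal-free component
can absorb either. -/
theorem LadderIndep.exists_insert (hT : T.IsAcyclic) (hI : LadderIndep 𝓔 I)
    (hnI : ¬ Maximal (LadderIndep 𝓔) I) (hB : Maximal (LadderIndep 𝓔) B) :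
    ∃ e ∈ B \ I, LadderIndep 𝓔 (insert e I) := by
  obtain ⟨hB1, hB2⟩ := exists_term_of_maximal hB
  by_cases h1 : ∀ x y, T.Adj x y → ∃ k, rail x y k ∈ I
  · by_cases h2 : ∀ v, ∃ t, Term 𝓔 (doubled T I) (rungs I) v t
    · exact absurd (hI.maximal hT h1 h2) hnI
    · push Not at h2
      obtain ⟨v, hv⟩ := h2
      obtain ⟨t, ht⟩ := hB2 v
      rcases Term.exists_exit hT (doubled_le T I) (doubled_le T B) hv ht with
        ⟨w, hw, hvw⟩ | ⟨x, y, hxy, hx, hy⟩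
      · refine ⟨rung w, ⟨hw, fun h => hv (Sum.inl w) ⟨h, hvw⟩⟩, hI.insert_rung fun t ht => ?_⟩
        exact hv t (ht.of_reachable hvw)
      · have hn : ¬ (doubled T I).Adj x y := fun h => hy (hx.trans h.reachable)
        obtain ⟨j, hj⟩ : ∃ j, rail x y j ∉ I := by
          by_contra! hcon
          exact hn ⟨hxy.1, hcon⟩
        exact ⟨rail x y j, ⟨hxy.2 j, hj⟩,
          hI.insert_rail hxy.1 fun t ht => hv t (ht.of_reachable hx)⟩
  · push Not at h1
    obtain ⟨x, y, hxy, hno⟩ := h1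
    obtain ⟨k, hk⟩ := hB1 x y hxy
    -- In `Fin 2`, `k + 1` is the other level.
    exact ⟨rail x y k, ⟨hk, hno k⟩, hI.insert_rail_of_notMem hxy (k := k + 1)
      (by omega) (hno _)⟩

theorem ladderIndep_empty : LadderIndep 𝓔 ∅ := by
  refine ⟨empty_subset _, fun v t t' ht ht' => ?_⟩
  have key : ∀ t, ¬ Term 𝓔 (doubled T ∅) (rungs ∅) v t := by
    rintro (w | ω) h
    · exact absurd h.1 (notMem_empty _)
    · obtain ⟨s, h1, -⟩ := h
      exact absurd ((h1.adj 0).2 0) (notMem_empty _)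
  exact absurd ht (key t)

variable (𝓔) in
/-- The matroid on the edge set of the ladder given by `LadderIndep`. -/
def ladderMatroid (hT : T.IsAcyclic) : Matroid (Sym2 (V × Fin 2)) :=
  IndepMatroid.matroid
    { E := (ladder T).edgeSet
      Indep := LadderIndep 𝓔
      indep_empty := ladderIndep_empty
      indep_subset := fun _ _ hJ h => hJ.subset h
      indep_aug := fun _ _ hI hnI hB => hI.exists_insert hT hnI hB
      indep_maximal := fun _ hX _ hI hIX => hI.exists_maximal_subset hT hX hIX
      subset_ground := fun _ hI => hI.1 }

/-- The complement of a set meeting all bases spans a forest with a component which has no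
terminal and is not extended by that complement, or misses both lifts of some edge. -/
theorem exists_of_meets_bases (hT : T.IsAcyclic) {F : Set (Sym2 (V × Fin 2))}
    (hF : ∀ B, (ladderMatroid 𝓔 hT).IsBase B → (F ∩ B).Nonempty) :
    (∃ x y, T.Adj x y ∧ ∀ j, rail x y j ∈ F) ∨
    ∃ (D : SimpleGraph V) (v : V), D ≤ T ∧ (∀ R t, (∀ x, D.Reachable v x → x ∉ R) →
      ¬ Term 𝓔 D R v t) ∧ (∀ x, D.Reachable v x → rung x ∈ F) ∧
      ∀ x y, D.Reachable v x → ¬ D.Reachable v y → T.Adj x y → ∃ j, rail x y j ∈ F := by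
  by_cases hpair : ∃ x y, T.Adj x y ∧ ∀ j, rail x y j ∈ F
  · exact Or.inl hpair
  right
  push Not at hpair
  -- A maximal independent set `J` outside `F` contains a lift of every edge. It is not a base, so
  -- one of its components has no terminal, and by maximality whatever could be added there lies in
  -- `F`.
  obtain ⟨J, -, hJ⟩ := (ladderIndep_empty (𝓔 := 𝓔)).exists_maximal_subset hT
    (X := (ladder T).edgeSet \ F) sdiff_subset (empty_subset _)
  have h1 : ∀ x y, T.Adj x y → ∃ k, rail x y k ∈ J := by
    intro x y hxy
    by_contra! hcon
    obtain ⟨j, hj⟩ := hpair x y hxy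
    exact hcon j (hJ.2 ⟨hJ.1.1.insert_rail_of_notMem hxy (j := j) (k := j + 1) (by omega) (hcon _),
      insert_subset ⟨rail_mem hxy, hj⟩ hJ.1.2⟩ (subset_insert _ _) (mem_insert _ _))
  have h2 : ∃ v, ∀ t, ¬ Term 𝓔 (doubled T J) (rungs J) v t := by
    by_contra! h2
    obtain ⟨e, he1, he2⟩ := hF J (hJ.1.1.maximal hT h1 h2)
    exact (hJ.1.2 he2).2 he1
  obtain ⟨v, hv⟩ := h2
  refine ⟨doubled T J, v, doubled_le T J, ?_, ?_, ?_⟩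
  · rintro R (w | ω) hR ht
    · exact hR w ht.2 ht.1
    · exact hv (Sum.inr ω) ht
  · intro x hx
    by_contra hxF
    have hmem := hJ.2 ⟨hJ.1.1.insert_rung (v := x) fun t ht => hv t (ht.of_reachable hx),
      insert_subset ⟨rung_mem x, hxF⟩ hJ.1.2⟩ (subset_insert _ _) (mem_insert _ _)
    exact hv (Sum.inl x) ⟨hmem, hx⟩
  · intro x y hx hy hxy
    by_contra! hcon
    refine hy (hx.trans (SimpleGraph.Adj.reachable ⟨hxy, fun j => ?_⟩))
    exact hJ.2 ⟨hJ.1.1.insert_rail hxy fun t ht => hv t (ht.of_reachable hx),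
      insert_subset ⟨rail_mem hxy, hcon j⟩ hJ.1.2⟩ (subset_insert _ _) (mem_insert _ _)

end LadderMatroid

/-! ### Open sets and continuous functions of `|G|_Ψ`; bounded cuts. -/

section Topology

variable {V : Type*} {G : SimpleGraph V}

theorem src_tgt_eq (e : G.edgeSet) : s(src e, tgt e) = (e : Sym2 V) := Quot.out_eq e.1

theorem adj_src_tgt (e : G.edgeSet) : G.Adj (src e) (tgt e) := by
  have := e.2
  rwa [← src_tgt_eq e, SimpleGraph.mem_edgeSet] at this

theorem src_mem (e : G.edgeSet) : src e ∈ (e : Sym2 V) := by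
  rw [← src_tgt_eq e]; exact Sym2.mem_mk_left _ _

theorem tgt_mem (e : G.edgeSet) : tgt e ∈ (e : Sym2 V) := by
  rw [← src_tgt_eq e]; exact Sym2.mem_mk_right _ _

theorem isOpen_hat {S : Finset V} (C : G.ComponentCompl (S : Set V)) :
    IsOpen (hat G (C : Set V)) := by
  refine ⟨fun v hv => ⟨1, one_pos, le_rfl, ?_⟩, fun e x hx => ⟨_, lt_min x.2.1 (sub_pos.2 x.2.2),
    le_rfl, ?_⟩, fun ω hω => ⟨S, C, ?_, subset_rfl⟩⟩
  · rcases hv with ⟨w, hw, h⟩ | ⟨e, x, h, -⟩ | ⟨ω, h, -⟩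
    · cases h
      rintro p (rfl | ⟨e, x, rfl, h⟩)
      · exact Or.inl ⟨v, hw, rfl⟩
      · refine Or.inr (Or.inl ⟨e, x, rfl, h.imp (fun h => ?_) (fun h => ?_)⟩)
        · exact h.1 ▸ hw
        · exact h.1 ▸ hw
    · cases h
    · cases h
  · rcases hx with ⟨w, hw, h⟩ | ⟨e', x', h, h'⟩ | ⟨ω, h, -⟩
    · cases h
    · cases h
      rintro p ⟨y, rfl, -⟩
      exact Or.inr (Or.inl ⟨e, y, rfl, h'⟩)
    · cases h
  · rcases hω with ⟨w, hw, h⟩ | ⟨e', x', h, h'⟩ | ⟨ω, h, h'⟩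
    · cases h
    · cases h
    · cases h
      exact h'

theorem isOpen_innerBall (e : G.edgeSet) (x : Set.Ioo (0 : ℝ) 1) (ε : ℝ) :
    IsOpen (innerBall e x ε) := by
  refine ⟨fun v hv => ?_, fun e' y hy => ?_, fun ω hω => ?_⟩
  · obtain ⟨y, h, -⟩ := hv
    cases h
  · obtain ⟨y, h, hy⟩ := hy
    cases h
    refine ⟨min (ε - |(y : ℝ) - x|) (min (y : ℝ) (1 - y)),
      lt_min (by linarith) (lt_min y.2.1 (sub_pos.2 y.2.2)), min_le_right _ _, ?_⟩
    rintro p ⟨z, rfl, hz⟩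
    refine ⟨z, rfl, ?_⟩
    have h1 := hz.trans_le (min_le_left _ _)
    have h2 := abs_sub_le (z : ℝ) y x
    linarith
  · obtain ⟨y, h, -⟩ := hω
    cases h

theorem isOpen_vertBall (v : V) {ε : ℝ} (hε : 0 < ε) : IsOpen (vertBall G v ε) := by
  refine ⟨fun w hw => ?_, fun e x hx => ?_, fun ω hω => ?_⟩
  · rcases hw with h | ⟨e, x, h, -⟩
    · cases h
      exact ⟨min ε 1, lt_min hε one_pos, min_le_right _ _, vertBall_mono G v (min_le_left _ _)⟩
    · cases h
  · rcases hx with h | ⟨e', x', h, h'⟩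
    · cases h
    · cases h
      rcases h' with ⟨h1, h2⟩ | ⟨h1, h2⟩
      · refine ⟨min (ε - x) (min (x : ℝ) (1 - x)),
          lt_min (by linarith) (lt_min x.2.1 (sub_pos.2 x.2.2)), min_le_right _ _, ?_⟩
        rintro p ⟨z, rfl, hz⟩
        refine Or.inr ⟨e, z, rfl, Or.inl ⟨h1, ?_⟩⟩
        have h3 := (abs_lt.1 (hz.trans_le (min_le_left _ _))).2
        linarith
      · refine ⟨min (ε - (1 - x)) (min (x : ℝ) (1 - x)),
          lt_min (by linarith) (lt_min x.2.1 (sub_pos.2 x.2.2)), min_le_right _ _, ?_⟩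
        rintro p ⟨z, rfl, hz⟩
        refine Or.inr ⟨e, z, rfl, Or.inr ⟨h1, ?_⟩⟩
        have h3 := (abs_lt.1 (hz.trans_le (min_le_left _ _))).1
        linarith
  · rcases hω with h | ⟨e', x', h, h'⟩
    · cases h
    · cases h

/-- The function on `|G|` with the given values on vertices, ends and edges. -/
def glue (fV : V → ℝ) (fE : Ends G → ℝ) (g : G.edgeSet → ℝ → ℝ) : Pt G → ℝ
  | Pt.vert v => fV v
  | Pt.ending ω => fE ω
  | Pt.inner e x => g e x

/-- A common Lipschitz constant `1` lets the `η`-ball serve at vertices and inner points whatever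
the degree; at ends the function is locally constant. -/
theorem continuous_glue {Ψ : Set (Ends G)} {fV : V → ℝ} {fE : Ends G → ℝ}
    {g : G.edgeSet → ℝ → ℝ}
    (h1 : ∀ e, ∀ x ∈ Icc (0 : ℝ) 1, ∀ y ∈ Icc (0 : ℝ) 1, |g e x - g e y| ≤ |x - y|)
    (h2 : ∀ e, g e 0 = fV (src e)) (h3 : ∀ e, g e 1 = fV (tgt e))
    (h4 : ∀ ω ∈ Ψ, ∃ (S : Finset V) (C : G.ComponentCompl (S : Set V)),
      ω.LivesIn (C : Set V) ∧ ∀ p ∈ hat G (C : Set V), glue fV fE g p = fE ω) :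
    Continuous fun p : PsiSpace Ψ => glue fV fE g p.1 := by
  rw [continuous_iff_continuousAt]
  rintro ⟨p, hp⟩
  rw [ContinuousAt, Metric.tendsto_nhds]
  intro η hη
  have key : ∀ U : Set (Pt G), IsOpen U → p ∈ U →
      (∀ q ∈ U, dist (glue fV fE g q) (glue fV fE g p) < η) →
      ∀ᶠ q in nhds (⟨p, hp⟩ : PsiSpace Ψ), dist (glue fV fE g q.1) (glue fV fE g p) < η := by
    intro U hU hpU h
    filter_upwards [(hU.preimage continuous_subtype_val).mem_nhds
      (x := (⟨p, hp⟩ : PsiSpace Ψ)) hpU] with q hq using h q.1 hq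
  have hIcc : ∀ x : Set.Ioo (0 : ℝ) 1, (x : ℝ) ∈ Icc (0 : ℝ) 1 := fun x => Ioo_subset_Icc_self x.2
  rcases p with v | ω | ⟨e, x⟩
  · refine key (vertBall G v η) (isOpen_vertBall v hη) (Or.inl rfl) ?_
    rintro q (rfl | ⟨e, x, rfl, ⟨h, hx⟩ | ⟨h, hx⟩⟩)
    · simpa using hη
    · have := h1 e x (hIcc x) 0 (by simp)
      rw [h2, h, sub_zero, abs_of_pos x.2.1] at this
      rw [Real.dist_eq]
      exact this.trans_lt hx
    · have := h1 e x (hIcc x) 1 (by simp)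
      rw [h3, h, abs_sub_comm (x : ℝ), abs_of_pos (sub_pos.2 x.2.2)] at this
      rw [Real.dist_eq]
      exact this.trans_lt hx
  · obtain ⟨S, C, hC, h⟩ := h4 ω (hp ω rfl)
    refine key (hat G (C : Set V)) (isOpen_hat C) (Or.inr (Or.inr ⟨ω, rfl, hC⟩)) fun q hq => ?_
    rw [h q hq]
    simpa [glue] using hη
  · refine key (innerBall e x η) (isOpen_innerBall e x η) ⟨x, rfl, by simpa using hη⟩ ?_
    rintro q ⟨y, rfl, hy⟩
    rw [Real.dist_eq]
    exact (h1 e y (hIcc y) x (hIcc x)).trans_lt hy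

/-- The cut of `G` induced by the bipartition `X, Xᶜ`. -/
def cutEdges (G : SimpleGraph V) (X : Set V) : Set (Sym2 V) :=
  {e | e ∈ G.edgeSet ∧ ∃ u v, e = s(u, v) ∧ u ∈ X ∧ v ∉ X}

theorem mem_cutEdges {X : Set V} {u v : V} :
    s(u, v) ∈ cutEdges G X ↔ G.Adj u v ∧ ((u ∈ X ∧ v ∉ X) ∨ (v ∈ X ∧ u ∉ X)) := by
  constructor
  · rintro ⟨h, a, b, hab, ha, hb⟩
    refine ⟨h, ?_⟩
    rcases Sym2.eq_iff.1 hab with ⟨rfl, rfl⟩ | ⟨rfl, rfl⟩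
    · exact Or.inl ⟨ha, hb⟩
    · exact Or.inr ⟨ha, hb⟩
  · rintro ⟨h, h' | h'⟩
    · exact ⟨h, u, v, rfl, h'⟩
    · exact ⟨h, v, u, Sym2.eq_swap, h'⟩

open Classical in
/-- A function which is `1` on one side of a cut and `0` on the other. -/
noncomputable def cutFun (G : SimpleGraph V) (X : Set V) : Pt G → ℝ :=
  glue (fun v => if v ∈ X then 1 else 0) (fun ω => if ω.LivesIn X then 1 else 0)
    fun e x => (1 - x) * (if src e ∈ X then 1 else 0) + x * (if tgt e ∈ X then 1 else 0)

theorem subset_of_component {S : Set V} (C : G.ComponentCompl S) {A : Set V}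
    (hA : ∀ x ∈ C, ∀ y ∈ C, x ∈ A → G.Adj x y → y ∈ A) {u : V} (hu : u ∈ C) (huA : u ∈ A) :
    (C : Set V) ⊆ A := by
  rintro w hw
  obtain ⟨huS, hu'⟩ := hu
  obtain ⟨hwS, hw'⟩ := hw
  have hr := SimpleGraph.ConnectedComponent.exact (hu'.trans hw'.symm)
  have := mem_of_reachable (A := {z : (Sᶜ : Set V) | (z : V) ∈ A ∧ (z : V) ∈ C}) ?_ hr
    ⟨huA, ⟨huS, hu'⟩⟩
  · exact this.1
  · rintro ⟨x, hx⟩ ⟨y, hy⟩ ⟨h1, h2⟩ hxy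
    have hyC : y ∈ C := SimpleGraph.ComponentCompl.mem_of_adj _ _ h2 hy hxy
    exact ⟨hA x h2 y hyC h1 hxy, hyC⟩

theorem not_livesIn_of_disjoint {ω : Ends G} {S : Finset V} {C : G.ComponentCompl (S : Set V)}
    (hC : ω.LivesIn (C : Set V)) {X : Set V} (h : Disjoint (C : Set V) X) : ¬ ω.LivesIn X := by
  rintro ⟨r, hr, hrX⟩
  obtain ⟨r', hr', hrC⟩ := hC
  obtain ⟨D, hD, ⟨N, hN⟩⟩ := (Quotient.exact (hr'.trans hr.symm) : RayEquiv r' r) S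
  obtain rfl := Ray.hasTailIn_unique ⟨0, fun n _ => hrC n⟩ hD
  exact Set.disjoint_left.1 h (hN N le_rfl) (hrX N)

theorem Ends.LivesIn.mono {ω : Ends G} {X Y : Set V} (h : ω.LivesIn X) (hXY : X ⊆ Y) : ω.LivesIn Y := by
  obtain ⟨r, hr, hrX⟩ := h
  exact ⟨r, hr, fun n => hXY (hrX n)⟩

theorem exists_of_not_mem_closure {Ψ : Set (Ends G)} {F : Set (Sym2 V)} (hF : IsPsiBounded Ψ F)
    {ω : Ends G} (hω : ω ∈ Ψ) : ∃ (S : Finset V) (C : G.ComponentCompl (S : Set V)),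
      ω.LivesIn (C : Set V) ∧ ∀ e : G.edgeSet, (e : Sym2 V) ∈ F → ∀ v ∈ (e : Sym2 V), v ∉ C := by
  have hp : ∀ ω', Pt.ending ω = Pt.ending (G := G) ω' → ω' ∈ Ψ := by
    intro ω' h
    cases h
    exact hω
  have h1 : (⟨Pt.ending ω, hp⟩ : PsiSpace Ψ) ∉ closure (edgePoints Ψ F) := fun h =>
    hF _ h ω rfl
  rw [mem_closure_iff] at h1
  push Not at h1
  obtain ⟨U, ⟨W, hW, rfl⟩, hpU, hU⟩ := h1
  obtain ⟨S, C, hC, hCW⟩ := hW.2.2 ω hpU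
  refine ⟨S, C, hC, fun e he v hv hvC => ?_⟩
  -- `hat` contains all inner points of an edge or none, so testing the midpoint is enough.
  have hx : (1 / 2 : ℝ) ∈ Ioo (0 : ℝ) 1 := by norm_num
  have hmem : (⟨Pt.inner e ⟨1 / 2, hx⟩, fun ω h => by cases h⟩ : PsiSpace Ψ) ∈
      Subtype.val ⁻¹' W ∩ edgePoints Ψ F := by
    refine ⟨hCW (Or.inr (Or.inl ⟨e, _, rfl, ?_⟩)), ⟨e, _, he, rfl⟩⟩
    rw [← src_tgt_eq e, Sym2.mem_iff] at hv
    rcases hv with rfl | rfl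
    · exact Or.inl hvC
    · exact Or.inr hvC
  rw [hU] at hmem
  exact hmem

theorem isPsiBounded_of_exists {Ψ : Set (Ends G)} {F : Set (Sym2 V)}
    (h : ∀ ω ∈ Ψ, ∃ (S : Finset V) (C : G.ComponentCompl (S : Set V)),
      ω.LivesIn (C : Set V) ∧ ∀ e ∈ F, ∀ v ∈ e, v ∉ C) : IsPsiBounded Ψ F := by
  intro p hp ω hpω
  obtain ⟨S, C, hC, hCF⟩ := h ω (p.2 ω hpω)
  rw [mem_closure_iff] at hp
  obtain ⟨q, hq, e, x, heF, hqe⟩ := hp (Subtype.val ⁻¹' hat G (C : Set V))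
    ((isOpen_hat C).preimage continuous_subtype_val) (Or.inr (Or.inr ⟨ω, hpω, hC⟩))
  rw [mem_preimage, hqe] at hq
  rcases hq with ⟨w, hw, h⟩ | ⟨e', x', h, h'⟩ | ⟨ω, h, -⟩
  · cases h
  · cases h
    rcases h' with h' | h'
    · exact hCF _ heF _ (src_mem e) h'
    · exact hCF _ heF _ (tgt_mem e) h'
  · cases h

theorem isPsiBounded_of_finite (Ψ : Set (Ends G)) {F : Set (Sym2 V)} (hF : F.Finite) :
    IsPsiBounded Ψ F := by
  have hfin : {v | ∃ e ∈ F, v ∈ e}.Finite := by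
    have : {v | ∃ e ∈ F, v ∈ e} = ⋃ e ∈ F, {v | v ∈ e} := by ext; simp
    rw [this]
    refine hF.biUnion fun e _ => ?_
    induction e using Sym2.ind with
    | _ a b => exact (Set.toFinite {a, b}).subset fun v hv => by simpa using hv
  refine isPsiBounded_of_exists fun ω _ => ?_
  obtain ⟨C, hC⟩ := ω.exists_livesIn hfin.toFinset
  refine ⟨_, C, hC, fun e he v hv hvC => ?_⟩
  obtain ⟨h, -⟩ := hvC
  exact h (by simpa using ⟨e, he, hv⟩)

theorem cutFun_inner_of_notMem {X : Set V} {e : G.edgeSet} (he : (e : Sym2 V) ∉ cutEdges G X)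
    (x : Set.Ioo (0 : ℝ) 1) : cutFun G X (Pt.inner e x) = 0 ∨ cutFun G X (Pt.inner e x) = 1 := by
  have hadj := adj_src_tgt e
  rw [← src_tgt_eq e, mem_cutEdges] at he
  unfold cutFun glue
  by_cases h1 : src e ∈ X <;> by_cases h2 : tgt e ∈ X <;> simp_all

theorem cutFun_inner_of_mem {X : Set V} {e : G.edgeSet} (he : (e : Sym2 V) ∈ cutEdges G X) :
    (∀ x, cutFun G X (Pt.inner e x) = x) ∨ ∀ x, cutFun G X (Pt.inner e x) = 1 - x := by
  rw [← src_tgt_eq e, mem_cutEdges] at he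
  unfold cutFun glue
  rcases he.2 with ⟨h1, h2⟩ | ⟨h1, h2⟩
  · right; intro x; simp [h1, h2]
  · left; intro x; simp [h1, h2]

theorem cutFun_of_isVertex {Ψ : Set (Ends G)} {p : PsiSpace Ψ} (hp : IsVertex p) (X : Set V) :
    cutFun G X p.1 = 0 ∨ cutFun G X p.1 = 1 := by
  obtain ⟨p, hp'⟩ := p
  unfold cutFun glue
  rcases p with v | ω | ⟨e, x⟩
  · by_cases h : v ∈ X <;> simp [h]
  · by_cases h : ω.LivesIn X <;> simp [h]
  · exact absurd rfl (hp e x)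

/-- Boundedness gives each end in `Ψ` a component `C` untouched by cut edges. Being connected, `C`
lies on one side of the cut, and the function is constant on its `hat`. -/
theorem continuous_cutFun {Ψ : Set (Ends G)} {X : Set V} (hX : IsPsiBounded Ψ (cutEdges G X)) :
    Continuous fun p : PsiSpace Ψ => cutFun G X p.1 := by
  classical
  refine continuous_glue ?_ ?_ ?_ ?_
  · intro e x _ y _
    by_cases h1 : src e ∈ X <;> by_cases h2 : tgt e ∈ X <;> simp [h1, h2, abs_sub_comm]
  · intro e; simp
  · intro e; simp
  · intro ω hω
    obtain ⟨S, C, hC, hCF⟩ := exists_of_not_mem_closure hX hω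
    refine ⟨S, C, hC, ?_⟩
    have hcut : ∀ x ∈ C, ∀ y, G.Adj x y → (x ∈ X ↔ y ∈ X) := by
      intro x hx y hxy
      have : s(x, y) ∉ cutEdges G X := fun h =>
        hCF ⟨s(x, y), hxy⟩ h x (Sym2.mem_mk_left _ _) hx
      rw [mem_cutEdges] at this
      tauto
    have hsides : ((C : Set V) ⊆ X) ∨ Disjoint (C : Set V) X := by
      by_cases h : ∃ u ∈ C, u ∈ X
      · obtain ⟨u, hu, huX⟩ := h
        exact Or.inl (subset_of_component C
          (fun x hx y _ hxX hxy => (hcut x hx y hxy).1 hxX) hu huX)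
      · push Not at h
        exact Or.inr (Set.disjoint_left.2 h)
    have hedge : ∀ e : G.edgeSet, (src e ∈ C ∨ tgt e ∈ C) → (src e ∈ X ↔ tgt e ∈ X) := by
      rintro e (he | he)
      · exact hcut _ he _ (adj_src_tgt e)
      · exact (hcut _ he _ (adj_src_tgt e).symm).symm
    rcases hsides with hs | hs
    · rintro p (⟨v, hv, rfl⟩ | ⟨e, x, rfl, he⟩ | ⟨ω', rfl, hω'⟩)
      · have h1 : v ∈ X := hs hv
        simp [glue, h1, hC.mono hs]
      · have h0 : src e ∈ X ∧ tgt e ∈ X := by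
          have := hedge e he
          rcases he with he | he
          · exact ⟨hs he, this.1 (hs he)⟩
          · exact ⟨this.2 (hs he), hs he⟩
        simp [glue, h0.1, h0.2, hC.mono hs]
      · simp [glue, hω'.mono hs, hC.mono hs]
    · have hn := not_livesIn_of_disjoint hC hs
      rintro p (⟨v, hv, rfl⟩ | ⟨e, x, rfl, he⟩ | ⟨ω', rfl, hω'⟩)
      · have h1 : v ∉ X := Set.disjoint_left.1 hs hv
        simp [glue, h1, hn]
      · have h0 : src e ∉ X ∧ tgt e ∉ X := by
          have := hedge e he
          rcases he with he | he
          · have h := Set.disjoint_left.1 hs he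
            exact ⟨h, fun h' => h (this.2 h')⟩
          · have h := Set.disjoint_left.1 hs he
            exact ⟨fun h' => h (this.1 h'), h⟩
        simp [glue, h0.1, h0.2, hn]
      · simp [glue, not_livesIn_of_disjoint hω' hs, hn]

end Topology

/-! ### Topology of the circle. -/

section Circle

/-- The difference of the values at antipodal points changes sign, so it vanishes somewhere. -/
theorem not_injective_of_continuous_circle {f : Circle → ℝ} (hf : Continuous f) :
    ¬ Function.Injective f := by
  intro hinj
  have hc : Continuous fun z : Circle => f z - f (-z) := by fun_prop
  obtain ⟨z, hz⟩ : (0 : ℝ) ∈ range fun z : Circle => f z - f (-z) := by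
    refine mem_range_of_exists_le_of_exists_ge hc ?_ ?_
    · rcases le_total (f 1) (f (-1)) with h | h
      · exact ⟨1, by linarith⟩
      · exact ⟨-1, by rw [neg_neg]; linarith⟩
    · rcases le_total (f 1) (f (-1)) with h | h
      · exact ⟨-1, by rw [neg_neg]; linarith⟩
      · exact ⟨1, by linarith⟩
  have h1 : z = -z := hinj (sub_eq_zero.1 hz)
  have h2 : (z : ℂ) = -(z : ℂ) := by
    rw [← Circle.coe_neg]
    exact congrArg _ h1
  exact Circle.coe_ne_zero z (self_eq_neg.1 h2)

theorem isPreconnected_compl_singleton_circle (z : Circle) : IsPreconnected ({z}ᶜ : Set Circle) := by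
  obtain ⟨θ, rfl⟩ := Circle.exp_surjective z
  have : ({Circle.exp θ}ᶜ : Set Circle) = Circle.exp '' Ioo θ (θ + 2 * Real.pi) := by
    ext w
    constructor
    · intro hw
      obtain ⟨φ, rfl⟩ := Circle.exp_surjective w
      obtain ⟨ψ, hψ, h⟩ : ∃ ψ ∈ Ico θ (θ + 2 * Real.pi), Circle.exp φ = Circle.exp ψ :=
        Circle.periodic_exp.exists_mem_Ico Real.two_pi_pos φ θ
      rcases eq_or_lt_of_le hψ.1 with h' | h'
      · exact absurd (h.trans (by rw [h'])) hw
      · exact ⟨ψ, ⟨h', hψ.2⟩, h.symm⟩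
    · rintro ⟨φ, hφ, rfl⟩ h
      have := Circle.exp_injOn_Ico (a := θ) (b := θ + 2 * Real.pi) (by linarith)
        ⟨hφ.1.le, hφ.2⟩ ⟨le_rfl, by linarith [Real.pi_pos]⟩ h
      exact hφ.1.ne' this
  rw [this]
  exact isPreconnected_Ioo.image _ Circle.exp.continuous.continuousOn

variable {X : Type*} [TopologicalSpace X]

theorem isPreconnected_sdiff_singleton {K : Set X} (h : K ≃ₜ Circle) (p : X) (hp : p ∈ K) :
    IsPreconnected (K \ {p}) := by
  have h1 := (isPreconnected_compl_singleton_circle (h ⟨p, hp⟩)).image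
    (fun z => ((h.symm z : K) : X)) (by fun_prop)
  convert h1 using 1
  ext q
  constructor
  · rintro ⟨hq, hqp⟩
    refine ⟨h ⟨q, hq⟩, fun h' => hqp ?_, by simp⟩
    have := h.injective h'
    simpa using this
  · rintro ⟨z, hz, rfl⟩
    refine ⟨(h.symm z).2, fun h' => hz ?_⟩
    have h'' : h.symm z = ⟨p, hp⟩ := Subtype.ext h'
    rw [← h'']
    simp

theorem eq_of_subset_of_homeomorph_circle {K L : Set X} (hKL : K ⊆ L) (hK : K ≃ₜ Circle)
    (hL : L ≃ₜ Circle) : K = L := by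
  refine hKL.antisymm fun p hp => ?_
  by_contra hpK
  set z := hL ⟨p, hp⟩ with hz
  set φ : Circle → Circle := fun w => hL (Set.inclusion hKL (hK.symm w)) with hφ
  have hφc : Continuous φ := by
    have := continuous_inclusion hKL
    fun_prop
  have hφi : Function.Injective φ :=
    hL.injective.comp ((Set.inclusion_injective hKL).comp hK.symm.injective)
  have hφz : ∀ w, φ w ≠ z := by
    intro w hw
    have h1 := hL.injective hw
    have h2 : ((hK.symm w : K) : X) = p := congrArg Subtype.val h1
    exact hpK (h2 ▸ (hK.symm w).2)
  -- The rotation moves the missed point `z` to `-1`, where `Complex.arg` jumps. After it, `arg` is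
  -- continuous and injective on the image of `φ`, which embeds a circle in the line.
  have hslit : ∀ w, ((-(φ w * z⁻¹) : Circle) : ℂ) ∈ Complex.slitPlane := by
    intro w
    rw [Complex.mem_slitPlane_iff_arg]
    refine ⟨fun h => ?_, Circle.coe_ne_zero _⟩
    have h1 : Circle.exp (Complex.arg ((-(φ w * z⁻¹) : Circle) : ℂ)) = -(φ w * z⁻¹) :=
      Circle.exp_arg _
    rw [h] at h1
    have h2 : Circle.exp Real.pi = -1 := by
      ext
      simp [Circle.coe_exp]
    rw [h2, neg_inj] at h1
    exact hφz w (mul_inv_eq_one.1 h1.symm)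
  refine not_injective_of_continuous_circle
    (f := fun w => Complex.arg ((-(φ w * z⁻¹) : Circle) : ℂ)) ?_ ?_
  · rw [continuous_iff_continuousAt]
    intro w
    refine (Complex.continuousAt_arg (hslit w)).comp (f := fun w => ((-(φ w * z⁻¹) : Circle) : ℂ)) ?_
    have : Continuous fun w => ((-(φ w * z⁻¹) : Circle) : ℂ) := by fun_prop
    exact this.continuousAt
  · intro a b hab
    have := Circle.injective_arg hab
    exact hφi (mul_right_cancel (neg_injective this))

end Circle

/-! ### Separating points of `|G|_Ψ`; circles and cuts. -/

section Separation

variable {V : Type*} {G : SimpleGraph V} {Ψ : Set (Ends G)}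

theorem rayEquiv_of_livesIn {ω ω' : Ends G}
    (h : ∀ (S : Finset V) (C D : G.ComponentCompl (S : Set V)),
      ω.LivesIn (C : Set V) → ω'.LivesIn (D : Set V) → C = D) : ω = ω' := by
  obtain ⟨r, rfl⟩ := Quotient.exists_rep ω
  obtain ⟨r', rfl⟩ := Quotient.exists_rep ω'
  refine Quotient.sound fun S => ?_
  obtain ⟨C, hC⟩ := Ends.exists_livesIn (Quotient.mk (raySetoid G) r : Ends G) S
  obtain ⟨D, hD⟩ := Ends.exists_livesIn (Quotient.mk (raySetoid G) r' : Ends G) S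
  obtain rfl := h S C D hC hD
  have key : ∀ s : Ray G, Ends.LivesIn (Quotient.mk (raySetoid G) s) (C : Set V) →
      s.HasTailIn (C : Set V) := by
    rintro s ⟨t, ht, htC⟩
    obtain ⟨B, h1, h2⟩ := (Quotient.exact ht : RayEquiv t s) S
    obtain rfl := Ray.hasTailIn_unique ⟨0, fun n _ => htC n⟩ h1
    exact h2
  exact ⟨C, key r hC, key r' hD⟩

theorem isVertex_iff {p : PsiSpace Ψ} :
    IsVertex p ↔ (∃ v, p.1 = Pt.vert v) ∨ ∃ ω, p.1 = Pt.ending ω := by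
  obtain ⟨p, hp⟩ := p
  rcases p with v | ω | ⟨e, x⟩
  · exact ⟨fun _ => Or.inl ⟨v, rfl⟩, fun _ e x h => by cases h⟩
  · exact ⟨fun _ => Or.inr ⟨ω, rfl⟩, fun _ e x h => by cases h⟩
  · refine ⟨fun h => absurd rfl (h e x), ?_⟩
    rintro (⟨v, h⟩ | ⟨ω, h⟩)
    · cases h
    · cases h

section LocallyFinite

variable (hfin : ∀ v, (G.neighborSet v).Finite)

include hfin

theorem finite_cutEdges {X : Set V} {S : Set V} (hS : S.Finite)
    (h : ∀ u ∈ X, ∀ v ∉ X, G.Adj u v → u ∈ S ∨ v ∈ S) : (cutEdges G X).Finite := by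
  have : cutEdges G X ⊆ ⋃ v ∈ S, (fun w => s(v, w)) '' G.neighborSet v := by
    rintro e ⟨he, u, v, rfl, hu, hv⟩
    rw [SimpleGraph.mem_edgeSet] at he
    rw [mem_iUnion₂]
    rcases h u hu v hv he with h | h
    · exact ⟨u, h, v, he, rfl⟩
    · exact ⟨v, h, u, he.symm, Sym2.eq_swap⟩
  exact (hS.biUnion fun v _ => (hfin v).image _).subset this

/-- A vertex is cut off by its finitely many incident edges. Two ends are separated by a finite `S`,
and every edge leaving a component of `G - S` ends in `S`, so these edges form a finite cut. Finite
cuts are bounded. -/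
theorem exists_cut_separating {p q : PsiSpace Ψ} (hp : IsVertex p) (hq : IsVertex q)
    (hpq : p ≠ q) :
    ∃ X : Set V, IsPsiBounded Ψ (cutEdges G X) ∧ cutFun G X p.1 ≠ cutFun G X q.1 := by
  classical
  have hsingle : ∀ u : V, IsPsiBounded Ψ (cutEdges G {u}) := fun u =>
    isPsiBounded_of_finite Ψ (finite_cutEdges hfin (S := {u}) (Set.finite_singleton u)
      fun a ha _ _ _ => Or.inl ha)
  have hvert : ∀ u : V, ∀ z : PsiSpace Ψ, IsVertex z → z.1 ≠ Pt.vert u →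
      cutFun G {u} z.1 ≠ cutFun G {u} (Pt.vert u) := by
    intro u z hz hzu
    have h1 : cutFun G {u} (Pt.vert u) = 1 := by simp [cutFun, glue]
    rw [h1]
    rcases isVertex_iff.1 hz with ⟨v, h⟩ | ⟨ω, h⟩
    · rw [h] at hzu ⊢
      have : v ≠ u := fun h => hzu (by rw [h])
      simp [cutFun, glue, this]
    · rw [h]
      have : ¬ ω.LivesIn {u} := by
        rintro ⟨r, -, hr⟩
        exact absurd (r.injective ((hr 0).trans (hr 1).symm)) (by norm_num)
      simp [cutFun, glue, this]
  have hpq' : p.1 ≠ q.1 := fun h => hpq (Subtype.ext h)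
  rcases isVertex_iff.1 hp with ⟨v, h⟩ | ⟨ω, h⟩
  · rw [h] at hpq' ⊢
    exact ⟨{v}, hsingle v, (hvert v q hq hpq'.symm).symm⟩
  · rcases isVertex_iff.1 hq with ⟨v, h'⟩ | ⟨ω', h'⟩
    · rw [h'] at hpq' ⊢
      exact ⟨{v}, hsingle v, hvert v p hp hpq'⟩
    · rw [h, h'] at hpq' ⊢
      have hne : ω ≠ ω' := fun h => hpq' (by rw [h])
      have hex := mt rayEquiv_of_livesIn hne
      push Not at hex
      obtain ⟨S, C, D, hC, hD, hCD⟩ := hex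
      refine ⟨(C : Set V), isPsiBounded_of_finite Ψ (finite_cutEdges hfin (S := (S : Set V))
        S.finite_toSet fun u hu v hv huv => Or.inr ?_), ?_⟩
      · by_contra hvS
        exact hv (SimpleGraph.ComponentCompl.mem_of_adj _ _ hu hvS huv)
      · have h2 : ¬ ω'.LivesIn (C : Set V) := not_livesIn_of_disjoint hD
          (SimpleGraph.ComponentCompl.pairwise_disjoint (Ne.symm hCD))
        simp [cutFun, glue, hC, h2]

theorem eq_of_notSeparated {p q : PsiSpace Ψ} (hp : IsVertex p) (hq : IsVertex q)
    (h : NotSeparated p q) : p = q := by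
  by_contra hpq
  obtain ⟨X, hX, hne⟩ := exists_cut_separating hfin hp hq hpq
  have hc := continuous_cutFun hX
  have := h {a | cutFun G X a.1 < 1 / 2} {a | 1 / 2 < cutFun G X a.1}
    (isOpen_lt hc continuous_const) (isOpen_lt continuous_const hc)
    (Set.disjoint_left.2 fun a h1 h2 =>
      lt_asymm (mem_ofPred_eq.mp h1) (mem_ofPred_eq.mp h2)) fun a ha => by
      rcases cutFun_of_isVertex ha X with h | h
      · left
        rw [mem_ofPred_eq, h]; norm_num
      · right
        rw [mem_ofPred_eq, h]; norm_num
  rw [mem_ofPred_eq, mem_ofPred_eq] at this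
  rcases cutFun_of_isVertex hp X with h1 | h1 <;> rcases cutFun_of_isVertex hq X with h2 | h2 <;>
    rw [h1, h2] at this hne
  · exact hne rfl
  · norm_num at this
  · norm_num at this
  · exact hne rfl

/-- In the locally finite case the graph-like quotient makes no identifications. -/
theorem exists_homeomorph_tildeSpace :
    ∃ h : PsiSpace Ψ ≃ₜ TildeSpace Ψ, ∀ p, h p = Quotient.mk (tildeSetoid Ψ) p := by
  have hq : Topology.IsQuotientMap (Quotient.mk (tildeSetoid Ψ)) := isQuotientMap_quotient_mk'
  have hinj : Function.Injective (Quotient.mk (tildeSetoid Ψ)) := by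
    intro p q hpq
    rcases Quotient.exact hpq with h | ⟨hp, hq, h⟩
    · exact h
    · exact eq_of_notSeparated hfin hp hq h
  refine ⟨(Equiv.ofBijective _ ⟨hinj, hq.surjective⟩).toHomeomorphOfContinuousOpen hq.continuous
    fun U hU => ?_, fun p => rfl⟩
  rw [← hq.isOpen_preimage]
  exact (Set.preimage_image_eq U hinj).symm ▸ hU

theorem isPsiCircuit_iff {F : Set (Sym2 V)} :
    IsPsiCircuit G Ψ F ↔ F ⊆ G.edgeSet ∧ Nonempty (closure (edgePoints Ψ F) ≃ₜ Circle) := by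
  obtain ⟨h, hh⟩ := exists_homeomorph_tildeSpace (Ψ := Ψ) hfin
  have heq : closure (tildeEdgePoints Ψ F) = h '' closure (edgePoints Ψ F) := by
    rw [h.image_closure, tildeEdgePoints]
    congr 1
    exact Set.image_congr fun p _ => (hh p).symm
  unfold IsPsiCircuit
  rw [heq]
  refine and_congr_right fun _ => ⟨?_, ?_⟩
  · rintro ⟨f⟩
    exact ⟨(h.image _).trans f⟩
  · rintro ⟨f⟩
    exact ⟨(h.image _).symm.trans f⟩

-- For vertices and ends a separating bounded cut provides the function. An inner point is
-- distinguished from all other points by a tent on its edge that peaks there and vanishes at both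
-- endvertices.
open Classical in
theorem exists_continuous_ne {p q : PsiSpace Ψ} (hpq : p ≠ q) :
    ∃ f : PsiSpace Ψ → ℝ, Continuous f ∧ f p ≠ f q := by
  have hinner : ∀ (e₀ : G.edgeSet) (x₀ : Set.Ioo (0 : ℝ) 1), ∃ f : PsiSpace Ψ → ℝ,
      Continuous f ∧ ∀ a b : PsiSpace Ψ, a.1 = Pt.inner e₀ x₀ → b ≠ a → f a ≠ f b := by
    intro e₀ x₀
    set δ : ℝ := min (x₀ : ℝ) (1 - x₀) with hδ
    have hδ0 : 0 < δ := lt_min x₀.2.1 (sub_pos.2 x₀.2.2)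
    refine ⟨_, continuous_glue (Ψ := Ψ) (fV := fun _ => 0) (fE := fun _ => 0)
      (g := fun e x => if e = e₀ then max 0 (δ - |x - x₀|) else 0) ?_ ?_ ?_ ?_, ?_⟩
    · intro e x _ y _
      by_cases he : e = e₀
      · simp only [he, ↓reduceIte]
        refine (abs_max_sub_max_le_max _ _ _ _).trans ?_
        rw [sub_self, abs_zero]
        refine max_le (abs_nonneg _) ?_
        have : δ - |x - x₀| - (δ - |y - x₀|) = |y - x₀| - |x - x₀| := by ring
        rw [this]
        refine (abs_abs_sub_abs_le_abs_sub _ _).trans ?_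
        rw [abs_sub_comm x y]
        exact le_of_eq (by ring_nf)
      · simp [he]
    · intro e
      by_cases he : e = e₀
      · simp only [he, ↓reduceIte, zero_sub, abs_neg, abs_of_pos x₀.2.1]
        exact max_eq_left (sub_nonpos.2 (min_le_left _ _))
      · simp [he]
    · intro e
      by_cases he : e = e₀
      · simp only [he, ↓reduceIte, abs_of_pos (sub_pos.2 x₀.2.2)]
        exact max_eq_left (sub_nonpos.2 (min_le_right _ _))
      · simp [he]
    · intro ω _
      -- Removing both endvertices of `e₀` keeps the neighbourhood of the end off the tent.
      obtain ⟨C, hC⟩ := ω.exists_livesIn {src e₀, tgt e₀}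
      refine ⟨_, C, hC, ?_⟩
      rintro p (⟨v, hv, rfl⟩ | ⟨e, x, rfl, he⟩ | ⟨ω', rfl, hω'⟩)
      · rfl
      · have : e ≠ e₀ := by
          rintro rfl
          rcases he with ⟨h, -⟩ | ⟨h, -⟩
          · exact h (by simp)
          · exact h (by simp)
        simp [glue, this]
      · rfl
    · rintro ⟨a, ha'⟩ ⟨b, hb'⟩ ha hba
      obtain rfl : a = _ := ha
      have h1 : glue (fun _ => 0) (fun _ => 0)
          (fun (e : G.edgeSet) x => if e = e₀ then max 0 (δ - |x - (x₀ : ℝ)|) else 0)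
          (Pt.inner e₀ x₀) = δ := by
        simp [glue, hδ0.le]
      simp only [h1]
      rcases b with v | ω | ⟨e, x⟩
      · exact hδ0.ne'
      · exact hδ0.ne'
      · by_cases he : e = e₀
        · subst he
          have hx : x ≠ x₀ := fun h => hba (by subst h; rfl)
          have hx' : 0 < |(x : ℝ) - x₀| := abs_pos.2 (sub_ne_zero.2 fun h => hx (Subtype.ext h))
          simp only [glue, ↓reduceIte]
          exact (max_lt hδ0 (by linarith)).ne'
        · simp only [glue, he, ↓reduceIte]
          exact hδ0.ne'
  by_cases hp : IsVertex p
  · by_cases hq : IsVertex q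
    · obtain ⟨X, hX, hne⟩ := exists_cut_separating hfin hp hq hpq
      exact ⟨_, continuous_cutFun hX, hne⟩
    · unfold IsVertex at hq
      push Not at hq
      obtain ⟨e, x, h⟩ := hq
      obtain ⟨f, hf, hne⟩ := hinner e x
      exact ⟨f, hf, (hne q p h hpq).symm⟩
  · unfold IsVertex at hp
    push Not at hp
    obtain ⟨e, x, h⟩ := hp
    obtain ⟨f, hf, hne⟩ := hinner e x
    exact ⟨f, hf, hne p q h hpq.symm⟩

theorem t2Space_psiSpace : T2Space (PsiSpace Ψ) := by
  refine ⟨fun p q hpq => ?_⟩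
  obtain ⟨f, hf, hne⟩ := exists_continuous_ne hfin hpq
  exact separated_by_continuous hf hne

end LocallyFinite

theorem mem_of_inner_mem_closure {F : Set (Sym2 V)} {p : PsiSpace Ψ} {e : G.edgeSet}
    {x : Set.Ioo (0 : ℝ) 1} (hp : p ∈ closure (edgePoints Ψ F)) (h : p.1 = Pt.inner e x) :
    (e : Sym2 V) ∈ F := by
  rw [mem_closure_iff] at hp
  obtain ⟨q, ⟨y, hq, -⟩, e', x', he', hq'⟩ := hp (Subtype.val ⁻¹' innerBall e x 1)
    ((isOpen_innerBall e x 1).preimage continuous_subtype_val) ⟨x, h, by simp⟩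
  rw [hq] at hq'
  cases hq'
  exact he'

/-- The point of `|G|_Ψ` in the edge `e` with parameter `x`. -/
def innerPt (Ψ : Set (Ends G)) (e : G.edgeSet) (x : Set.Ioo (0 : ℝ) 1) : PsiSpace Ψ :=
  ⟨Pt.inner e x, fun ω h => by cases h⟩

theorem innerPt_mem {F : Set (Sym2 V)} {e : G.edgeSet} (he : (e : Sym2 V) ∈ F)
    (x : Set.Ioo (0 : ℝ) 1) : innerPt Ψ e x ∈ closure (edgePoints Ψ F) :=
  subset_closure ⟨e, x, he, rfl⟩

/-- A `Ψ`-circuit does not meet a `Ψ`-bounded cut in exactly one edge. -/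
theorem inter_cutEdges_ne_singleton {F : Set (Sym2 V)} {X : Set V} (hF : F ⊆ G.edgeSet)
    (hcirc : Nonempty (closure (edgePoints Ψ F) ≃ₜ Circle)) (hX : IsPsiBounded Ψ (cutEdges G X))
    (e : Sym2 V) : F ∩ cutEdges G X ≠ {e} := by
  intro h
  obtain ⟨φ⟩ := hcirc
  have he : e ∈ F ∩ cutEdges G X := h ▸ mem_singleton e
  set e' : G.edgeSet := ⟨e, hF he.1⟩ with he'
  have hm : (1 / 2 : ℝ) ∈ Ioo (0 : ℝ) 1 := by norm_num
  have h14 : (1 / 4 : ℝ) ∈ Ioo (0 : ℝ) 1 := by norm_num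
  have h34 : (3 / 4 : ℝ) ∈ Ioo (0 : ℝ) 1 := by norm_num
  set m : PsiSpace Ψ := innerPt Ψ e' ⟨1 / 2, hm⟩ with hmdef
  have hconn := isPreconnected_sdiff_singleton φ m (innerPt_mem he.1 _)
  have hc := continuous_cutFun (Ψ := Ψ) hX
  -- `cutFun` takes the value `1 / 2` only at midpoints of cut edges, and `m` is the only such point
  -- in the circle. But the circle minus `m` is connected and contains the points of `e` at `1 / 4`
  -- and `3 / 4`, with values on both sides of `1 / 2`.
  have hne : ∀ p ∈ closure (edgePoints Ψ F) \ {m}, cutFun G X p.1 ≠ 1 / 2 := by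
    rintro p ⟨hp, hpm⟩ hval
    by_cases hv : IsVertex p
    · rcases cutFun_of_isVertex hv X with h | h <;> rw [h] at hval <;> norm_num at hval
    · unfold IsVertex at hv
      push Not at hv
      obtain ⟨e₁, x, hpe⟩ := hv
      have he₁ := mem_of_inner_mem_closure hp hpe
      by_cases hcut : (e₁ : Sym2 V) ∈ cutEdges G X
      · have h1 : (e₁ : Sym2 V) ∈ F ∩ cutEdges G X := ⟨he₁, hcut⟩
        rw [h] at h1
        obtain rfl : e₁ = e' := Subtype.ext h1
        have hx : (x : ℝ) = 1 / 2 := by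
          rw [hpe] at hval
          rcases cutFun_inner_of_mem hcut with h | h <;> rw [h x] at hval <;> linarith
        refine hpm (Subtype.ext ?_)
        rw [hpe, hmdef]
        exact congrArg _ (Subtype.ext hx)
      · rw [hpe] at hval
        rcases cutFun_inner_of_notMem hcut x with h | h <;> rw [h] at hval <;> norm_num at hval
  have ha : innerPt Ψ e' ⟨1 / 4, h14⟩ ∈ closure (edgePoints Ψ F) \ {m} := by
    refine ⟨innerPt_mem he.1 _, fun h => ?_⟩
    have := congrArg Subtype.val (h : _ = _)
    simp only [hmdef, innerPt, Pt.inner.injEq, Subtype.mk.injEq, true_and] at this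
    norm_num at this
  have hb : innerPt Ψ e' ⟨3 / 4, h34⟩ ∈ closure (edgePoints Ψ F) \ {m} := by
    refine ⟨innerPt_mem he.1 _, fun h => ?_⟩
    have := congrArg Subtype.val (h : _ = _)
    simp only [hmdef, innerPt, Pt.inner.injEq, Subtype.mk.injEq, true_and] at this
    norm_num at this
  have hcut' : (e' : Sym2 V) ∈ cutEdges G X := he.2
  obtain ⟨p, hp, hval⟩ : (1 / 2 : ℝ) ∈
      (fun p : PsiSpace Ψ => cutFun G X p.1) '' (closure (edgePoints Ψ F) \ {m}) := by
    rcases cutFun_inner_of_mem hcut' with h | h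
    · refine hconn.intermediate_value ha hb hc.continuousOn ?_
      simp only [innerPt, h]
      constructor <;> norm_num
    · refine hconn.intermediate_value hb ha hc.continuousOn ?_
      simp only [innerPt, h]
      constructor <;> norm_num
  exact hne p hp hval

theorem eq_of_subset_of_closure_circle {F F' : Set (Sym2 V)} (hFF : F ⊆ F')
    (hF' : F' ⊆ G.edgeSet) (h : Nonempty (closure (edgePoints Ψ F) ≃ₜ Circle))
    (h' : Nonempty (closure (edgePoints Ψ F') ≃ₜ Circle)) : F = F' := by
  obtain ⟨φ⟩ := h
  obtain ⟨φ'⟩ := h'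
  have hsub : edgePoints Ψ F ⊆ edgePoints Ψ F' := fun p ⟨e, x, he, hp⟩ => ⟨e, x, hFF he, hp⟩
  have heq := eq_of_subset_of_homeomorph_circle (closure_mono hsub) φ φ'
  refine hFF.antisymm fun e he => ?_
  have hm : (1 / 2 : ℝ) ∈ Ioo (0 : ℝ) 1 := by norm_num
  have h1 := innerPt_mem (Ψ := Ψ) (F := F') (e := ⟨e, hF' he⟩) he ⟨1 / 2, hm⟩
  rw [← heq] at h1
  exact mem_of_inner_mem_closure h1 rfl

end Separation

/-! ### Concatenating arcs, finitely and infinitely often. -/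

section Arcs

variable {X : Type*} [TopologicalSpace X] {A B : Set X} {x y z : X}

/-- `A` is the image of an injective path from `x` to `y`. -/
def IsArc (A : Set X) (x y : X) : Prop := ∃ γ : Path x y, Function.Injective γ ∧ range γ = A

theorem IsArc.symm (h : IsArc A x y) : IsArc A y x := by
  obtain ⟨γ, h1, h2⟩ := h
  refine ⟨γ.symm, fun a b hab => ?_, by rw [Path.symm_range, h2]⟩
  have := h1 hab
  exact unitInterval.symm_bijective.injective this

theorem IsArc.isCompact (h : IsArc A x y) : IsCompact A := by
  obtain ⟨γ, -, rfl⟩ := h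
  exact isCompact_range γ.continuous

theorem IsArc.trans (h : IsArc A x y) (h' : IsArc B y z) (hAB : A ∩ B ⊆ {y}) :
    IsArc (A ∪ B) x z := by
  obtain ⟨γ, h1, rfl⟩ := h
  obtain ⟨γ', h1', rfl⟩ := h'
  refine ⟨γ.trans γ', ?_, Path.trans_range _ _⟩
  have key : ∀ (a b : unitInterval) , (a : ℝ) ≤ 1 / 2 → ¬ (b : ℝ) ≤ 1 / 2 →
      (γ.trans γ') a ≠ (γ.trans γ') b := by
    intro a b ha hb hab
    rw [Path.trans_apply, Path.trans_apply, dif_pos ha, dif_neg hb] at hab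
    have := hAB ⟨⟨_, hab⟩, ⟨_, rfl⟩⟩
    rw [mem_singleton_iff] at this
    have h0 := congrArg Subtype.val (h1' (this.trans γ'.source.symm))
    simp only [Set.Icc.coe_zero] at h0
    exact hb (by linarith)
  intro a b hab
  by_cases ha : (a : ℝ) ≤ 1 / 2 <;> by_cases hb : (b : ℝ) ≤ 1 / 2
  · rw [Path.trans_apply, Path.trans_apply, dif_pos ha, dif_pos hb] at hab
    have := congrArg Subtype.val (h1 hab)
    exact Subtype.ext (by simpa using this)
  · exact absurd hab (key a b ha hb)
  · exact absurd hab.symm (key b a hb ha)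
  · rw [Path.trans_apply, Path.trans_apply, dif_neg ha, dif_neg hb] at hab
    have := congrArg Subtype.val (h1' hab)
    exact Subtype.ext (by simpa using this)

/-- Two arcs with common endpoints and otherwise disjoint form a circle. -/
theorem IsArc.union_homeomorph_circle [T2Space X] (h : IsArc A x y) (h' : IsArc B x y)
    (hAB : A ∩ B ⊆ {x, y}) : Nonempty (↥(A ∪ B) ≃ₜ Circle) := by
  obtain ⟨γ, h1, rfl⟩ := h
  obtain ⟨γ', h1', rfl⟩ := h'
  set ℓ : Path x x := γ.trans γ'.symm with hℓ
  have key : ∀ (a b : unitInterval), (a : ℝ) ≤ 1 / 2 → ¬ (b : ℝ) ≤ 1 / 2 → (b : ℝ) < 1 →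
      ℓ a ≠ ℓ b := by
    intro a b ha hb hb1 hab
    rw [hℓ, Path.trans_apply, Path.trans_apply, dif_pos ha, dif_neg hb, Path.symm_apply] at hab
    rcases hAB ⟨⟨_, hab⟩, ⟨_, rfl⟩⟩ with h | h
    · have h0 := congrArg Subtype.val (h1' (h.trans γ'.source.symm))
      simp only [Set.Icc.coe_zero, unitInterval.coe_symm_eq] at h0
      linarith
    · have h0 := congrArg Subtype.val (h1' (h.trans γ'.target.symm))
      simp only [Set.Icc.coe_one, unitInterval.coe_symm_eq] at h0
      exact hb (by linarith)
  have hinj : ∀ a b : unitInterval, (a : ℝ) < 1 → (b : ℝ) < 1 → ℓ a = ℓ b → a = b := by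
    intro a b ha1 hb1 hab
    by_cases ha : (a : ℝ) ≤ 1 / 2 <;> by_cases hb : (b : ℝ) ≤ 1 / 2
    · rw [hℓ, Path.trans_apply, Path.trans_apply, dif_pos ha, dif_pos hb] at hab
      have := congrArg Subtype.val (h1 hab)
      exact Subtype.ext (by simpa using this)
    · exact absurd hab (key a b ha hb hb1)
    · exact absurd hab.symm (key b a hb ha ha1)
    · rw [hℓ, Path.trans_apply, Path.trans_apply, dif_neg ha, dif_neg hb, Path.symm_apply,
        Path.symm_apply] at hab
      have := congrArg Subtype.val (h1' hab)
      simp only [unitInterval.coe_symm_eq] at this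
      exact Subtype.ext (by linarith)
  have hfact : Fact ((0 : ℝ) < 1) := ⟨one_pos⟩
  -- The loop `ℓ` is injective on `[0, 1)`, so it descends to a continuous injection of the compact
  -- `AddCircle` into a Hausdorff space, which is an embedding.
  set f : AddCircle (1 : ℝ) → X := AddCircle.liftIco 1 0 ℓ.extend with hf
  have hfv : ∀ t (ht : t ∈ Ico (0 : ℝ) 1), f (t : AddCircle (1 : ℝ)) = ℓ ⟨t, ht.1, ht.2.le⟩ := by
    intro t ht
    rw [hf, AddCircle.liftIco_zero_coe_apply ht, Path.extend_apply _ (Ico_subset_Icc_self ht)]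
  have hcont : Continuous f := by
    refine AddCircle.liftIco_zero_continuous ?_ ℓ.continuous_extend.continuousOn
    rw [Path.extend_zero, Path.extend_one]
  have hrep : ∀ u : AddCircle (1 : ℝ), ∃ t ∈ Ico (0 : ℝ) 1, (t : AddCircle (1 : ℝ)) = u := by
    intro u
    have hu : u ∈ (QuotientAddGroup.mk '' Ico (0 : ℝ) (0 + 1) : Set (AddCircle (1 : ℝ))) := by
      rw [AddCircle.coe_image_Ico_eq]
      trivial
    obtain ⟨t, ht, h⟩ := hu
    exact ⟨t, by simpa using ht, h⟩
  have hfinj : Function.Injective f := by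
    intro u v huv
    obtain ⟨s, hs, rfl⟩ := hrep u
    obtain ⟨t, ht, rfl⟩ := hrep v
    rw [hfv s hs, hfv t ht] at huv
    have := congrArg Subtype.val (hinj _ _ hs.2 ht.2 huv)
    exact congrArg _ this
  have hrange : range f = range γ ∪ range γ' := by
    rw [← Path.symm_range γ', ← Path.trans_range]
    ext p
    constructor
    · rintro ⟨u, rfl⟩
      obtain ⟨s, hs, rfl⟩ := hrep u
      rw [hfv s hs]
      exact ⟨_, rfl⟩
    · rintro ⟨t, rfl⟩
      rcases lt_or_eq_of_le t.2.2 with h | h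
      · exact ⟨((t : ℝ) : AddCircle (1 : ℝ)), hfv t ⟨t.2.1, h⟩⟩
      · refine ⟨((0 : ℝ) : AddCircle (1 : ℝ)), ?_⟩
        rw [hfv 0 ⟨le_rfl, one_pos⟩]
        have : t = 1 := Subtype.ext h
        rw [this]
        exact ℓ.source.trans ℓ.target.symm
  have hemb := (hcont.isClosedEmbedding hfinj).isEmbedding
  rw [← hrange]
  exact ⟨hemb.toHomeomorph.symm.trans (AddCircle.homeomorphCircle one_ne_zero)⟩

/-- Infinitely many consecutive arcs that converge to a point form an arc. -/
theorem isArc_iUnion {A : ℕ → Set X} {x : ℕ → X} {y : X} (hA : ∀ n, IsArc (A n) (x n) (x (n + 1)))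
    (h1 : ∀ n, A n ∩ A (n + 1) ⊆ {x (n + 1)}) (h2 : ∀ m n, m + 1 < n → Disjoint (A m) (A n))
    (hy : ∀ n, y ∉ A n) (hlim : ∀ U ∈ nhds y, ∃ N, ∀ n, N ≤ n → A n ⊆ U) :
    IsArc ((⋃ n, A n) ∪ {y}) (x 0) y := by
  choose γ hγ hr using hA
  -- On `[n, n + 1]` this runs through the `n`-th arc; for negative `t` the floor is `0` and `f` is
  -- constantly `x 0`.
  set f : ℝ → X := fun t => (γ ⌊t⌋₊).extend (t - ⌊t⌋₊) with hf
  have hmem : ∀ n t, (γ n).extend t ∈ A n := by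
    intro n t
    rw [← hr n, ← Path.extend_range (γ n)]
    exact ⟨t, rfl⟩
  have hfn : ∀ (n : ℕ) t, ⌊t⌋₊ = n → f t = (γ n).extend (t - n) := by
    rintro _ t rfl
    rfl
  have hfA : ∀ t, f t ∈ A ⌊t⌋₊ := fun t => hmem _ _
  have hinjn : ∀ n, ∀ s ∈ Icc (0 : ℝ) 1, ∀ t ∈ Icc (0 : ℝ) 1,
      (γ n).extend s = (γ n).extend t → s = t := by
    intro n s hs t ht hst
    rw [Path.extend_apply _ hs, Path.extend_apply _ ht] at hst
    exact congrArg Subtype.val (hγ n hst)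
  have heq : ∀ n : ℕ, EqOn f (fun t => (γ n).extend (t - n)) (Icc (n : ℝ) (n + 1)) := by
    intro n t ht
    rcases lt_or_eq_of_le ht.2 with h | h
    · have : ⌊t⌋₊ = n := (Nat.floor_eq_iff ((Nat.cast_nonneg n).trans ht.1)).2 ⟨ht.1, h⟩
      exact hfn n t this
    · have : ⌊t⌋₊ = n + 1 := by
        rw [h]; exact_mod_cast Nat.floor_natCast (n + 1)
      rw [hfn _ t this, h]
      simp
  have hcontn : ∀ n : ℕ, ContinuousOn f (Iic (n : ℝ)) := by
    intro n
    induction n with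
    | zero =>
      refine (continuousOn_const (c := x 0)).congr fun t ht => ?_
      have ht' : t ≤ 0 := by simpa using ht
      have : ⌊t⌋₊ = 0 := Nat.floor_of_nonpos ht'
      rw [hfn _ t this]
      exact Path.extend_of_le_zero _ (by simpa using ht')
    | succ n ih =>
      have : Iic ((n + 1 : ℕ) : ℝ) = Iic (n : ℝ) ∪ Icc (n : ℝ) (n + 1) := by
        push_cast
        exact (Iic_union_Icc_eq_Iic (by linarith)).symm
      rw [this]
      refine ih.union_of_isClosed ?_ isClosed_Iic isClosed_Icc
      refine ContinuousOn.congr ?_ (heq n)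
      exact ((γ n).continuous_extend.comp (continuous_id.sub continuous_const)).continuousOn
  have hcont : Continuous f := by
    rw [continuous_iff_continuousAt]
    intro t
    obtain ⟨n, hn⟩ := exists_nat_gt t
    exact (hcontn n).continuousAt (Iic_mem_nhds hn)
  have hlt : ∀ s t : ℝ, 0 ≤ s → s < t → f s ≠ f t := by
    intro s t hs hst hfst
    have ht : 0 ≤ t := hs.trans hst.le
    have hs1 := Nat.floor_le hs
    have hs2 := Nat.lt_floor_add_one s
    have ht1 := Nat.floor_le ht
    have ht2 := Nat.lt_floor_add_one t
    have hle : ⌊s⌋₊ ≤ ⌊t⌋₊ := Nat.floor_le_floor hst.le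
    rcases Nat.lt_or_ge (⌊s⌋₊ + 1) ⌊t⌋₊ with h | h
    · exact Set.disjoint_left.1 (h2 _ _ h) (hfA s) (hfst ▸ hfA t)
    · rcases Nat.eq_or_lt_of_le hle with h' | h'
      · have h3 : (γ ⌊s⌋₊).extend (s - ⌊s⌋₊) = (γ ⌊s⌋₊).extend (t - ⌊s⌋₊) := by
          rw [← hfn _ s rfl, ← hfn _ t h'.symm]
          exact hfst
        have h4 := hinjn _ _ ⟨by linarith, by linarith⟩ _
          ⟨by linarith, by rw [← h'] at ht2; linarith⟩ h3
        linarith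
      · have h5 : ⌊t⌋₊ = ⌊s⌋₊ + 1 := by omega
        have h6 : f s ∈ A ⌊s⌋₊ ∩ A (⌊s⌋₊ + 1) := ⟨hfA s, h5 ▸ hfst ▸ hfA t⟩
        have h7 : f s = (γ ⌊s⌋₊).extend 1 := by
          rw [Path.extend_one]
          exact h1 _ h6
        have h8 := hinjn _ _ ⟨by linarith, by linarith⟩ _ ⟨zero_le_one, le_rfl⟩ h7
        linarith
  have hpar : ∀ t : unitInterval, t ≠ 1 → 0 < 1 - (t : ℝ) := by
    intro t ht
    have : (t : ℝ) ≠ 1 := fun h => ht (Subtype.ext h)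
    have := lt_of_le_of_ne t.2.2 this
    linarith
  classical
  -- The map `t ↦ t / (1 - t)` is an increasing bijection from `[0, 1)` to `[0, ∞)` with inverse `u
  -- ↦ u / (1 + u)`; continuity at `1` is `hlim`.
  set h : unitInterval → X := fun t => if t = 1 then y else f (t / (1 - t)) with hh
  have hhcont : Continuous h := by
    rw [continuous_iff_continuousAt]
    intro t
    by_cases ht : t = 1
    · subst ht
      rw [ContinuousAt]
      have h11 : h 1 = y := by simp [hh]
      rw [h11]
      intro U hU
      obtain ⟨N, hN⟩ := hlim U hU
      -- `N / (N + 1)` is the parameter that is sent to `N`.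
      have hev : ∀ᶠ t : unitInterval in nhds 1, (N : ℝ) / (N + 1) < (t : ℝ) := by
        refine (continuous_subtype_val.tendsto (1 : unitInterval)).eventually_const_lt ?_
        rw [Set.Icc.coe_one, div_lt_one (by positivity)]
        linarith
      rw [Filter.mem_map]
      filter_upwards [hev] with t ht
      rw [mem_preimage]
      by_cases ht1 : t = 1
      · rw [ht1, h11]
        exact mem_of_mem_nhds hU
      · simp only [hh, ht1, ↓reduceIte]
        refine hN ⌊(t : ℝ) / (1 - t)⌋₊ (Nat.le_floor ?_) (hfA _)
        rw [le_div_iff₀ (hpar t ht1)]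
        rw [div_lt_iff₀ (by positivity)] at ht
        nlinarith
    · have hev : h =ᶠ[nhds t] fun t => f (t / (1 - t)) := by
        filter_upwards [isOpen_ne.mem_nhds ht] with s hs
        simp only [hh, (hs : s ≠ 1), ↓reduceIte]
      refine ContinuousAt.congr ?_ hev.symm
      refine hcont.continuousAt.comp (ContinuousAt.div ?_ ?_ (hpar t ht).ne')
      · exact continuous_subtype_val.continuousAt
      · exact (continuous_const.sub continuous_subtype_val).continuousAt
  have hy' : ∀ t, f t ≠ y := fun t ht => hy _ (ht ▸ hfA t)
  refine ⟨⟨⟨h, hhcont⟩, ?_, by simp [hh]⟩, ?_, ?_⟩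
  · simp only [hh]
    rw [if_neg (by simp)]
    simp [hf]
  · have hinj : ∀ s t : unitInterval, s < t → h s ≠ h t := by
      intro s t hst hst'
      have hs : s ≠ 1 := fun h => absurd (hst.trans_le unitInterval.le_one') (by simp [h])
      by_cases ht : t = 1
      · simp only [hh, ht, hs, ↓reduceIte] at hst'
        exact hy' _ hst'
      · simp only [hh, ht, hs, ↓reduceIte] at hst'
        refine hlt _ _ (div_nonneg s.2.1 (hpar s hs).le) ?_ hst'
        have hst2 : (s : ℝ) < t := hst
        rw [div_lt_div_iff₀ (hpar s hs) (hpar t ht)]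
        nlinarith
    intro s t hst
    rcases lt_trichotomy s t with h' | h' | h'
    · exact absurd hst (hinj s t h')
    · exact h'
    · exact absurd hst.symm (hinj t s h')
  · ext p
    constructor
    · rintro ⟨t, rfl⟩
      by_cases ht : t = 1
      · right
        simp [hh, ht]
      · left
        rw [mem_iUnion]
        refine ⟨⌊(t : ℝ) / (1 - t)⌋₊, ?_⟩
        show h t ∈ _
        simp only [hh, ht, ↓reduceIte]
        exact hfA _
    · rintro (hp | rfl)
      · rw [mem_iUnion] at hp
        obtain ⟨n, hp⟩ := hp
        rw [← hr n] at hp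
        obtain ⟨r, rfl⟩ := hp
        set u : ℝ := n + r with hu
        have hu0 : 0 ≤ u := add_nonneg (Nat.cast_nonneg n) r.2.1
        have hu1 : 0 < 1 + u := by linarith
        have hmemI : u / (1 + u) ∈ Icc (0 : ℝ) 1 :=
          ⟨div_nonneg hu0 hu1.le, (div_le_one hu1).2 (by linarith)⟩
        refine ⟨⟨u / (1 + u), hmemI⟩, ?_⟩
        have hne : (⟨u / (1 + u), hmemI⟩ : unitInterval) ≠ 1 := by
          intro h
          have := congrArg Subtype.val h
          simp only [Set.Icc.coe_one] at this
          rw [div_eq_one_iff_eq hu1.ne'] at this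
          linarith
        show h _ = _
        simp only [hh, hne, ↓reduceIte]
        have : u / (1 + u) / (1 - u / (1 + u)) = u := by field_simp; ring
        rw [this, heq n ⟨by linarith [r.2.1], by linarith [r.2.2]⟩]
        simp only [hu, add_sub_cancel_left]
        rw [Path.extend_apply _ r.2]
      · exact ⟨1, by show h 1 = _; simp [hh]⟩

end Arcs

/-! ### Arcs in `|G|_Ψ` along edges, paths and rays. -/

section GraphArcs

variable {V : Type*} {G : SimpleGraph V} {Ψ : Set (Ends G)}

/-- The set consisting of the given vertices, the inner points of the given edges, and the given
ends. -/
def pts (Ψ : Set (Ends G)) (S : Set V) (F : Set (Sym2 V)) (E : Set (Ends G)) :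
    Set (PsiSpace Ψ) :=
  {p | (∃ v ∈ S, p.1 = Pt.vert v) ∨
    (∃ (e : G.edgeSet) (x : Set.Ioo (0 : ℝ) 1), (e : Sym2 V) ∈ F ∧ p.1 = Pt.inner e x) ∨
    ∃ ω ∈ E, p.1 = Pt.ending ω}

/-- The vertex `v` as a point of `|G|_Ψ`. -/
def vertPt (Ψ : Set (Ends G)) (v : V) : PsiSpace Ψ := ⟨Pt.vert v, fun ω h => by cases h⟩

/-- The end `ω ∈ Ψ` as a point of `|G|_Ψ`. -/
def endPt {ω : Ends G} (hω : ω ∈ Ψ) : PsiSpace Ψ := ⟨Pt.ending ω, fun ω' h => by cases h; exact hω⟩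

theorem pts_inter {S S' : Set V} {F F' : Set (Sym2 V)} {E E' : Set (Ends G)} :
    pts Ψ S F E ∩ pts Ψ S' F' E' ⊆ pts Ψ (S ∩ S') (F ∩ F') (E ∩ E') := by
  rintro p ⟨⟨v, hv, h⟩ | ⟨e, x, he, h⟩ | ⟨ω, hω, h⟩, ⟨v', hv', h'⟩ | ⟨e', x', he', h'⟩ | ⟨ω', hω', h'⟩⟩ <;>
    rw [h] at h' <;> cases h'
  · exact Or.inl ⟨v, ⟨hv, hv'⟩, h⟩
  · exact Or.inr (Or.inl ⟨e, x, ⟨he, he'⟩, h⟩)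
  · exact Or.inr (Or.inr ⟨ω, ⟨hω, hω'⟩, h⟩)

theorem pts_union {S S' : Set V} {F F' : Set (Sym2 V)} {E E' : Set (Ends G)} :
    pts Ψ S F E ∪ pts Ψ S' F' E' = pts Ψ (S ∪ S') (F ∪ F') (E ∪ E') := by
  ext p
  constructor
  · rintro ((⟨v, hv, h⟩ | ⟨e, x, he, h⟩ | ⟨ω, hω, h⟩) | ⟨v, hv, h⟩ | ⟨e, x, he, h⟩ | ⟨ω, hω, h⟩)
    · exact Or.inl ⟨v, Or.inl hv, h⟩
    · exact Or.inr (Or.inl ⟨e, x, Or.inl he, h⟩)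
    · exact Or.inr (Or.inr ⟨ω, Or.inl hω, h⟩)
    · exact Or.inl ⟨v, Or.inr hv, h⟩
    · exact Or.inr (Or.inl ⟨e, x, Or.inr he, h⟩)
    · exact Or.inr (Or.inr ⟨ω, Or.inr hω, h⟩)
  · rintro (⟨v, hv | hv, h⟩ | ⟨e, x, he | he, h⟩ | ⟨ω, hω | hω, h⟩)
    · exact Or.inl (Or.inl ⟨v, hv, h⟩)
    · exact Or.inr (Or.inl ⟨v, hv, h⟩)
    · exact Or.inl (Or.inr (Or.inl ⟨e, x, he, h⟩))
    · exact Or.inr (Or.inr (Or.inl ⟨e, x, he, h⟩))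
    · exact Or.inl (Or.inr (Or.inr ⟨ω, hω, h⟩))
    · exact Or.inr (Or.inr (Or.inr ⟨ω, hω, h⟩))

theorem pts_mono {S S' : Set V} {F F' : Set (Sym2 V)} {E E' : Set (Ends G)} (hS : S ⊆ S')
    (hF : F ⊆ F') (hE : E ⊆ E') : pts Ψ S F E ⊆ pts Ψ S' F' E' := by
  rintro p (⟨v, hv, h⟩ | ⟨e, x, he, h⟩ | ⟨ω, hω, h⟩)
  · exact Or.inl ⟨v, hS hv, h⟩
  · exact Or.inr (Or.inl ⟨e, x, hF he, h⟩)
  · exact Or.inr (Or.inr ⟨ω, hE hω, h⟩)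

theorem pts_pair_vert {u v : V} : pts Ψ {u, v} ∅ ∅ ⊆ {vertPt Ψ u, vertPt Ψ v} := by
  rintro p (⟨w, hw, h⟩ | ⟨e, x, he, h⟩ | ⟨ω, hω, h⟩)
  · rcases hw with rfl | rfl
    · exact Or.inl (Subtype.ext h)
    · exact Or.inr (Subtype.ext h)
  · exact absurd he (notMem_empty _)
  · exact absurd hω (notMem_empty _)

theorem pts_vert {v : V} : pts Ψ {v} ∅ ∅ ⊆ {vertPt Ψ v} := by
  have := pts_pair_vert (Ψ := Ψ) (u := v) (v := v)
  simpa using this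

theorem pts_vert_end {v : V} {ω : Ends G} (hω : ω ∈ Ψ) :
    pts Ψ {v} ∅ {ω} ⊆ {vertPt Ψ v, endPt hω} := by
  rintro p (⟨w, rfl, h⟩ | ⟨e, x, he, h⟩ | ⟨ω', rfl, h⟩)
  · exact Or.inl (Subtype.ext h)
  · exact absurd he (notMem_empty _)
  · exact Or.inr (Subtype.ext h)

theorem pts_pair_end {ω ω' : Ends G} (hω : ω ∈ Ψ) (hω' : ω' ∈ Ψ) :
    pts Ψ ∅ ∅ {ω, ω'} ⊆ {endPt hω, endPt hω'} := by
  rintro p (⟨w, hw, h⟩ | ⟨e, x, he, h⟩ | ⟨ω'', hω'', h⟩)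
  · exact absurd hw (notMem_empty _)
  · exact absurd he (notMem_empty _)
  · rcases hω'' with rfl | rfl
    · exact Or.inl (Subtype.ext h)
    · exact Or.inr (Subtype.ext h)

theorem IsArc.trans_pts {S S' : Set V} {F F' : Set (Sym2 V)} {E E' : Set (Ends G)}
    {x z : PsiSpace Ψ} {v : V} (h : IsArc (pts Ψ S F E) x (vertPt Ψ v))
    (h' : IsArc (pts Ψ S' F' E') (vertPt Ψ v) z) (hS : S ∩ S' ⊆ {v}) (hF : F ∩ F' ⊆ ∅)
    (hE : E ∩ E' ⊆ ∅) : IsArc (pts Ψ (S ∪ S') (F ∪ F') (E ∪ E')) x z := by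
  rw [← pts_union]
  exact h.trans h' ((pts_inter.trans (pts_mono hS hF hE)).trans pts_vert)

theorem isArc_src_tgt (e : G.edgeSet) :
    IsArc (pts Ψ {src e, tgt e} {(e : Sym2 V)} ∅) (vertPt Ψ (src e)) (vertPt Ψ (tgt e)) := by
  classical
  have hmem : ∀ t : unitInterval, t ≠ 0 → t ≠ 1 → (t : ℝ) ∈ Ioo (0 : ℝ) 1 := fun t h0 h1 =>
    ⟨lt_of_le_of_ne t.2.1 fun h => h0 (Subtype.ext h.symm),
      lt_of_le_of_ne t.2.2 fun h => h1 (Subtype.ext h)⟩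
  set f : unitInterval → Pt G := fun t => if h0 : t = 0 then Pt.vert (src e) else
    if h1 : t = 1 then Pt.vert (tgt e) else Pt.inner e ⟨t, hmem t h0 h1⟩ with hf
  have f0 : f 0 = Pt.vert (src e) := by simp [hf]
  have f1 : f 1 = Pt.vert (tgt e) := by simp [hf]
  have fi : ∀ t (h0 : t ≠ 0) (h1 : t ≠ 1), f t = Pt.inner e ⟨t, hmem t h0 h1⟩ := by
    intro t h0 h1
    simp only [hf, h0, h1, ↓reduceDIte]
  have hcont : Continuous f := by
    refine continuous_def.2 fun U hU => ?_
    rw [isOpen_iff_mem_nhds]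
    intro t ht
    rw [mem_preimage] at ht
    by_cases h0 : t = 0
    · subst h0
      rw [f0] at ht
      obtain ⟨ε, hε, hε1, hεU⟩ := hU.1 _ ht
      filter_upwards [(continuous_subtype_val.tendsto (0 : unitInterval)).eventually_lt_const
        (u := ε) (by simpa using hε)] with s hs
      by_cases hs0 : s = 0
      · rw [mem_preimage, hs0, f0]
        exact ht
      · have hs1 : s ≠ 1 := by
          rintro rfl
          simp only [Set.Icc.coe_one] at hs
          linarith
        rw [mem_preimage, fi s hs0 hs1]
        exact hεU (Or.inr ⟨e, _, rfl, Or.inl ⟨rfl, hs⟩⟩)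
    · by_cases h1 : t = 1
      · subst h1
        rw [f1] at ht
        obtain ⟨ε, hε, hε1, hεU⟩ := hU.1 _ ht
        filter_upwards [(continuous_subtype_val.tendsto (1 : unitInterval)).eventually_const_lt
          (u := 1 - ε) (by simpa using hε)] with s hs
        by_cases hs1 : s = 1
        · rw [mem_preimage, hs1, f1]
          exact ht
        · have hs0 : s ≠ 0 := by
            rintro rfl
            simp only [Set.Icc.coe_zero] at hs
            linarith
          rw [mem_preimage, fi s hs0 hs1]
          exact hεU (Or.inr ⟨e, _, rfl, Or.inr ⟨rfl, by simp only; linarith⟩⟩)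
      · rw [fi t h0 h1] at ht
        obtain ⟨ε, hε, -, hεU⟩ := hU.2.1 _ _ ht
        filter_upwards [isOpen_ne.mem_nhds h0, isOpen_ne.mem_nhds h1,
          Metric.ball_mem_nhds t hε] with s hs0 hs1 hs
        rw [mem_preimage, fi s hs0 hs1]
        exact hεU ⟨_, rfl, hs⟩
  have hΨ : ∀ t ω, f t = Pt.ending ω → ω ∈ Ψ := by
    intro t ω h
    by_cases h0 : t = 0
    · rw [h0, f0] at h
      cases h
    · by_cases h1 : t = 1
      · rw [h1, f1] at h
        cases h
      · rw [fi t h0 h1] at h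
        cases h
  refine ⟨⟨⟨fun t => ⟨f t, hΨ t⟩, hcont.subtype_mk _⟩, Subtype.ext f0, Subtype.ext f1⟩, ?_, ?_⟩
  · have hne := (adj_src_tgt e).ne
    intro s t hst
    have hst' : f s = f t := congrArg Subtype.val hst
    by_cases hs0 : s = 0 <;> by_cases ht0 : t = 0
    · rw [hs0, ht0]
    · rw [hs0, f0] at hst'
      by_cases ht1 : t = 1
      · rw [ht1, f1] at hst'
        exact absurd (Pt.vert.inj hst') hne
      · rw [fi t ht0 ht1] at hst'
        cases hst'
    · rw [ht0, f0] at hst'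
      by_cases hs1 : s = 1
      · rw [hs1, f1] at hst'
        exact absurd (Pt.vert.inj hst') hne.symm
      · rw [fi s hs0 hs1] at hst'
        cases hst'
    · by_cases hs1 : s = 1 <;> by_cases ht1 : t = 1
      · rw [hs1, ht1]
      · rw [hs1, f1, fi t ht0 ht1] at hst'
        cases hst'
      · rw [ht1, f1, fi s hs0 hs1] at hst'
        cases hst'
      · rw [fi s hs0 hs1, fi t ht0 ht1] at hst'
        injection hst' with _ h
        exact Subtype.ext (congrArg (fun z : Set.Ioo (0 : ℝ) 1 => (z : ℝ)) h)
  · ext ⟨p, hp⟩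
    constructor
    · rintro ⟨t, ht⟩
      have ht' : f t = p := congrArg Subtype.val ht
      subst ht'
      by_cases h0 : t = 0
      · exact Or.inl ⟨src e, Or.inl rfl, (congrArg f h0).trans f0⟩
      · by_cases h1 : t = 1
        · exact Or.inl ⟨tgt e, Or.inr rfl, (congrArg f h1).trans f1⟩
        · exact Or.inr (Or.inl ⟨e, _, rfl, fi t h0 h1⟩)
    · rintro (⟨v, rfl | rfl, h⟩ | ⟨e', x, he, h⟩ | ⟨ω, hω, h⟩)
      · exact ⟨0, Subtype.ext (f0.trans h.symm)⟩
      · exact ⟨1, Subtype.ext (f1.trans h.symm)⟩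
      · obtain rfl : e' = e := Subtype.ext he
        have hx0 : (⟨x, Ioo_subset_Icc_self x.2⟩ : unitInterval) ≠ 0 := fun h =>
          x.2.1.ne' (congrArg Subtype.val h)
        have hx1 : (⟨x, Ioo_subset_Icc_self x.2⟩ : unitInterval) ≠ 1 := fun h =>
          x.2.2.ne (congrArg Subtype.val h)
        exact ⟨⟨x, Ioo_subset_Icc_self x.2⟩, Subtype.ext ((fi _ hx0 hx1).trans h.symm)⟩
      · exact absurd hω (notMem_empty _)

theorem isArc_edge {u v : V} (h : G.Adj u v) :
    IsArc (pts Ψ {u, v} {s(u, v)} ∅) (vertPt Ψ u) (vertPt Ψ v) := by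
  set e : G.edgeSet := ⟨s(u, v), h⟩ with he
  have harc := isArc_src_tgt (Ψ := Ψ) e
  have heq : s(src e, tgt e) = s(u, v) := src_tgt_eq e
  rcases Sym2.eq_iff.1 heq with ⟨h1, h2⟩ | ⟨h1, h2⟩
  · rw [h1, h2] at harc
    exact harc
  · rw [h1, h2, Set.pair_comm] at harc
    exact harc.symm

/-- The case `n = 0` is excluded because a constant path is not injective. -/
theorem isArc_path {s : ℕ → V} {n : ℕ} (hn : 0 < n) (hinj : InjOn s (Iic n))
    (hadj : ∀ i < n, G.Adj (s i) (s (i + 1))) :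
    IsArc (pts Ψ (s '' Iic n) ((fun i => s(s i, s (i + 1))) '' Iio n) ∅)
      (vertPt Ψ (s 0)) (vertPt Ψ (s n)) := by
  induction n, (hn : 1 ≤ n) using Nat.le_induction with
  | base =>
    have h1 : s '' Iic 1 = {s 0, s 1} := by
      have : Iic 1 = ({0, 1} : Set ℕ) := by ext i; simp; omega
      rw [this, image_pair]
    have h2 : (fun i => s(s i, s (i + 1))) '' Iio 1 = {s(s 0, s 1)} := by
      have : Iio 1 = ({0} : Set ℕ) := by ext i; simp
      rw [this, image_singleton]
    rw [h1, h2]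
    exact isArc_edge (hadj 0 one_pos)
  | succ k hk ih =>
    have harc := (ih (hinj.mono (Iic_subset_Iic.2 (Nat.le_succ k)))
      fun i hi => hadj i (by omega)).trans_pts (isArc_edge (hadj k (Nat.lt_succ_self k)))
      ?_ ?_ (inter_subset_left)
    · have h1 : s '' Iic (k + 1) = s '' Iic k ∪ {s k, s (k + 1)} := by
        have : Iic (k + 1) = Iic k ∪ {k, k + 1} := by ext i; simp; omega
        rw [this, image_union, image_pair]
      have h2 : (fun i => s(s i, s (i + 1))) '' Iio (k + 1) =
          (fun i => s(s i, s (i + 1))) '' Iio k ∪ {s(s k, s (k + 1))} := by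
        have : Iio (k + 1) = Iio k ∪ {k} := by ext i; simp
        rw [this, image_union, image_singleton]
      rw [h1, h2, ← union_empty (∅ : Set (Ends G))]
      exact harc
    · rintro _ ⟨⟨i, hi, rfl⟩, h | h⟩
      · exact h
      · have h' : s i = s (k + 1) := h
        have : i = k + 1 := hinj (mem_Iic.2 ((mem_Iic.1 hi).trans (Nat.le_succ k)))
          (mem_Iic.2 le_rfl) h'
        have := mem_Iic.1 hi
        omega
    · rintro _ ⟨⟨i, hi, rfl⟩, h⟩
      have h' : s(s i, s (i + 1)) = s(s k, s (k + 1)) := h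
      have hi' := mem_Iio.1 hi
      have hmem : ∀ j, j ≤ k + 1 → j ∈ Iic (k + 1) := fun j hj => hj
      rcases Sym2.eq_iff.1 h' with ⟨h1, -⟩ | ⟨h1, -⟩
      · have := hinj (hmem i (by omega)) (hmem k (by omega)) h1
        omega
      · have := hinj (hmem i (by omega)) (hmem (k + 1) (by omega)) h1
        omega

theorem Ray.hasTailIn_of_livesIn {r : Ray G} {S : Finset V} {C : G.ComponentCompl (S : Set V)}
    (h : Ends.LivesIn (Quotient.mk (raySetoid G) r) (C : Set V)) : r.HasTailIn (C : Set V) := by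
  obtain ⟨t, ht, htC⟩ := h
  obtain ⟨B, h1, h2⟩ := (Quotient.exact ht : RayEquiv t r) S
  obtain rfl := Ray.hasTailIn_unique ⟨0, fun n _ => htC n⟩ h1
  exact h2

/-- Every basic neighbourhood of `ω` contains a tail of `r`, which is the convergence that
`isArc_iUnion` requires. -/
theorem isArc_ray (r : Ray G) {ω : Ends G} (hr : (Quotient.mk (raySetoid G) r : Ends G) = ω)
    (hω : ω ∈ Ψ) :
    IsArc (pts Ψ (range r.toFun) (range fun i => s(r.toFun i, r.toFun (i + 1))) {ω})
      (vertPt Ψ (r.toFun 0)) (endPt hω) := by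
  have harc := isArc_iUnion
    (A := fun n => pts Ψ {r.toFun n, r.toFun (n + 1)} {s(r.toFun n, r.toFun (n + 1))} ∅)
    (x := fun n => vertPt Ψ (r.toFun n)) (y := endPt hω) (fun n => isArc_edge (r.adj n)) ?_ ?_ ?_ ?_
  · convert harc using 1
    ext p
    constructor
    · rintro (⟨_, ⟨n, rfl⟩, h⟩ | ⟨e, x, ⟨n, he⟩, h⟩ | ⟨ω', rfl, h⟩)
      · exact Or.inl (mem_iUnion.2 ⟨n, Or.inl ⟨_, Or.inl rfl, h⟩⟩)
      · exact Or.inl (mem_iUnion.2 ⟨n, Or.inr (Or.inl ⟨e, x, he.symm, h⟩)⟩)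
      · exact Or.inr (Subtype.ext h)
    · rintro (h | rfl)
      · obtain ⟨n, hn⟩ := mem_iUnion.1 h
        refine pts_mono ?_ ?_ (empty_subset _) hn
        · rintro _ (rfl | rfl)
          · exact ⟨n, rfl⟩
          · exact ⟨n + 1, rfl⟩
        · rintro _ rfl
          exact ⟨n, rfl⟩
      · exact Or.inr (Or.inr ⟨ω, rfl, rfl⟩)
  · intro n
    refine (pts_inter.trans (pts_mono ?_ ?_ inter_subset_left)).trans pts_vert
    · rintro v ⟨h1 | h1, h2 | h2⟩
      · have := r.injective ((h1 : v = _).symm.trans h2)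
        omega
      · have := r.injective ((h1 : v = _).symm.trans h2)
        omega
      · exact h2
      · exact h1
    · rintro e ⟨h1, h2⟩
      have h3 := (h1 : e = _).symm.trans h2
      rcases Sym2.eq_iff.1 h3 with ⟨h, -⟩ | ⟨h, -⟩ <;> have := r.injective h <;> omega
  · intro m n hmn
    rw [Set.disjoint_iff]
    intro p hp
    rcases pts_inter hp with ⟨v, ⟨h1 | h1, h2 | h2⟩, -⟩ | ⟨e, -, ⟨h1, h2⟩, -⟩ | ⟨ω, ⟨h1, -⟩, -⟩
    · have := r.injective ((h1 : v = _).symm.trans h2)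
      omega
    · have := r.injective ((h1 : v = _).symm.trans h2)
      omega
    · have := r.injective ((h1 : v = _).symm.trans h2)
      omega
    · have := r.injective ((h1 : v = _).symm.trans h2)
      omega
    · have h3 := (h1 : (e : Sym2 V) = _).symm.trans h2
      rcases Sym2.eq_iff.1 h3 with ⟨h, -⟩ | ⟨h, -⟩ <;> have := r.injective h <;> omega
    · exact absurd h1 (notMem_empty _)
  · rintro n (⟨v, -, h⟩ | ⟨e, x, -, h⟩ | ⟨ω, h, -⟩)
    · cases h
    · cases h
    · exact absurd h (notMem_empty _)
  · intro U hU
    obtain ⟨U', hU', ⟨W, hW, rfl⟩, hmem⟩ := mem_nhds_iff.1 hU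
    obtain ⟨S, C, hC, hCW⟩ := hW.2.2 ω hmem
    rw [← hr] at hC
    obtain ⟨N, hN⟩ := Ray.hasTailIn_of_livesIn hC
    refine ⟨N, fun n hn p hp => hU' (hCW ?_)⟩
    rcases hp with ⟨v, h1 | h1, h⟩ | ⟨e, x, h1, h⟩ | ⟨ω, h1, -⟩
    · exact Or.inl ⟨v, (h1 : v = _) ▸ hN n hn, h⟩
    · exact Or.inl ⟨v, (h1 : v = _) ▸ hN (n + 1) (by omega), h⟩
    · refine Or.inr (Or.inl ⟨e, x, h, ?_⟩)
      have h2 := src_mem e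
      rw [(h1 : (e : Sym2 V) = _), Sym2.mem_iff] at h2
      rcases h2 with h2 | h2
      · exact Or.inl (h2 ▸ hN n hn)
      · exact Or.inl (h2 ▸ hN (n + 1) (by omega))
    · exact absurd h1 (notMem_empty _)

theorem pts_subset_closure {S : Set V} {F : Set (Sym2 V)} {E : Set (Ends G)}
    (hF : F ⊆ G.edgeSet) (hS : ∀ v ∈ S, ∃ e ∈ F, v ∈ e)
    (hE : ∀ ω ∈ E, ∃ r : Ray G, (Quotient.mk (raySetoid G) r : Ends G) = ω ∧
      ∀ n, s(r.toFun n, r.toFun (n + 1)) ∈ F) : pts Ψ S F E ⊆ closure (edgePoints Ψ F) := by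
  rintro p (⟨v, hv, h⟩ | ⟨e, x, he, h⟩ | ⟨ω, hω, h⟩)
  · rw [mem_closure_iff]
    rintro _ ⟨W, hW, rfl⟩ hp
    rw [mem_preimage, h] at hp
    obtain ⟨ε, hε, hε1, hεW⟩ := hW.1 v hp
    obtain ⟨e, he, hve⟩ := hS v hv
    set e' : G.edgeSet := ⟨e, hF he⟩
    have hve' : v ∈ s(src e', tgt e') := by
      rw [src_tgt_eq e']
      exact hve
    rcases Sym2.mem_iff.1 hve' with hv' | hv'
    · have hx : ε / 2 ∈ Ioo (0 : ℝ) 1 := ⟨by linarith, by linarith⟩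
      refine ⟨innerPt Ψ e' ⟨ε / 2, hx⟩, hεW (Or.inr ⟨e', _, rfl, Or.inl ⟨hv'.symm, ?_⟩⟩), e', _, he,
        rfl⟩
      simp only
      linarith
    · have hx : 1 - ε / 2 ∈ Ioo (0 : ℝ) 1 := ⟨by linarith, by linarith⟩
      refine ⟨innerPt Ψ e' ⟨1 - ε / 2, hx⟩, hεW (Or.inr ⟨e', _, rfl, Or.inr ⟨hv'.symm, ?_⟩⟩), e', _,
        he, rfl⟩
      simp only
      linarith
  · exact subset_closure ⟨e, x, he, h⟩
  · rw [mem_closure_iff]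
    rintro _ ⟨W, hW, rfl⟩ hp
    rw [mem_preimage, h] at hp
    obtain ⟨S, C, hC, hCW⟩ := hW.2.2 ω hp
    obtain ⟨r, rfl, hr⟩ := hE ω hω
    obtain ⟨N, hN⟩ := Ray.hasTailIn_of_livesIn hC
    have hx : (1 / 2 : ℝ) ∈ Ioo (0 : ℝ) 1 := by norm_num
    set e' : G.edgeSet := ⟨_, hF (hr N)⟩ with he'
    refine ⟨innerPt Ψ e' ⟨1 / 2, hx⟩, hCW (Or.inr (Or.inl ⟨e', _, rfl, ?_⟩)), e', _, hr N, rfl⟩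
    have h2 := src_mem e'
    rcases Sym2.mem_iff.1 h2 with h2 | h2
    · exact Or.inl (h2 ▸ hN N le_rfl)
    · exact Or.inl (h2 ▸ hN (N + 1) (by omega))

/-- Two arcs of vertices, edges and ends with common endpoints form a `Ψ`-circuit. -/
theorem isPsiCircuit_of_arcs (hfin : ∀ v, (G.neighborSet v).Finite) {S S' : Set V}
    {F F' : Set (Sym2 V)} {E E' : Set (Ends G)} {x y : PsiSpace Ψ}
    (h : IsArc (pts Ψ S F E) x y) (h' : IsArc (pts Ψ S' F' E') x y)
    (hxy : pts Ψ (S ∩ S') (F ∩ F') (E ∩ E') ⊆ {x, y}) (hF : F ∪ F' ⊆ G.edgeSet)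
    (hS : ∀ v ∈ S ∪ S', ∃ e ∈ F ∪ F', v ∈ e)
    (hE : ∀ ω ∈ E ∪ E', ∃ r : Ray G, (Quotient.mk (raySetoid G) r : Ends G) = ω ∧
      ∀ n, s(r.toFun n, r.toFun (n + 1)) ∈ F ∪ F') :
    Nonempty (closure (edgePoints Ψ (F ∪ F')) ≃ₜ Circle) := by
  have := t2Space_psiSpace (Ψ := Ψ) hfin
  have h1 := h.union_homeomorph_circle h' (pts_inter.trans hxy)
  have h2 : pts Ψ S F E ∪ pts Ψ S' F' E' = closure (edgePoints Ψ (F ∪ F')) := by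
    -- The union of the arcs is compact, hence closed in the Hausdorff space `|G|_Ψ`.
    refine Subset.antisymm ?_ (closure_minimal ?_ (h.isCompact.union h'.isCompact).isClosed)
    · rw [pts_union]
      exact pts_subset_closure hF hS hE
    · rw [pts_union]
      rintro p ⟨e, x, he, hp⟩
      exact Or.inr (Or.inl ⟨e, x, he, hp⟩)
  rwa [h2] at h1

end GraphArcs

/-! ### Equivalence of rays and avoidance of vertices. -/

section RayLemmas

variable {V : Type*} {G : SimpleGraph V}

theorem componentCompl_eq_of_mem {S : Set V} {C D : G.ComponentCompl S} {v : V} (hC : v ∈ C)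
    (hD : v ∈ D) : C = D := by
  by_contra hne
  exact Set.disjoint_left.1 (SimpleGraph.ComponentCompl.pairwise_disjoint hne) hC hD

theorem rayEquiv_of_meet {r r' : Ray G} (h : ∀ N, ∃ n m, N ≤ n ∧ N ≤ m ∧
    (r.toFun n = r'.toFun m ∨ G.Adj (r.toFun n) (r'.toFun m))) :
    (Quotient.mk (raySetoid G) r : Ends G) = Quotient.mk (raySetoid G) r' := by
  refine Quotient.sound fun S => ?_
  obtain ⟨C, N, hN⟩ := r.exists_hasTailIn S
  obtain ⟨D, M, hM⟩ := r'.exists_hasTailIn S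
  obtain ⟨n, m, hn, hm, hnm⟩ := h (max N M)
  have h1 := hN n ((le_max_left _ _).trans hn)
  have h2 := hM m ((le_max_right _ _).trans hm)
  have hCD : C = D := by
    rcases hnm with h3 | h3
    · rw [h3] at h1
      exact componentCompl_eq_of_mem h1 h2
    · have hS : r'.toFun m ∉ (S : Set V) := by
        obtain ⟨h, -⟩ := h2
        exact h
      exact componentCompl_eq_of_mem (SimpleGraph.ComponentCompl.mem_of_adj _ _ h1 hS h3) h2
  subst hCD
  exact ⟨C, ⟨N, hN⟩, ⟨M, hM⟩⟩

theorem reachable_within_of_walk {A : Set V} {u v : V} (p : G.Walk u v)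
    (hp : ∀ w ∈ p.support, w ∈ A) : (within G A).Reachable u v := by
  induction p with
  | nil => rfl
  | cons h q ih =>
    simp only [SimpleGraph.Walk.support_cons, List.mem_cons, forall_eq_or_imp] at hp
    have hadj : (within G A).Adj _ _ := ⟨h, hp.1, hp.2 _ q.start_mem_support⟩
    exact hadj.reachable.trans (ih hp.2)

theorem exists_adj_reachable_within {a v : V} (h : G.Reachable a v) (hav : a ≠ v) :
    ∃ b, G.Adj a b ∧ (within G {a}ᶜ).Reachable b v := by
  obtain ⟨p, hp⟩ := h.exists_isPath
  cases p with
  | nil => exact absurd rfl hav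
  | cons h q =>
    rw [SimpleGraph.Walk.cons_isPath_iff] at hp
    exact ⟨_, h, reachable_within_of_walk q fun w hw hwa => hp.2 (hwa ▸ hw)⟩

theorem IsRay.eventually_notMem {s : ℕ → V} (hs : IsRay G s) {A : Set V} (hA : A.Finite) :
    ∃ N, ∀ n, N ≤ n → s n ∉ A := by
  obtain ⟨N, hN⟩ := (hA.preimage hs.inj.injOn).bddAbove
  exact ⟨N + 1, fun n hn h => by have := hN (show n ∈ s ⁻¹' A from h); omega⟩

theorem within_compl_le_deleteEdges (G : SimpleGraph V) (x y : V) :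
    within G {x}ᶜ ≤ G.deleteEdges {s(x, y)} := by
  rintro a b ⟨h, ha, hb⟩
  rw [SimpleGraph.deleteEdges_adj]
  refine ⟨h, fun he => ?_⟩
  rcases Sym2.eq_iff.1 (he : s(a, b) = s(x, y)) with ⟨h, -⟩ | ⟨-, h⟩
  · exact ha h
  · exact hb h

end RayLemmas

/-! ### The ends of the ladder are the ends of the tree. -/

section LadderEnds

variable {V : Type*} {T : SimpleGraph V}

theorem not_reachable_deleteEdges (hT : T.IsAcyclic) {x y : V} (h : T.Adj x y) :
    ¬ (T.deleteEdges {s(x, y)}).Reachable x y :=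
  not_reachable_of_not_adj hT (SimpleGraph.deleteEdges_le _) h (by simp)

/-- Projecting to `T` turns the deletion of both copies of `x` into the deletion of `x`. -/
theorem reachable_fst_of_component {x : V} {S : Set (V × Fin 2)}
    (hS : ∀ j, (x, j) ∈ S) (C : (ladder T).ComponentCompl S) {u v : V × Fin 2} (hu : u ∈ C)
    (hv : v ∈ C) : (within T {x}ᶜ).Reachable u.1 v.1 := by
  have hne : ∀ z ∈ C, z.1 ≠ x := by
    rintro ⟨z, j⟩ ⟨h, -⟩ rfl
    exact h (hS j)
  refine subset_of_component C (A := {z | (within T {x}ᶜ).Reachable u.1 z.1}) ?_ hu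
    (SimpleGraph.Reachable.refl _) hv
  intro a ha b hb hau hab
  rw [SimpleGraph.boxProd_adj] at hab
  rcases hab with ⟨h, -⟩ | ⟨-, h⟩
  · exact SimpleGraph.Reachable.trans hau (SimpleGraph.Adj.reachable ⟨h, hne a ha, hne b hb⟩)
  · rw [mem_ofPred_eq, ← h]
    exact hau

/-- The copy of a ray of `T` at level `j`. -/
def liftRay {s : ℕ → V} (hs : IsRay T s) (j : Fin 2) : Ray (ladder T) where
  toFun n := (s n, j)
  injective a b h := hs.inj (congrArg Prod.fst h)
  adj n := by simp [SimpleGraph.boxProd_adj, hs.adj n]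

/-- The end of the ladder that contains the lifts of a ray of `T`. -/
def endOf {s : ℕ → V} (hs : IsRay T s) : Ends (ladder T) :=
  Quotient.mk (raySetoid (ladder T)) (liftRay hs 0)

theorem mk_liftRay {s : ℕ → V} (hs : IsRay T s) (j : Fin 2) :
    (Quotient.mk (raySetoid (ladder T)) (liftRay hs j) : Ends (ladder T)) = endOf hs := by
  refine rayEquiv_of_meet fun N => ⟨N, N, le_rfl, le_rfl, ?_⟩
  by_cases h : j = 0
  · left
    simp [liftRay, h]
  · right
    simp [liftRay, SimpleGraph.boxProd_adj, h]

theorem endOf_shift {s : ℕ → V} (hs : IsRay T s) (k : ℕ) : endOf (hs.shift k) = endOf hs :=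
  rayEquiv_of_meet fun N => ⟨N, k + N, le_rfl, by omega, Or.inl rfl⟩

theorem endOf_eq_of_meet {s s' : ℕ → V} (hs : IsRay T s) (hs' : IsRay T s')
    (h : ∀ N, ∃ n, N ≤ n ∧ ∃ m, s n = s' m) : endOf hs = endOf hs' := by
  refine rayEquiv_of_meet fun N => ?_
  obtain ⟨M, hM⟩ := hs.eventually_notMem ((Set.finite_Iio N).image s')
  obtain ⟨n, hn, m, hnm⟩ := h (max N M)
  refine ⟨n, m, (le_max_left _ _).trans hn, ?_, Or.inl (by simp [liftRay, hnm])⟩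
  by_contra hm
  exact hM n ((le_max_right _ _).trans hn) ⟨m, not_le.1 hm, hnm.symm⟩

/-- If the rays are disjoint, pick `x` on `s` beyond the path `p` that joins their starting
vertices. The two copies of `x` do not separate the lifted rays. So the successor of `x` is joined
to its predecessor in `T - x`, through `s'`, `p` and the beginning of `s`, which closes a cycle
through `x`. -/
theorem exists_meet_of_endOf_eq (hT : T.IsTree) {s s' : ℕ → V} (hs : IsRay T s)
    (hs' : IsRay T s') (h : endOf hs = endOf hs') : ∃ n m, s n = s' m := by
  classical
  by_contra! hne
  obtain ⟨p⟩ := hT.connected.preconnected (s' 0) (s 0)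
  obtain ⟨N, hN⟩ := hs.eventually_notMem (A := {v | v ∈ p.support}) (List.finite_toSet _)
  set x := s (N + 1) with hx
  obtain ⟨C, ⟨n, hn⟩, ⟨m, hm⟩⟩ :=
    (Quotient.exact h : RayEquiv _ _) {(x, (0 : Fin 2)), (x, (1 : Fin 2))}
  have hS : ∀ j : Fin 2, (x, j) ∈ (({(x, (0 : Fin 2)), (x, (1 : Fin 2))} : Finset (V × Fin 2)) :
      Set (V × Fin 2)) := by
    intro j
    have : j = 0 ∨ j = 1 := by omega
    rcases this with rfl | rfl <;> simp
  have h1 := reachable_fst_of_component hS C (hn (max n (N + 2)) (le_max_left _ _)) (hm m le_rfl)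
  have h1' : (within T {x}ᶜ).Reachable (s (max n (N + 2))) (s' m) := h1
  have hsne : ∀ i, i ≠ N + 1 → s i ∈ ({x}ᶜ : Set V) := fun i hi h => hi (hs.inj h)
  have h2 : (within T {x}ᶜ).Reachable (s (N + 2)) (s (max n (N + 2))) :=
    reachable_of_seq (le_max_right _ _) fun k hk _ =>
      ⟨hs.adj k, hsne k (by omega), hsne (k + 1) (by omega)⟩
  have h3 : (within T {x}ᶜ).Reachable (s' 0) (s' m) :=
    reachable_of_seq (Nat.zero_le m) fun k _ _ =>
      ⟨hs'.adj k, fun h => hne _ _ (Eq.symm h), fun h => hne _ _ (Eq.symm h)⟩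
  have h4 : (within T {x}ᶜ).Reachable (s' 0) (s 0) :=
    reachable_within_of_walk p fun w hw hwx => hN (N + 1) (by omega) (by
      rw [← hx, ← (hwx : w = x)]
      exact hw)
  have h5 : (within T {x}ᶜ).Reachable (s 0) (s N) :=
    reachable_of_seq (Nat.zero_le N) fun k _ hk =>
      ⟨hs.adj k, hsne k (by omega), hsne (k + 1) (by omega)⟩
  have h6 := (((h2.trans h1').trans h3.symm).trans h4).trans h5
  refine not_reachable_deleteEdges hT.isAcyclic (hs.adj (N + 1)) (SimpleGraph.Reachable.symm ?_)
  refine (h6.mono (within_compl_le_deleteEdges T x (s (N + 2)))).trans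
    (SimpleGraph.Adj.reachable ?_)
  rw [SimpleGraph.deleteEdges_adj]
  refine ⟨hs.adj N, fun he => ?_⟩
  rcases Sym2.eq_iff.1 (he : s(s N, s (N + 1)) = s(s (N + 1), s (N + 2))) with ⟨h, -⟩ | ⟨h, -⟩ <;>
    have := hs.inj h <;> omega

/-- Every end of the ladder contains the lifts of some ray of `T`. -/
theorem exists_endOf_eq (hT : T.IsTree) (ω : Ends (ladder T)) :
    ∃ (s : ℕ → V) (hs : IsRay T s), endOf hs = ω := by
  classical
  obtain ⟨ρ, rfl⟩ := Quotient.exists_rep ω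
  -- `Q a b` orients the edge towards the side of `T` containing a tail of the projection of `ρ`.
  -- Every vertex has an outgoing edge and no edge is oriented both ways, so following the
  -- orientation yields a ray `s`.
  set Q : V → V → Prop := fun a b => T.Adj a b ∧
    ∃ N, ∀ n, N ≤ n → (T.deleteEdges {s(a, b)}).Reachable b (ρ.toFun n).1 with hQ
  have hQex : ∀ a, ∃ b, Q a b := by
    intro a
    obtain ⟨C, N, hN⟩ := ρ.exists_hasTailIn {(a, (0 : Fin 2)), (a, (1 : Fin 2))}
    have hS : ∀ j : Fin 2, (a, j) ∈ (({(a, (0 : Fin 2)), (a, (1 : Fin 2))} :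
        Finset (V × Fin 2)) : Set (V × Fin 2)) := by
      intro j
      have : j = 0 ∨ j = 1 := by omega
      rcases this with rfl | rfl <;> simp
    have hne : a ≠ (ρ.toFun N).1 := by
      intro h
      obtain ⟨h', -⟩ := hN N le_rfl
      refine h' ?_
      have := hS (ρ.toFun N).2
      rw [h] at this ⊢
      exact this
    obtain ⟨b, hab, hb⟩ := exists_adj_reachable_within (hT.connected.preconnected a _) hne
    exact ⟨b, hab, N, fun n hn => (hb.trans (reachable_fst_of_component hS C (hN N le_rfl)
      (hN n hn))).mono (within_compl_le_deleteEdges T a b)⟩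
  have hQasymm : ∀ a b, Q a b → ¬ Q b a := by
    rintro a b ⟨hab, N, hN⟩ ⟨-, M, hM⟩
    refine not_reachable_deleteEdges hT.isAcyclic hab ?_
    have h2 := hM (max N M) (le_max_right _ _)
    rw [Sym2.eq_swap] at h2
    exact h2.trans (hN (max N M) (le_max_left _ _)).symm
  choose nxt hnxt using hQex
  set s : ℕ → V := fun n => nxt^[n] (ρ.toFun 0).1 with hs
  have hsucc : ∀ n, s (n + 1) = nxt (s n) := fun n => Function.iterate_succ_apply' _ _ _
  have hQs : ∀ n, Q (s n) (s (n + 1)) := fun n => hsucc n ▸ hnxt (s n)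
  have hbr : ∀ n m, n + 1 ≤ m →
      (T.deleteEdges {s(s n, s (n + 1))}).Reachable (s (n + 1)) (s m) := by
    intro n m hm
    induction m, hm using Nat.le_induction with
    | base => rfl
    | succ m hm ih =>
      refine ih.trans (SimpleGraph.Adj.reachable ?_)
      rw [SimpleGraph.deleteEdges_adj]
      refine ⟨(hQs m).1, fun he => ?_⟩
      rcases Sym2.eq_iff.1 (he : s(s m, s (m + 1)) = s(s n, s (n + 1))) with ⟨h, -⟩ | ⟨h, h'⟩
      · rw [h] at ih
        exact not_reachable_deleteEdges hT.isAcyclic (hQs n).1 ih.symm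
      · have h1 := hQs m
        rw [h, h'] at h1
        exact hQasymm _ _ (hQs n) h1
  have hray : IsRay T s := by
    refine ⟨?_, fun n => (hQs n).1⟩
    have hlt : ∀ n m, n < m → s n ≠ s m := by
      intro n m hnm h
      have := hbr n m hnm
      rw [← h] at this
      exact not_reachable_deleteEdges hT.isAcyclic (hQs n).1 this.symm
    intro n m hnm
    rcases lt_trichotomy n m with h | h | h
    · exact absurd hnm (hlt n m h)
    · exact h
    · exact absurd hnm.symm (hlt m n h)
  -- Every vertex is eventually left behind: it does not lie in the branch beyond a late edge of
  -- `s`.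
  have hout : ∀ w, ∃ M, ∀ n, M ≤ n →
      ¬ (T.deleteEdges {s(s n, s (n + 1))}).Reachable (s (n + 1)) w := by
    intro w
    obtain ⟨p⟩ := hT.connected.preconnected w (s 0)
    obtain ⟨M, hM⟩ := hray.eventually_notMem (A := {v | v ∈ p.support}) (List.finite_toSet _)
    refine ⟨M, fun n hn hr => not_reachable_deleteEdges hT.isAcyclic (hQs n).1 ?_⟩
    have h1 : (T.deleteEdges {s(s n, s (n + 1))}).Reachable w (s 0) :=
      (reachable_within_of_walk (A := {s n}ᶜ) p fun v hv hvn => hM n hn (by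
        rw [← (hvn : v = s n)]
        exact hv)).mono (within_compl_le_deleteEdges T (s n) (s (n + 1)))
    have h2 : (T.deleteEdges {s(s n, s (n + 1))}).Reachable (s 0) (s n) :=
      reachable_of_seq (Nat.zero_le n) fun k _ hk => by
        rw [SimpleGraph.deleteEdges_adj]
        refine ⟨hray.adj k, fun he => ?_⟩
        rcases Sym2.eq_iff.1 (he : s(s k, s (k + 1)) = s(s n, s (n + 1))) with ⟨h, -⟩ | ⟨h, -⟩ <;>
          have := hray.inj h <;> omega
    exact (h1.trans h2).symm.trans hr.symm
  refine ⟨s, hray, Quotient.sound fun S => ?_⟩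
  obtain ⟨C, N, hN⟩ := (liftRay hray 0).exists_hasTailIn S
  obtain ⟨D, M, hM⟩ := ρ.exists_hasTailIn S
  choose K hK using hout
  -- For this `n`, the branch beyond the edge from `s n` to `s (n + 1)` avoids the projection of
  -- `S`. So its lift to both levels lies in one component, and by `Q` this lift contains a tail of
  -- `ρ`.
  set n := max N (S.sup fun z => K z.1) with hn
  have hnS : ∀ w j, (T.deleteEdges {s(s n, s (n + 1))}).Reachable (s (n + 1)) w →
      (w, j) ∉ (S : Set (V × Fin 2)) := by
    intro w j hw hS
    refine hK w n ?_ hw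
    exact (Finset.le_sup (f := fun z : V × Fin 2 => K z.1) hS).trans (le_max_right _ _)
  have h0 : (s (n + 1), (0 : Fin 2)) ∈ C := hN (n + 1) ((le_max_left _ _).trans (Nat.le_succ n))
  have hall : ∀ w, (T.deleteEdges {s(s n, s (n + 1))}).Reachable (s (n + 1)) w →
      ∀ j, (w, j) ∈ C := by
    intro w hw
    refine (mem_of_reachable (A := {w | (T.deleteEdges {s(s n, s (n + 1))}).Reachable
      (s (n + 1)) w ∧ ∀ j, (w, j) ∈ C}) ?_ hw ⟨SimpleGraph.Reachable.refl _, fun j => ?_⟩).2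
    · rintro a b ⟨h1, h2⟩ hab
      have h3 := h1.trans hab.reachable
      refine ⟨h3, fun j => SimpleGraph.ComponentCompl.mem_of_adj _ _ (h2 j) (hnS b j h3) ?_⟩
      rw [SimpleGraph.deleteEdges_adj] at hab
      simp [SimpleGraph.boxProd_adj, hab.1]
    · by_cases hj : j = 0
      · rw [hj]
        exact h0
      · refine SimpleGraph.ComponentCompl.mem_of_adj _ _ h0
          (hnS _ _ (SimpleGraph.Reachable.refl _)) ?_
        simp [SimpleGraph.boxProd_adj, Ne.symm hj]
  obtain ⟨-, L, hL⟩ := hQs n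
  have h1 := hall _ (hL (max L M) (le_max_left _ _)) (ρ.toFun (max L M)).2
  obtain rfl := componentCompl_eq_of_mem h1 (hM (max L M) (le_max_right _ _))
  exact ⟨C, ⟨N, hN⟩, ⟨M, hM⟩⟩

/-- Convergence of rays of `T` to ends in `Ψ`. -/
def ladderConv (hT : T.IsTree) (Ψ : Set (Ends (ladder T))) : EndConv T (Ends (ladder T)) where
  conv s ω := ω ∈ Ψ ∧ ∃ hs : IsRay T s, endOf hs = ω
  ray h := h.2.1
  shift h k := ⟨h.1, h.2.1.shift k, (endOf_shift h.2.1 k).trans h.2.2⟩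
  unshift hs h := ⟨h.1, hs, (endOf_shift hs _).symm.trans h.2.2⟩
  meet h h' := exists_meet_of_endOf_eq hT h.2.1 h'.2.1 (h.2.2.trans h'.2.2.symm)
  eq_of_meet h h' hm := h.2.2.symm.trans ((endOf_eq_of_meet h.2.1 h'.2.1 hm).trans h'.2.2)

/-- Prolonging or shortening a ray so that it starts at a given vertex of its component. -/
theorem EndConv.exists_ray_from {Ω : Type*} (𝓔 : EndConv T Ω) {D : SimpleGraph V} (hD : D ≤ T)
    {s : ℕ → V} {ω : Ω} (hs : IsRay D s) (hω : 𝓔.conv s ω) {w : V} (hw : D.Reachable w (s 0)) :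
    ∃ s', IsRay D s' ∧ 𝓔.conv s' ω ∧ s' 0 = w := by
  obtain ⟨p⟩ := hw
  generalize ha : s 0 = a at p
  induction p with
  | nil => exact ⟨s, hs, hω, ha⟩
  | cons h q ih =>
    rename_i u v b
    obtain ⟨s', h1, h2, h3⟩ := ih ha
    by_cases hu : ∃ m, s' m = u
    · obtain ⟨m, rfl⟩ := hu
      exact ⟨_, h1.shift m, 𝓔.shift h2 m, rfl⟩
    · push Not at hu
      have hray : IsRay D (fun n => Nat.casesOn n u s' : ℕ → V) := by
        refine ⟨?_, ?_⟩
        · rintro (_ | a) (_ | b) hab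
          · rfl
          · exact absurd hab.symm (hu b)
          · exact absurd hab (hu a)
          · exact congrArg _ (h1.inj hab)
        · rintro (_ | n)
          · show D.Adj u (s' 0)
            rw [h3]
            exact h
          · exact h1.adj n
      refine ⟨_, hray, 𝓔.unshift (k := 1) (hray.mono hD) ?_, rfl⟩
      have : (fun i => (Nat.casesOn (1 + i) u s' : V)) = s' := by
        funext i
        rw [Nat.add_comm]
      rw [this]
      exact h2

end LadderEnds

/-! ### Bounded cuts inside sets that meet all bases. -/

section BoundedCuts

variable {V : Type*} {T : SimpleGraph V}

theorem adj_deleteEdges_of_ne {x y a b : V} (h : T.Adj a b) (hne : s(a, b) ≠ s(x, y)) :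
    (T.deleteEdges {s(x, y)}).Adj a b := by
  rw [SimpleGraph.deleteEdges_adj]
  exact ⟨h, hne⟩

theorem finite_neighborSet_ladder (hfin : ∀ v, (T.neighborSet v).Finite) (v : V × Fin 2) :
    ((ladder T).neighborSet v).Finite := by
  refine (((hfin v.1).prod (Set.toFinite (univ : Set (Fin 2)))).union
    (Set.toFinite (({v.1} : Set V) ×ˢ (univ : Set (Fin 2))))).subset ?_
  rintro ⟨w, j⟩ h
  rw [SimpleGraph.mem_neighborSet, SimpleGraph.boxProd_adj] at h
  rcases h with ⟨h, -⟩ | ⟨-, h⟩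
  · exact Or.inl ⟨h, trivial⟩
  · exact Or.inr ⟨h.symm, trivial⟩

/-- The two lifts of an edge of `T` form a bounded cut. -/
theorem exists_cut_of_edge (hT : T.IsTree) (Ψ : Set (Ends (ladder T))) {x y : V}
    (hxy : T.Adj x y) : ∃ X : Set (V × Fin 2), (cutEdges (ladder T) X).Nonempty ∧
      IsPsiBounded Ψ (cutEdges (ladder T) X) ∧ cutEdges (ladder T) X ⊆ range (rail x y) := by
  set X : Set (V × Fin 2) := {z | (T.deleteEdges {s(x, y)}).Reachable y z.1} with hX
  have hsub : cutEdges (ladder T) X ⊆ range (rail x y) := by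
    rintro e ⟨he, ⟨a, i⟩, ⟨b, j⟩, rfl, ha, hb⟩
    rw [SimpleGraph.mem_edgeSet, SimpleGraph.boxProd_adj] at he
    rcases he with ⟨hab, rfl⟩ | ⟨-, h⟩
    · refine ⟨i, ?_⟩
      by_contra hne
      refine hb (SimpleGraph.Reachable.trans ha (adj_deleteEdges_of_ne hab fun h => ?_).reachable)
      refine hne (rail_eq_rail.2 ⟨rfl, ?_⟩)
      rcases Sym2.eq_iff.1 h with ⟨h1, h2⟩ | ⟨h1, h2⟩
      · exact Or.inl ⟨h1.symm, h2.symm⟩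
      · exact Or.inr ⟨h2.symm, h1.symm⟩
    · obtain rfl : a = b := h
      exact absurd ha hb
  refine ⟨X, ⟨rail x y 0, rail_mem hxy, (y, 0), (x, 0), Sym2.eq_swap,
    SimpleGraph.Reachable.refl y, fun h => ?_⟩,
    isPsiBounded_of_finite Ψ ((Set.finite_range _).subset hsub), hsub⟩
  exact not_reachable_deleteEdges hT.isAcyclic hxy (SimpleGraph.Reachable.symm h)

/-- A component `Z` to which no ray in `Z` converges yields a bounded cut consisting of the rungs
of `Z` and one lift of each edge leaving `Z`. -/
theorem exists_cut_of_component (hT : T.IsTree) (Ψ : Set (Ends (ladder T))) {D : SimpleGraph V}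
    {v : V} (hD : D ≤ T) {F : Set (Sym2 (V × Fin 2))}
    (h1 : ∀ R t, (∀ x, D.Reachable v x → x ∉ R) → ¬ Term (ladderConv hT Ψ) D R v t)
    (h2 : ∀ x, D.Reachable v x → rung x ∈ F)
    (h3 : ∀ x y, D.Reachable v x → ¬ D.Reachable v y → T.Adj x y → ∃ j, rail x y j ∈ F) :
    ∃ X : Set (V × Fin 2), (cutEdges (ladder T) X).Nonempty ∧
      IsPsiBounded Ψ (cutEdges (ladder T) X) ∧ cutEdges (ladder T) X ⊆ F := by
  classical
  have hnr := fun x y (h : T.Adj x y) => not_reachable_deleteEdges hT.isAcyclic h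
  have hDle : ∀ x y, D.Reachable v x → ¬ D.Reachable v y → D ≤ T.deleteEdges {s(x, y)} := by
    intro x y hx hy a b hab
    refine adj_deleteEdges_of_ne (hD hab) fun he => ?_
    rcases Sym2.eq_iff.1 he with ⟨rfl, rfl⟩ | ⟨rfl, rfl⟩
    · exact hy (hx.trans hab.reachable)
    · exact hy (hx.trans hab.symm.reachable)
  have hfar : ∀ x y, D.Reachable v x → ¬ D.Reachable v y → T.Adj x y → ∀ w, D.Reachable v w →
      ¬ (T.deleteEdges {s(x, y)}).Reachable y w := fun x y hx hy hxy w hw hr =>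
    hnr x y hxy (((hx.symm.trans hw).mono (hDle x y hx hy)).trans hr.symm)
  -- Level `0` of the component, together with both levels of each branch beyond a leaving edge
  -- whose lift at level `0` is not in `F`. Such an edge contributes its lift at level `1`, which is
  -- then in `F` by `h3`; every other leaving edge contributes its lift at level `0`.
  set X : Set (V × Fin 2) := {z | (D.Reachable v z.1 ∧ z.2 = 0) ∨ ∃ x y, D.Reachable v x ∧
    ¬ D.Reachable v y ∧ T.Adj x y ∧ (T.deleteEdges {s(x, y)}).Reachable y z.1 ∧
    rail x y 0 ∉ F} with hX
  have hXin : ∀ w j, D.Reachable v w → ((w, j) ∈ X ↔ j = 0) := by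
    intro w j hw
    constructor
    · rintro (⟨-, h⟩ | ⟨x, y, hx, hy, hxy, h, -⟩)
      · exact h
      · exact absurd h (hfar x y hx hy hxy w hw)
    · intro h
      exact Or.inl ⟨hw, h⟩
  have hXlevel : ∀ w i j, ¬ D.Reachable v w → (w, i) ∈ X → (w, j) ∈ X := by
    rintro w i j hw (⟨h, -⟩ | h)
    · exact absurd h hw
    · exact Or.inr h
  have hXout : ∀ a b i, ¬ D.Reachable v a → ¬ D.Reachable v b → T.Adj a b → (a, i) ∈ X →
      (b, i) ∈ X := by
    rintro a b i ha hb hab (⟨h, -⟩ | ⟨x, y, hx, hy, hxy, h, hF⟩)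
    · exact absurd h ha
    · refine Or.inr ⟨x, y, hx, hy, hxy, h.trans (adj_deleteEdges_of_ne hab fun he => ?_).reachable,
        hF⟩
      rcases Sym2.eq_iff.1 he with ⟨rfl, -⟩ | ⟨-, rfl⟩
      · exact ha hx
      · exact hb hx
  have hXbd : ∀ a b i, D.Reachable v a → ¬ D.Reachable v b → T.Adj a b →
      ((b, i) ∈ X ↔ rail a b 0 ∉ F) := by
    intro a b i ha hb hab
    constructor
    · rintro (⟨h, -⟩ | ⟨x, y, hx, hy, hxy, h, hF⟩)
      · exact absurd h hb
      · have he : s(a, b) = s(x, y) := by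
          by_contra hne
          exact hfar x y hx hy hxy a ha (h.trans (adj_deleteEdges_of_ne hab hne).symm.reachable)
        rcases Sym2.eq_iff.1 he with ⟨rfl, rfl⟩ | ⟨rfl, rfl⟩
        · exact hF
        · exact absurd ha hy
    · intro hF
      exact Or.inr ⟨a, b, ha, hb, hab, SimpleGraph.Reachable.refl b, hF⟩
  have hbdF : ∀ a b i, D.Reachable v a → ¬ D.Reachable v b → T.Adj a b →
      ¬ ((a, i) ∈ X ↔ (b, i) ∈ X) → rail a b i ∈ F := by
    intro a b i ha hb hab hne
    rw [hXin a i ha, hXbd a b i ha hb hab] at hne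
    obtain ⟨k, hk⟩ := h3 a b ha hb hab
    have hi : i = 0 ∨ i = 1 := by omega
    have hk' : k = 0 ∨ k = 1 := by omega
    rcases hi with rfl | rfl
    · by_contra hF
      exact hne (by simp [hF])
    · rcases hk' with rfl | rfl
      · simp [hk] at hne
      · exact hk
  have hstruct : ∀ e ∈ cutEdges (ladder T) X, e ∈ F ∧ ((∃ z, D.Reachable v z ∧ e = rung z) ∨
      ∃ a b j, D.Reachable v a ∧ ¬ D.Reachable v b ∧ T.Adj a b ∧ e = rail a b j) := by
    rintro e ⟨he, ⟨a, i⟩, ⟨b, j⟩, rfl, ha, hb⟩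
    have he' := he
    rw [SimpleGraph.mem_edgeSet, SimpleGraph.boxProd_adj] at he
    rcases he with ⟨hab, rfl⟩ | ⟨hij, h⟩
    · by_cases haZ : D.Reachable v a <;> by_cases hbZ : D.Reachable v b
      · exact absurd ((hXin b i hbZ).2 ((hXin a i haZ).1 ha)) hb
      · exact ⟨hbdF a b i haZ hbZ hab (by tauto), Or.inr ⟨a, b, i, haZ, hbZ, hab, rfl⟩⟩
      · have := hbdF b a i hbZ haZ hab.symm (by tauto)
        rw [rail_comm] at this
        exact ⟨this, Or.inr ⟨b, a, i, hbZ, haZ, hab.symm, rail_comm a b i⟩⟩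
      · exact absurd (hXout a b i haZ hbZ hab ha) hb
    · obtain rfl : a = b := h
      by_cases haZ : D.Reachable v a
      · have hi := (hXin a i haZ).1 ha
        subst hi
        have hj : j = 1 := by
          have : j ≠ 0 := fun h => hb ((hXin a j haZ).2 h)
          omega
        subst hj
        exact ⟨h2 a haZ, Or.inl ⟨a, haZ, rfl⟩⟩
      · exact absurd (hXlevel a i j haZ ha) hb
  refine ⟨X, ⟨rung v, rung_mem v, (v, 0), (v, 1), rfl,
    (hXin v 0 (SimpleGraph.Reachable.refl v)).2 rfl, fun h => ?_⟩, ?_, fun e he => (hstruct e he).1⟩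
  · exact absurd ((hXin v 1 (SimpleGraph.Reachable.refl v)).1 h) (by decide)
  -- A ray of `T` from `v` to `ω` leaves the component, which has no end of `Ψ` as a terminal, along
  -- some edge `xy`. Deleting both copies of `x` and `y` leaves `ω` in a part of the branch beyond
  -- `y`, where no edge of the cut has an endvertex.
  refine isPsiBounded_of_exists fun ω hω => ?_
  obtain ⟨s₀, hs₀, hω₀⟩ := exists_endOf_eq hT ω
  obtain ⟨s, hs, ⟨-, hs', hse⟩, hs0⟩ := (ladderConv hT Ψ).exists_ray_from le_rfl hs₀
    ⟨hω, hs₀, hω₀⟩ (hT.connected.preconnected v (s₀ 0))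
  have hleave : ∃ n, ¬ D.Adj (s n) (s (n + 1)) := by
    by_contra! hcon
    exact h1 ∅ (Sum.inr ω) (fun _ _ => notMem_empty _)
      ⟨s, ⟨hs.inj, hcon⟩, ⟨hω, hs', hse⟩, by rw [hs0]⟩
  obtain ⟨n, hn, hmin⟩ : ∃ n, ¬ D.Adj (s n) (s (n + 1)) ∧ ∀ k < n, D.Adj (s k) (s (k + 1)) :=
    ⟨Nat.find hleave, Nat.find_spec hleave, fun k hk => not_not.1 (Nat.find_min hleave hk)⟩
  set x := s n with hx
  set y := s (n + 1) with hy
  have hxZ : D.Reachable v x := by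
    rw [← hs0]
    exact reachable_of_seq (Nat.zero_le n) fun k _ hk => hmin k hk
  have hyZ : ¬ D.Reachable v y := fun h =>
    not_reachable_of_not_adj hT.isAcyclic hD (hs.adj n) hn (hxZ.symm.trans h)
  set S : Finset (V × Fin 2) := {(x, 0), (x, 1), (y, 0), (y, 1)} with hS
  have hSx : ∀ j : Fin 2, (x, j) ∈ (S : Set (V × Fin 2)) := by
    intro j
    have : j = 0 ∨ j = 1 := by omega
    rcases this with rfl | rfl <;> simp [hS]
  have hSy : ∀ j : Fin 2, (y, j) ∈ (S : Set (V × Fin 2)) := by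
    intro j
    have : j = 0 ∨ j = 1 := by omega
    rcases this with rfl | rfl <;> simp [hS]
  obtain ⟨C, hC⟩ := ω.exists_livesIn S
  have hC' := hC
  rw [← hse] at hC'
  obtain ⟨N, hN⟩ := Ray.hasTailIn_of_livesIn (r := liftRay hs' 0) hC'
  have hCbr : ∀ u ∈ C, (T.deleteEdges {s(x, y)}).Reachable y u.1 ∧ u.1 ≠ y := by
    intro u hu
    constructor
    · have h4 : (T.deleteEdges {s(x, y)}).Reachable y (s (max N (n + 1))) :=
        reachable_of_seq (le_max_right _ _) fun k hk _ =>
          adj_deleteEdges_of_ne (hs.adj k) fun he => by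
            rcases Sym2.eq_iff.1 he with ⟨h, -⟩ | ⟨-, h⟩ <;> have := hs.inj h <;> omega
      exact h4.trans ((reachable_fst_of_component hSx C (hN (max N (n + 1)) (le_max_left _ _))
        hu).mono (within_compl_le_deleteEdges T x y))
    · rintro hu'
      obtain ⟨h, -⟩ := hu
      refine h ?_
      have := hSy u.2
      rw [← hu'] at this
      exact this
  have hZC : ∀ u ∈ C, ¬ D.Reachable v u.1 := fun u hu hZ =>
    hfar x y hxZ hyZ (hs.adj n) _ hZ (hCbr u hu).1
  refine ⟨S, C, hC, fun e he u hu huC => ?_⟩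
  rcases (hstruct e he).2 with ⟨z, hz, rfl⟩ | ⟨a, b, j, ha, hb, hab, rfl⟩
  · rcases Sym2.mem_iff.1 hu with rfl | rfl
    · exact hZC _ huC hz
    · exact hZC _ huC hz
  · rcases Sym2.mem_iff.1 hu with rfl | rfl
    · exact hZC _ huC ha
    · obtain ⟨h4, h5⟩ := hCbr _ huC
      refine hfar x y hxZ hyZ (hs.adj n) a ha (h4.trans
        (adj_deleteEdges_of_ne hab.symm fun he => ?_).reachable)
      rcases Sym2.eq_iff.1 he with ⟨h, -⟩ | ⟨h, -⟩
      · exact hb ((show b = x from h) ▸ hxZ)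
      · exact h5 h

theorem exists_cut_of_meets_bases (hT : T.IsTree) (Ψ : Set (Ends (ladder T)))
    {F : Set (Sym2 (V × Fin 2))}
    (hF : ∀ B, (ladderMatroid (ladderConv hT Ψ) hT.isAcyclic).IsBase B → (F ∩ B).Nonempty) :
    ∃ X : Set (V × Fin 2), (cutEdges (ladder T) X).Nonempty ∧
      IsPsiBounded Ψ (cutEdges (ladder T) X) ∧ cutEdges (ladder T) X ⊆ F := by
  rcases exists_of_meets_bases hT.isAcyclic hF with ⟨x, y, hxy, h⟩ | ⟨D, v, hD, h1, h2, h3⟩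
  · obtain ⟨X, hX1, hX2, hX3⟩ := exists_cut_of_edge hT Ψ hxy
    refine ⟨X, hX1, hX2, hX3.trans ?_⟩
    rintro _ ⟨j, rfl⟩
    exact h j
  · exact exists_cut_of_component hT Ψ hD h1 h2 h3

end BoundedCuts

/-! ### Circles between two terminals. -/

section Circuits

variable {V : Type*} {T : SimpleGraph V} {Ψ : Set (Ends (ladder T))}

/-- The lifts to level `j` of the edges `s i, s (i + 1)` with `i ∈ I`. -/
def railsAlong (s : ℕ → V) (I : Set ℕ) (j : Fin 2) : Set (Sym2 (V × Fin 2)) :=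
  (fun i => rail (s i) (s (i + 1)) j) '' I

theorem railsAlong_inter {s s' : ℕ → V} {I I' : Set ℕ} {i j : Fin 2} (hij : i ≠ j) :
    railsAlong s I i ∩ railsAlong s' I' j ⊆ ∅ := by
  rintro _ ⟨⟨a, -, rfl⟩, b, -, h⟩
  exact hij (rail_eq_rail.1 h).1.symm

theorem railsAlong_inter_rung {s : ℕ → V} {I : Set ℕ} {j : Fin 2} {v : V} :
    railsAlong s I j ∩ {rung v} ⊆ ∅ := by
  rintro _ ⟨⟨a, -, rfl⟩, h⟩
  exact rung_ne_rail _ _ _ _ (Eq.symm h)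

theorem railsAlong_subset {s : ℕ → V} {I : Set ℕ} {j : Fin 2} {C : Set (Sym2 (V × Fin 2))}
    (h : ∀ i ∈ I, (doubled T C).Adj (s i) (s (i + 1))) : railsAlong s I j ⊆ C := by
  rintro _ ⟨i, hi, rfl⟩
  exact (h i hi).2 j

theorem railsAlong_subset_edgeSet {s : ℕ → V} {I : Set ℕ} {j : Fin 2}
    (h : ∀ i ∈ I, T.Adj (s i) (s (i + 1))) : railsAlong s I j ⊆ (ladder T).edgeSet := by
  rintro _ ⟨i, hi, rfl⟩
  exact rail_mem (h i hi)

theorem adj_rung (v : V) : (ladder T).Adj (v, 0) (v, 1) := rung_mem (T := T) v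

theorem isArc_rung (v : V) :
    IsArc (pts Ψ {(v, 0), (v, 1)} {rung v} ∅) (vertPt Ψ (v, 0)) (vertPt Ψ (v, 1)) :=
  isArc_edge (adj_rung v)

theorem isArc_liftRay {s : ℕ → V} {hT : T.IsTree} {ω : Ends (ladder T)}
    (hs : (ladderConv hT Ψ).conv s ω) (j : Fin 2) :
    IsArc (pts Ψ (range fun n => (s n, j)) (railsAlong s univ j) {ω}) (vertPt Ψ (s 0, j))
      (endPt hs.1) := by
  have := isArc_ray (liftRay hs.2.1 j) ((mk_liftRay hs.2.1 j).trans hs.2.2) hs.1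
  rw [railsAlong, image_univ]
  exact this

theorem exists_ray_of_conv {s : ℕ → V} {hT : T.IsTree} {ω : Ends (ladder T)}
    (hs : (ladderConv hT Ψ).conv s ω) (j : Fin 2) {F : Set (Sym2 (V × Fin 2))}
    (hF : railsAlong s univ j ⊆ F) : ∃ r : Ray (ladder T),
      (Quotient.mk (raySetoid (ladder T)) r : Ends (ladder T)) = ω ∧
      ∀ n, s(r.toFun n, r.toFun (n + 1)) ∈ F :=
  ⟨liftRay hs.2.1 j, (mk_liftRay hs.2.1 j).trans hs.2.2, fun n => hF ⟨n, trivial, rfl⟩⟩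

theorem isArc_liftPath {s : ℕ → V} {n : ℕ} (hn : 0 < n) (hinj : InjOn s (Iic n))
    (hadj : ∀ i < n, T.Adj (s i) (s (i + 1))) (j : Fin 2) :
    IsArc (pts Ψ ((fun i => (s i, j)) '' Iic n) (railsAlong s (Iio n) j) ∅)
      (vertPt Ψ (s 0, j)) (vertPt Ψ (s n, j)) :=
  isArc_path (G := ladder T) (s := fun i => (s i, j)) hn
    (fun _ ha _ hb h => hinj ha hb (congrArg Prod.fst h))
    fun i hi => rail_mem (j := j) (hadj i hi)

theorem exists_mem_railsAlong {s : ℕ → V} {n : ℕ} {I : Set ℕ} {j : Fin 2}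
    (h : n ∈ I ∨ ∃ k ∈ I, n = k + 1) : ∃ e ∈ railsAlong s I j, (s n, j) ∈ e := by
  rcases h with h | ⟨k, hk, rfl⟩
  · exact ⟨_, ⟨n, h, rfl⟩, Sym2.mem_mk_left _ _⟩
  · exact ⟨_, ⟨k, hk, rfl⟩, Sym2.mem_mk_right _ _⟩

variable (hT : T.IsTree) (hfin : ∀ v, (T.neighborSet v).Finite)

include hfin

/-- There is one kind of circle for each kind of pair of terminals: two rungs here, a rung and an
end in `circle_of_ray`, two ends in `circle_of_double_ray`. -/
theorem circle_of_path {s : ℕ → V} {n : ℕ} (hn : 0 < n) (hinj : InjOn s (Iic n))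
    (hadj : ∀ i < n, T.Adj (s i) (s (i + 1))) :
    Nonempty (closure (edgePoints Ψ ((railsAlong s (Iio n) 0 ∪ {rung (s n)} ∪
      railsAlong s (Iio n) 1) ∪ {rung (s 0)})) ≃ₜ Circle) := by
  have h0n : s 0 ≠ s n := fun h => by
    have := hinj (mem_Iic.2 (Nat.zero_le n)) (mem_Iic.2 le_rfl) h
    omega
  have hmem : ∀ k, k ≤ n → k ∈ Iio n ∨ ∃ l ∈ Iio n, k = l + 1 := by
    intro k hk
    rcases Nat.lt_or_ge k n with h | h
    · exact Or.inl h
    · exact Or.inr ⟨n - 1, mem_Iio.2 (by omega), by omega⟩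
  have harc1 := (isArc_liftPath (Ψ := Ψ) hn hinj hadj 0).trans_pts (isArc_rung (s n)) ?_
    railsAlong_inter_rung inter_subset_left
  · have harc2 := harc1.trans_pts (isArc_liftPath (Ψ := Ψ) hn hinj hadj 1).symm ?_ ?_ ?_
    · refine isPsiCircuit_of_arcs (finite_neighborSet_ladder hfin) harc2 (isArc_rung (s 0)) ?_ ?_ ?_
        ?_
      · refine (pts_mono inter_subset_right ?_ inter_subset_right).trans pts_pair_vert
        rw [union_inter_distrib_right, union_inter_distrib_right]
        refine union_subset (union_subset railsAlong_inter_rung ?_) railsAlong_inter_rung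
        rintro _ ⟨rfl, h⟩
        exact h0n (rung_eq_rung.1 h).symm
      · refine union_subset (union_subset (union_subset (railsAlong_subset_edgeSet hadj) ?_)
          (railsAlong_subset_edgeSet hadj)) ?_ <;>
        exact singleton_subset_iff.2 (rung_mem _)
      · rintro v (((⟨k, hk, rfl⟩ | hv) | ⟨k, hk, rfl⟩) | hv)
        · obtain ⟨e, he, hv⟩ := exists_mem_railsAlong (s := s) (j := 0) (hmem k hk)
          exact ⟨e, Or.inl (Or.inl (Or.inl he)), hv⟩
        · exact ⟨_, Or.inl (Or.inl (Or.inr rfl)), Sym2.mem_iff.2 hv⟩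
        · obtain ⟨e, he, hv⟩ := exists_mem_railsAlong (s := s) (j := 1) (hmem k hk)
          exact ⟨e, Or.inl (Or.inr he), hv⟩
        · exact ⟨_, Or.inr rfl, Sym2.mem_iff.2 hv⟩
      · rintro ω h
        simp at h
    · rintro v ⟨⟨k, hk, rfl⟩ | rfl | h, k', hk', h'⟩
      · exact absurd (congrArg Prod.snd h') (by simp)
      · exact absurd (congrArg Prod.snd h') (by simp)
      · exact h
    · rw [union_inter_distrib_right]
      refine union_subset (railsAlong_inter (by decide)) ?_
      rw [inter_comm]
      exact railsAlong_inter_rung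
    · exact inter_subset_right
  · rintro v ⟨⟨k, hk, rfl⟩, h | h⟩
    · exact h
    · exact absurd (congrArg Prod.snd h) (by simp)

theorem circle_of_ray {s : ℕ → V} {ω : Ends (ladder T)} (hs : (ladderConv hT Ψ).conv s ω) :
    Nonempty (closure (edgePoints Ψ (railsAlong s univ 0 ∪
      ({rung (s 0)} ∪ railsAlong s univ 1))) ≃ₜ Circle) := by
  have hinj := hs.2.1.inj
  have hadj := hs.2.1.adj
  have harc := (isArc_rung (Ψ := Ψ) (s 0)).trans_pts (isArc_liftRay hs 1) ?_ ?_ ?_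
  · refine isPsiCircuit_of_arcs (finite_neighborSet_ladder hfin) (isArc_liftRay hs 0) harc ?_ ?_ ?_
      ?_
    · refine (pts_mono ?_ ?_ inter_subset_left).trans (pts_vert_end hs.1)
      · rintro v ⟨⟨k, rfl⟩, (h | h) | ⟨k', h⟩⟩
        · exact h
        · exact absurd (congrArg Prod.snd h) (by simp)
        · exact absurd (congrArg Prod.snd h) (by simp)
      · rw [inter_union_distrib_left]
        exact union_subset railsAlong_inter_rung (railsAlong_inter (by decide))
    · exact union_subset (railsAlong_subset_edgeSet fun i _ => hadj i) (union_subset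
        (singleton_subset_iff.2 (rung_mem _)) (railsAlong_subset_edgeSet fun i _ => hadj i))
    · rintro v (⟨k, rfl⟩ | hv | ⟨k, rfl⟩)
      · obtain ⟨e, he, hv⟩ := exists_mem_railsAlong (s := s) (j := 0) (Or.inl (mem_univ k))
        exact ⟨e, Or.inl he, hv⟩
      · exact ⟨_, Or.inr (Or.inl rfl), Sym2.mem_iff.2 hv⟩
      · obtain ⟨e, he, hv⟩ := exists_mem_railsAlong (s := s) (j := 1) (Or.inl (mem_univ k))
        exact ⟨e, Or.inr (Or.inr he), hv⟩
    · rintro ω' h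
      have : ω' = ω := by simpa using h
      rw [this]
      exact exists_ray_of_conv hs 0 subset_union_left
  · rintro v ⟨h | h, k, hk⟩
    · rw [h] at hk
      exact absurd (congrArg Prod.snd hk) (by simp)
    · exact h
  · rw [inter_comm]
    exact railsAlong_inter_rung
  · exact inter_subset_left

theorem circle_of_double_ray {s s' : ℕ → V} {ω ω' : Ends (ladder T)}
    (hs : (ladderConv hT Ψ).conv s ω) (hs' : (ladderConv hT Ψ).conv s' ω') (hω : ω ≠ ω')
    (h0 : s 0 = s' 0) (hss : ∀ n m, s n = s' m → n = 0) :
    Nonempty (closure (edgePoints Ψ ((railsAlong s univ 0 ∪ railsAlong s' univ 0) ∪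
      (railsAlong s univ 1 ∪ railsAlong s' univ 1))) ≃ₜ Circle) := by
  have hinj := hs.2.1.inj
  have hadj := hs.2.1.adj
  have hinj' := hs'.2.1.inj
  have hadj' := hs'.2.1.adj
  have harc : ∀ j, IsArc (pts Ψ ((range fun n => (s n, j)) ∪ range fun n => (s' n, j))
      (railsAlong s univ j ∪ railsAlong s' univ j) ({ω} ∪ {ω'})) (endPt hs.1) (endPt hs'.1) := by
    intro j
    have h1 := isArc_liftRay hs' j
    rw [← h0] at h1
    refine (isArc_liftRay hs j).symm.trans_pts h1 ?_ ?_ ?_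
    · rintro _ ⟨⟨n, rfl⟩, m, h⟩
      have := hss n m (congrArg Prod.fst h).symm
      subst this
      rfl
    · rintro _ ⟨⟨n, -, rfl⟩, m, -, h⟩
      rcases (rail_eq_rail.1 h).2 with ⟨h1, h2⟩ | ⟨h1, h2⟩
      · have := hss (n + 1) _ h2.symm
        omega
      · have := hss (n + 1) _ h1.symm
        omega
    · rintro _ ⟨rfl, h⟩
      exact hω h
  refine isPsiCircuit_of_arcs (finite_neighborSet_ladder hfin) (harc 0) (harc 1) ?_ ?_ ?_ ?_
  · refine (pts_mono ?_ ?_ inter_subset_left).trans (pts_pair_end hs.1 hs'.1)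
    · rintro _ ⟨⟨n, rfl⟩ | ⟨n, rfl⟩, ⟨m, h⟩ | ⟨m, h⟩⟩ <;>
        exact absurd (congrArg Prod.snd h) (by simp)
    · rw [union_inter_distrib_right, inter_union_distrib_left, inter_union_distrib_left]
      exact union_subset
        (union_subset (railsAlong_inter (by decide)) (railsAlong_inter (by decide)))
        (union_subset (railsAlong_inter (by decide)) (railsAlong_inter (by decide)))
  · have h1 : ∀ j, railsAlong s univ j ⊆ (ladder T).edgeSet := fun j =>
      railsAlong_subset_edgeSet fun i _ => hadj i
    have h2 : ∀ j, railsAlong s' univ j ⊆ (ladder T).edgeSet := fun j =>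
      railsAlong_subset_edgeSet fun i _ => hadj' i
    exact union_subset (union_subset (h1 0) (h2 0)) (union_subset (h1 1) (h2 1))
  · rintro v ((⟨k, rfl⟩ | ⟨k, rfl⟩) | ⟨k, rfl⟩ | ⟨k, rfl⟩)
    · obtain ⟨e, he, hv⟩ := exists_mem_railsAlong (s := s) (j := 0) (Or.inl (mem_univ k))
      exact ⟨e, Or.inl (Or.inl he), hv⟩
    · obtain ⟨e, he, hv⟩ := exists_mem_railsAlong (s := s') (j := 0) (Or.inl (mem_univ k))
      exact ⟨e, Or.inl (Or.inr he), hv⟩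
    · obtain ⟨e, he, hv⟩ := exists_mem_railsAlong (s := s) (j := 1) (Or.inl (mem_univ k))
      exact ⟨e, Or.inr (Or.inl he), hv⟩
    · obtain ⟨e, he, hv⟩ := exists_mem_railsAlong (s := s') (j := 1) (Or.inl (mem_univ k))
      exact ⟨e, Or.inr (Or.inr he), hv⟩
  · intro ω'' h
    have : ω'' = ω' ∨ ω'' = ω := by simpa using h
    rcases this.symm with rfl | rfl
    · exact exists_ray_of_conv hs 0 (subset_union_left.trans subset_union_left)
    · exact exists_ray_of_conv hs' 0 (subset_union_right.trans subset_union_left)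

omit hfin in
theorem not_ladderIndep {C : Set (Sym2 (V × Fin 2))} {v : V} {t t' : V ⊕ Ends (ladder T)}
    (h : Term (ladderConv hT Ψ) (doubled T C) (rungs C) v t)
    (h' : Term (ladderConv hT Ψ) (doubled T C) (rungs C) v t') (hne : t ≠ t') :
    ¬ LadderIndep (ladderConv hT Ψ) C := fun hC => hne (hC.2 v t t' h h')

/-- Every dependent set contains a dependent set whose closure is a circle. -/
theorem exists_circle_subset {C : Set (Sym2 (V × Fin 2))} (hC : C ⊆ (ladder T).edgeSet)
    (hdep : ¬ LadderIndep (ladderConv hT Ψ) C) :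
    ∃ C₀ ⊆ C, Nonempty (closure (edgePoints Ψ C₀) ≃ₜ Circle) ∧
      ¬ LadderIndep (ladderConv hT Ψ) C₀ := by
  have hadd : ∀ {s : ℕ → V} {I : Set ℕ} {C₀ : Set (Sym2 (V × Fin 2))},
      (∀ i ∈ I, T.Adj (s i) (s (i + 1))) → railsAlong s I 0 ⊆ C₀ → railsAlong s I 1 ⊆ C₀ →
      ∀ i ∈ I, (doubled T C₀).Adj (s i) (s (i + 1)) := by
    intro s I C₀ hadj h0 h1 i hi
    refine ⟨hadj i hi, fun j => ?_⟩
    have : j = 0 ∨ j = 1 := by omega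
    rcases this with rfl | rfl
    · exact h0 ⟨i, hi, rfl⟩
    · exact h1 ⟨i, hi, rfl⟩
  have hmixed : ∀ w ω, w ∈ rungs C → Term (ladderConv hT Ψ) (doubled T C) (rungs C) w (Sum.inr ω) →
      ∃ C₀ ⊆ C, Nonempty (closure (edgePoints Ψ C₀) ≃ₜ Circle) ∧
        ¬ LadderIndep (ladderConv hT Ψ) C₀ := by
    rintro w ω hw ⟨s₀, h1, h2, h3⟩
    obtain ⟨s, hs1, hs2, rfl⟩ := EndConv.exists_ray_from _ (doubled_le T C) h1 h2 h3
    refine ⟨_, ?_, circle_of_ray hT hfin hs2, ?_⟩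
    · exact union_subset (railsAlong_subset fun i _ => hs1.adj i) (union_subset
        (singleton_subset_iff.2 hw) (railsAlong_subset fun i _ => hs1.adj i))
    · refine not_ladderIndep hT (v := s 0) (t := Sum.inl (s 0)) (t' := Sum.inr ω)
        ⟨Or.inr (Or.inl rfl), SimpleGraph.Reachable.refl _⟩
        ⟨s, ⟨hs1.inj, fun n => hadd (I := univ) (fun i _ => hs2.2.1.adj i) ?_ ?_ n trivial⟩, hs2,
          SimpleGraph.Reachable.refl _⟩ (by simp)
      · exact subset_union_left
      · exact subset_union_right.trans subset_union_right
  have hdep' : ¬ AtMostOne (ladderConv hT Ψ) (doubled T C) (rungs C) := fun h => hdep ⟨hC, h⟩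
  unfold AtMostOne at hdep'
  push Not at hdep'
  obtain ⟨v, t, t', ht, ht', hne⟩ := hdep'
  rcases t with w | ω <;> rcases t' with w' | ω'
  · obtain ⟨p, hp⟩ := (ht.2.symm.trans ht'.2).exists_isPath
    have hww : w ≠ w' := fun h => hne (by rw [h])
    have hn : 0 < p.length := by
      rw [Nat.pos_iff_ne_zero]
      exact fun h => hww (SimpleGraph.Walk.eq_of_length_eq_zero h)
    set s : ℕ → V := p.getVert with hs
    have hs0 : s 0 = w := p.getVert_zero
    have hsn : s p.length = w' := p.getVert_length
    have hadj : ∀ i < p.length, (doubled T C).Adj (s i) (s (i + 1)) := fun i hi =>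
      p.adj_getVert_succ hi
    have hinj : InjOn s (Iic p.length) := hp.getVert_injOn
    refine ⟨_, ?_, circle_of_path hfin hn hinj fun i hi => (hadj i hi).1, ?_⟩
    · refine union_subset (union_subset (union_subset (railsAlong_subset hadj) ?_)
        (railsAlong_subset hadj)) ?_
      · rw [singleton_subset_iff, hsn]
        exact ht'.1
      · rw [singleton_subset_iff, hs0]
        exact ht.1
    · refine not_ladderIndep hT (v := s 0) (t := Sum.inl (s 0)) (t' := Sum.inl (s p.length))
        ⟨Or.inr rfl, SimpleGraph.Reachable.refl _⟩
        ⟨Or.inl (Or.inl (Or.inr rfl)), reachable_of_seq (Nat.zero_le _) fun k _ hk =>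
          hadd (I := Iio p.length) (fun i hi => (hadj i hi).1) ?_ ?_ k hk⟩ ?_
      · exact (subset_union_left.trans subset_union_left).trans subset_union_left
      · exact subset_union_right.trans subset_union_left
      · rw [hs0, hsn]
        exact fun h => hww (Sum.inl.inj h)
  · exact hmixed w ω' ht.1 (ht'.of_reachable ht.2.symm)
  · exact hmixed w' ω ht'.1 (ht.of_reachable ht'.2.symm)
  · classical
    have hωω : ω ≠ ω' := fun h => hne (by rw [h])
    obtain ⟨s, hs1, hs2, hs3⟩ := ht
    obtain ⟨s₀, h1, h2, h3⟩ := ht'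
    obtain ⟨s', hs1', hs2', hs3'⟩ := EndConv.exists_ray_from _ (doubled_le T C) h1 h2
      (hs3.symm.trans h3)
    have hfinal : ∃ N, ∀ n, N ≤ n → ∀ m, s n ≠ s' m := by
      by_contra! hcon
      exact hωω ((ladderConv hT Ψ).eq_of_meet hs2 hs2' hcon)
    -- Starting both rays at the last vertex of `s` on `s'` makes them share only their first
    -- vertex, so that they form a double ray.
    obtain ⟨m, k, hmk, hlast⟩ : ∃ m k, s m = s' k ∧ ∀ n, m < n → ∀ l, s n ≠ s' l := by
      have hspec := Nat.find_spec hfinal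
      have hpos : Nat.find hfinal ≠ 0 := by
        intro h
        rw [h] at hspec
        exact hspec 0 le_rfl 0 hs3'.symm
      obtain ⟨m, hm⟩ := Nat.exists_eq_succ_of_ne_zero hpos
      have hmin := Nat.find_min hfinal (m := m) (by omega)
      push Not at hmin
      obtain ⟨n, hn, k, hnk⟩ := hmin
      obtain rfl : n = m := by
        by_contra hne'
        exact hspec n (by omega) k hnk
      exact ⟨n, k, hnk, fun l hl j => hspec l (by omega) j⟩
    have hc := (ladderConv hT Ψ).shift hs2 m
    have hc' := (ladderConv hT Ψ).shift hs2' k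
    have hr := hs1.shift m
    have hr' := hs1'.shift k
    refine ⟨_, ?_, circle_of_double_ray hT hfin hc hc' hωω hmk fun n l h => ?_, ?_⟩
    · exact union_subset (union_subset (railsAlong_subset fun i _ => hr.adj i)
        (railsAlong_subset fun i _ => hr'.adj i)) (union_subset
        (railsAlong_subset fun i _ => hr.adj i) (railsAlong_subset fun i _ => hr'.adj i))
    · by_contra hn
      exact hlast (m + n) (by omega) _ h
    · refine not_ladderIndep hT (v := s m) (t := Sum.inr ω) (t' := Sum.inr ω')
        ⟨_, ⟨hr.inj, fun n => hadd (I := univ) (fun i _ => hc.2.1.adj i) ?_ ?_ n trivial⟩, hc,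
          SimpleGraph.Reachable.refl _⟩
        ⟨_, ⟨hr'.inj, fun n => hadd (I := univ) (fun i _ => hc'.2.1.adj i) ?_ ?_ n trivial⟩, hc',
          ?_⟩ hne
      · exact subset_union_left.trans subset_union_left
      · exact subset_union_left.trans subset_union_right
      · exact subset_union_right.trans subset_union_left
      · exact subset_union_right.trans subset_union_right
      · rw [hmk]
        exact SimpleGraph.Reachable.refl _

end Circuits

/-! ### Circuits and cocircuits of the ladder matroid. -/

section Main

variable {V : Type*} {T : SimpleGraph V}

theorem inducesMatroid_ladder (hT : T.IsTree) (hfin : ∀ v, (T.neighborSet v).Finite)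
    (Ψ : Set (Ends (ladder T))) : InducesMatroid (ladder T) Ψ := by
  set M := ladderMatroid (ladderConv hT Ψ) hT.isAcyclic with hM
  have hE : M.E = (ladder T).edgeSet := rfl
  have hfin' := finite_neighborSet_ladder hfin
  have hIndep : ∀ I, M.Indep I ↔ LadderIndep (ladderConv hT Ψ) I := fun I => Iff.rfl
  have hcirc : ∀ C, M.IsCircuit C → Nonempty (closure (edgePoints Ψ C) ≃ₜ Circle) := by
    intro C hC
    obtain ⟨C₀, h1, h2, h3⟩ := exists_circle_subset hT hfin hC.subset_ground hC.not_indep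
    rwa [hC.eq_of_not_indep_subset h3 h1] at h2
  have hmeet : ∀ X, (cutEdges (ladder T) X).Nonempty → IsPsiBounded Ψ (cutEdges (ladder T) X) →
      ∀ B, M.IsBase B → (cutEdges (ladder T) X ∩ B).Nonempty := by
    rintro X ⟨e, he⟩ hX B hB
    by_contra hempty
    rw [not_nonempty_iff_eq_empty] at hempty
    have heB : e ∉ B := fun h => notMem_empty e (hempty ▸ ⟨he, h⟩)
    have hC := hB.fundCircuit_isCircuit (x := e) he.1 heB
    -- If the cut missed `B`, the fundamental circuit of `e` would be a circle meeting the cut only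
    -- in `e`.
    refine inter_cutEdges_ne_singleton hC.subset_ground (hcirc _ hC) hX e ?_
    refine Subset.antisymm ?_ (singleton_subset_iff.2 ⟨M.mem_fundCircuit e B, he⟩)
    rintro f ⟨hf, hfX⟩
    rcases M.fundCircuit_subset_insert e B hf with h | h
    · exact h
    · exact absurd ⟨hfX, h⟩ (hempty ▸ notMem_empty f)
  have hcut : ∀ F, (F.Nonempty ∧ IsCut (ladder T) F ∧ IsPsiBounded Ψ F) ↔
      ∃ X, F = cutEdges (ladder T) X ∧ (cutEdges (ladder T) X).Nonempty ∧
        IsPsiBounded Ψ (cutEdges (ladder T) X) := by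
    intro F
    constructor
    · rintro ⟨h1, ⟨X, rfl⟩, h3⟩
      exact ⟨X, rfl, h1, h3⟩
    · rintro ⟨X, rfl, h1, h3⟩
      exact ⟨h1, ⟨X, rfl⟩, h3⟩
  refine ⟨M, hE, fun F => ⟨fun hF => ?_, fun hF => ?_⟩, fun F => ?_⟩
  · exact (isPsiCircuit_iff hfin').2 ⟨hF.subset_ground, hcirc F hF⟩
  · obtain ⟨hFE, hFc⟩ := (isPsiCircuit_iff hfin').1 hF
    have hdep : ¬ M.Indep F := by
      intro hFI
      obtain ⟨B, hB, hFB⟩ := hFI.exists_isBase_superset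
      have hne : F.Nonempty := by
        rw [nonempty_iff_ne_empty]
        rintro rfl
        obtain ⟨φ⟩ := hFc
        have : edgePoints Ψ (∅ : Set (Sym2 (V × Fin 2))) = ∅ := by
          ext p
          simp [edgePoints]
        have hp : (closure (edgePoints Ψ (∅ : Set (Sym2 (V × Fin 2))))).Nonempty :=
          ⟨_, (φ.symm 1).2⟩
        rw [this, closure_empty] at hp
        exact not_nonempty_empty hp
      obtain ⟨e, he⟩ := hne
      -- A base avoiding this set would be properly contained in `B`. The set therefore contains a
      -- bounded cut; this cut meets `B`, and hence the circle `F ⊆ B`, in `e` alone.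
      obtain ⟨X, hX1, hX2, hX3⟩ := exists_cut_of_meets_bases hT Ψ (F := M.E \ (B \ {e})) (by
        intro B' hB'
        by_contra hempty
        rw [not_nonempty_iff_eq_empty] at hempty
        have hsub : B' ⊆ B \ {e} := by
          intro f hf
          by_contra hfn
          exact notMem_empty f (hempty ▸ ⟨⟨hB'.subset_ground hf, hfn⟩, hf⟩)
        have hBB : B' = B := hB'.eq_of_subset_isBase hB (hsub.trans sdiff_subset)
        exact (hsub (hBB.symm ▸ hFB he)).2 rfl)
      have hXB : ∀ f ∈ cutEdges (ladder T) X, f ∈ B → f = e := by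
        intro f hf hfB
        by_contra hfe
        exact (hX3 hf).2 ⟨hfB, hfe⟩
      obtain ⟨f, hfX, hfB⟩ := hmeet X hX1 hX2 B hB
      obtain rfl := hXB f hfX hfB
      refine inter_cutEdges_ne_singleton hFE hFc hX2 f ?_
      refine Subset.antisymm ?_ (singleton_subset_iff.2 ⟨he, hfX⟩)
      rintro g ⟨hg, hgX⟩
      exact hXB g hgX (hFB hg)
    obtain ⟨C, hCF, hC⟩ := ((M.not_indep_iff hFE).1 hdep).exists_isCircuit_subset
    rw [← eq_of_subset_of_closure_circle hCF hFE (hcirc C hC) hFc]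
    exact hC
  · rw [Matroid.isCocircuit_iff_minimal]
    unfold IsPsiBond
    -- Nonempty bounded cuts meet all bases, and sets meeting all bases contain such cuts, so the
    -- two families have the same minimal members.
    have hto : ∀ F, (F.Nonempty ∧ IsCut (ladder T) F ∧ IsPsiBounded Ψ F) →
        ∀ B, M.IsBase B → (F ∩ B).Nonempty := by
      intro F hF
      obtain ⟨X, rfl, h1, h2⟩ := (hcut F).1 hF
      exact hmeet X h1 h2
    have hfrom : ∀ F, (∀ B, M.IsBase B → (F ∩ B).Nonempty) →
        ∃ F' ⊆ F, F'.Nonempty ∧ IsCut (ladder T) F' ∧ IsPsiBounded Ψ F' := by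
      intro F hF
      obtain ⟨X, h1, h2, h3⟩ := exists_cut_of_meets_bases hT Ψ hF
      exact ⟨_, h3, (hcut _).2 ⟨X, rfl, h1, h2⟩⟩
    constructor
    · rintro ⟨h1, h2⟩
      obtain ⟨F', hF', h3⟩ := hfrom F h1
      obtain rfl : F' = F := hF'.antisymm (h2 (hto F' h3) hF')
      exact ⟨h3, fun F'' h4 h5 => h2 (hto F'' h4) h5⟩
    · rintro ⟨h1, h2⟩
      refine ⟨hto F h1, fun F' h3 h4 => ?_⟩
      obtain ⟨F'', h5, h6⟩ := hfrom F' h3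
      exact (h2 h6 (h5.trans h4)).trans h5

end Main

end PsiSystem

theorem lemma6p11 {V : Type*} (T : SimpleGraph V) (hT : T.IsTree)
    (hfin : ∀ v, (T.neighborSet v).Finite)
    (Ψ : Set (PsiSystem.Ends (T.boxProd (⊤ : SimpleGraph (Fin 2))))) :
    PsiSystem.InducesMatroid (T.boxProd (⊤ : SimpleGraph (Fin 2))) Ψ :=
  PsiSystem.inducesMatroid_ladder hT hfin Ψ
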